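/- Let $\Omega\subset\mathbb R^N$ be a bounded domain (nonempty, open, connected) with smooth ($C^\infty$) boundary, let $\mathcal O\subset\mathbb R^N$ be open with $\overline\Omega\subset\mathcal O$, let $\mathcal S_N$ be the space of real symmetric $N\times N$ matrices with its usual order, and let $F:\mathcal O\times\mathbb R\times\mathbb R^N\times\mathcal S_N\to\mathbb R$ be continuous. Assume: (H1) $F(x,r,p,X+Y)\le F(x,r,p,X)$ for all $(x,r,p,X)$ and all $Y\ge0$ in $\mathcal S_N$; (H2) for some $\alpha>0$, $F(x,\tau r,\tau p,\tau X)=\tau^\alpha F(x,r,p,X)$ for all $(x,r,p,X)$ and all $\tau\ge0$; (H3) $r\mapsto F(x,r,p,X)$ is continuous, uniformly with respect to $(x,p,X)\in\mathcal O\times\mathbb R^N\times\mathcal S_N$; (H4) for all $R>0$ there is $\omega\in C([0,+\infty))$ with $\omega(0)=0$ such that, whenever $X,Y\in\mathcal S_N$ and $\sigma>0$ satisfy $$-3\sigma\begin{pmatrix}I&0\\0&I\end{pmatrix}\le\begin{pmatrix}X&0\\0&-Y\end{pmatrix}\le3\sigma\begin{pmatrix}I&-I\\-I&I\end{pmatrix},$$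 one has $F(y,r,\sigma(x-y),Y)-F(x,r,\sigma(x-y),X)\le\omega(\sigma|x-y|^2+|x-y|)$ for all $x,y\in\mathcal O$, $|r|\le R$; and, for some open neighbourhood $V$ of $\partial\Omega$: (H5) for all $R>0$, $(r,p,X)\mapsto F(x,r,p,X)$ is uniformly continuous in $[0,R]\times\mathbb R^N\times\mathcal S_N$, uniformly with respect to $x\in\overline\Omega\cap V$; (H6) for all $R>0$ there is $K>0$ such that, whenever $X,Y\in\mathcal S_N$ and $\sigma>0$ satisfy $$-\sigma\begin{pmatrix}I&0\\0&I\end{pmatrix}\le\begin{pmatrix}X&0\\0&-Y\end{pmatrix}\le\sigma\begin{pmatrix}I&-I\\-I&I\end{pmatrix},$$ one has $F(y,r,p,Y)-F(x,r,p,X)\le K(1+|x-y||p|+\sigma|x-y|^2)$ for all $x,y\in\overline\Omega\cap V$, $|r|\le R$, $p\in\mathbb R^N$. Write $F[\phi]=F(x,\phi,D\phi,D^2\phi)$; differential inequalities are understood in the viscosity sense. Assume finally that every $\xi\in\partial\Omega$ admits a barrier: there are an open ball $B$ centred at $\xi$ and a nonnegative $w\in C(\overline{\Omega\cap B})$ with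 $w(\xi)=0$ and $F[w]\ge1$ in $\Omega\cap B$. Define, in $[-\infty,+\infty]$, $$\overline\lambda_1(F,\Omega)=\sup\{\lambda\in\mathbb R:\ \exists\,\phi\in LSC(\Omega),\ \inf_\Omega\phi>0,\ F[\phi]-\lambda\phi^\alpha\ge0\text{ in }\Omega\},$$ $$\mu_1(F,\Omega)=\sup\{\lambda\in\mathbb R:\ \exists\,\Omega'\text{ open},\ \overline\Omega\subset\Omega'\subset\mathcal O,\ \exists\,\phi\in LSC(\Omega'),\ \phi>0\text{ and }F[\phi]-\lambda\phi^\alpha\ge0\text{ in }\Omega'\}.$$ Then $$\mu_1(F,\Omega)=\overline\lambda_1(F,\Omega).$$ Consequently, $F$ satisfies the Maximum Principle in $\Omega$ if and only if $\overline\lambda_1(F,\Omega)>0$. Here the Maximum Principle means that $u\le0$ in $\overline\Omega$ for every $u\in USC(\overline\Omega)$ that is a viscosity subsolution of $F[u]=0$ in $\Omega$, $u=0$ on $\partial\Omega$, that is, such that whenever $\varphi\in C^2$ and $u-\varphi$ attains its maximum over $\overline\Omega$ at $\xi$, one has $F(\xi,u(\xi),D\varphi(\xi),D^2\varphi(\xi))\le0$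 if $\xi\in\Omega$, and $\min\big[u(\xi),F(\xi,u(\xi),D\varphi(\xi),D^2\varphi(\xi))\big]\le0$ if $\xi\in\partial\Omega$. -/

import Mathlib

open scoped ContDiff

noncomputable section

namespace DegElliptic

/-- Euclidean space `ℝ^N`. -/
abbrev Eu (N : ℕ) := EuclideanSpace ℝ (Fin N)

/-- Real `N × N` matrices. Operators are only ever constrained at, and evaluated on, symmetric
ones. -/
abbrev Mat (N : ℕ) := Matrix (Fin N) (Fin N) ℝ

/-- A fully nonlinear second order operator `F(x, r, p, X)`. It is a total function; every
hypothesis below concerns only `x` in a given set and symmetric `X`. -/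
abbrev Operator (N : ℕ) := Eu N → ℝ → Eu N → Mat N → ℝ

/-- The Hessian matrix `D²ψ(x)`. -/
def hess {N : ℕ} (ψ : Eu N → ℝ) (x : Eu N) : Mat N :=
  Matrix.of fun i j =>
    fderiv ℝ (fderiv ℝ ψ) x (EuclideanSpace.single i 1) (EuclideanSpace.single j 1)

/-- Joint continuity of `F` on `O × ℝ × ℝ^N × S_N`. -/
def IsContinuousOperator {N : ℕ} (F : Operator N) (O : Set (Eu N)) : Prop :=
  ContinuousOn (fun q : Eu N × ℝ × Eu N × Mat N => F q.1 q.2.1 q.2.2.1 q.2.2.2)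
    {q | q.1 ∈ O ∧ q.2.2.2.IsSymm}

/-- Degenerate ellipticity: `F` is non-increasing in the matrix variable. -/
def IsDegenerateElliptic {N : ℕ} (F : Operator N) (O : Set (Eu N)) : Prop :=
  ∀ x ∈ O, ∀ (r : ℝ) (p : Eu N) (X Y : Mat N), X.IsSymm → Y.IsSymm → Y.PosSemidef →
    F x r p (X + Y) - F x r p X ≤ 0

/-- Positive homogeneity of degree `α` in `(r, p, X)`. -/
def IsHomogeneous {N : ℕ} (F : Operator N) (O : Set (Eu N)) (α : ℝ) : Prop :=
  ∀ x ∈ O, ∀ (r : ℝ) (p : Eu N) (X : Mat N), X.IsSymm → ∀ τ : ℝ, 0 ≤ τ →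
    F x (τ * r) (τ • p) (τ • X) = τ ^ α * F x r p X

/-- `r ↦ F(x, r, p, X)` is continuous, uniformly with respect to `(x, p, X)`. -/
def IsUniformlyContinuousInValue {N : ℕ} (F : Operator N) (O : Set (Eu N)) : Prop :=
  ∀ r : ℝ, ∀ ε > 0, ∃ δ > 0, ∀ s : ℝ, |s - r| < δ →
    ∀ x ∈ O, ∀ (p : Eu N) (X : Mat N), X.IsSymm → |F x s p X - F x r p X| < ε

/-- The two-sided block matrix inequality
`-c (I 0; 0 I) ≤ (X 0; 0 -Y) ≤ c (I -I; -I I)`. -/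
def BlockIneq {N : ℕ} (c : ℝ) (X Y : Mat N) : Prop :=
  (Matrix.fromBlocks X 0 0 (-Y)
      - (-c) • (Matrix.fromBlocks 1 0 0 1 : Matrix (Fin N ⊕ Fin N) (Fin N ⊕ Fin N) ℝ)).PosSemidef ∧
  (c • (Matrix.fromBlocks 1 (-1) (-1) 1 : Matrix (Fin N ⊕ Fin N) (Fin N ⊕ Fin N) ℝ)
      - Matrix.fromBlocks X 0 0 (-Y)).PosSemidef

/-- The structure condition of the comparison theory of viscosity solutions. -/
def StructureCondition {N : ℕ} (F : Operator N) (O : Set (Eu N)) : Prop :=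
  ∀ R > 0, ∃ m : ℝ → ℝ, ContinuousOn m (Set.Ici 0) ∧ m 0 = 0 ∧
    ∀ X Y : Mat N, X.IsSymm → Y.IsSymm → ∀ σ > 0, BlockIneq (3 * σ) X Y →
      ∀ x ∈ O, ∀ y ∈ O, ∀ r : ℝ, |r| ≤ R →
        F y r (σ • (x - y)) Y - F x r (σ • (x - y)) X ≤ m (σ * ‖x - y‖ ^ 2 + ‖x - y‖)

/-- For all `R > 0`, `(r, p, X) ↦ F(x, r, p, X)` is uniformly continuous on
`[0, R] × ℝ^N × S_N`, uniformly with respect to `x ∈ A`. -/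
def IsUniformlyContinuousNear {N : ℕ} (F : Operator N) (A : Set (Eu N)) : Prop :=
  ∀ R > 0, ∀ ε > 0, ∃ δ > 0, ∀ x ∈ A,
    ∀ r ∈ Set.Icc (0 : ℝ) R, ∀ s ∈ Set.Icc (0 : ℝ) R, ∀ p q : Eu N,
    ∀ X Y : Mat N, X.IsSymm → Y.IsSymm →
      |r - s| < δ → ‖p - q‖ < δ → (∀ i j, |X i j - Y i j| < δ) →
        |F x r p X - F x s q Y| < ε

/-- The structure condition required near the boundary, for `x, y ∈ A`. -/
def BoundaryStructureCondition {N : ℕ} (F : Operator N) (A : Set (Eu N)) : Prop :=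
  ∀ R > 0, ∃ K > 0,
    ∀ X Y : Mat N, X.IsSymm → Y.IsSymm → ∀ σ > 0, BlockIneq σ X Y →
      ∀ x ∈ A, ∀ y ∈ A, ∀ r : ℝ, |r| ≤ R → ∀ p : Eu N,
        F y r p Y - F x r p X ≤ K * (1 + ‖x - y‖ * ‖p‖ + σ * ‖x - y‖ ^ 2)

/-- `φ` satisfies `G(x, φ, Dφ, D²φ) ≥ 0` in the open set `U` in the viscosity sense (the
semicontinuity of `φ` is required separately). -/
def IsViscositySupersolution {N : ℕ} (G : Operator N) (U : Set (Eu N)) (φ : Eu N → ℝ) : Prop :=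
  ∀ x ∈ U, ∀ ψ : Eu N → ℝ, ContDiffAt ℝ 2 ψ x →
    IsLocalMinOn (fun y => φ y - ψ y) U x → 0 ≤ G x (φ x) (gradient ψ x) (hess ψ x)

/-- The operator `F[u] - l u^α`, to be used on positive functions `u`. -/
def shifted {N : ℕ} (F : Operator N) (α l : ℝ) : Operator N :=
  fun x r p X => F x r p X - l * r ^ α

/-- `λ̄₁(F, Ω)`: the supremum (in `[-∞, +∞]`) of the real `l` for which there is a lower
semicontinuous `φ` on `Ω` with `inf_Ω φ > 0` and `F[φ] - l φ^α ≥ 0` in `Ω`. -/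
def lambdaBar {N : ℕ} (F : Operator N) (α : ℝ) (Ω : Set (Eu N)) : EReal :=
  sSup ((fun l : ℝ => (l : EReal)) '' {l : ℝ | ∃ φ : Eu N → ℝ,
    LowerSemicontinuousOn φ Ω ∧ (∃ c > 0, ∀ x ∈ Ω, c ≤ φ x) ∧
    IsViscositySupersolution (shifted F α l) Ω φ})

/-- `μ₁(F, Ω)` for an operator defined in `O`: the supremum (in `[-∞, +∞]`) of the real `l` for
which there are an open `Ω'` with `closure Ω ⊆ Ω' ⊆ O` and a positive lower semicontinuous `φ`
on `Ω'` with `F[φ] - l φ^α ≥ 0` in `Ω'`. -/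
def mu {N : ℕ} (F : Operator N) (α : ℝ) (O Ω : Set (Eu N)) : EReal :=
  sSup ((fun l : ℝ => (l : EReal)) '' {l : ℝ | ∃ Ω' : Set (Eu N),
    IsOpen Ω' ∧ closure Ω ⊆ Ω' ∧ Ω' ⊆ O ∧ ∃ φ : Eu N → ℝ,
      LowerSemicontinuousOn φ Ω' ∧ (∀ x ∈ Ω', 0 < φ x) ∧
      IsViscositySupersolution (shifted F α l) Ω' φ})

/-- `u` is a viscosity subsolution of the Dirichlet problem `F[u] = 0` in `Ω`, `u = 0` on `∂Ω`,
the boundary condition being understood in the (relaxed) viscosity sense as well. -/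
def IsDirichletSubsolution {N : ℕ} (F : Operator N) (Ω : Set (Eu N)) (u : Eu N → ℝ) : Prop :=
  ∀ ψ : Eu N → ℝ, ContDiff ℝ 2 ψ → ∀ ξ ∈ closure Ω,
    IsMaxOn (fun y => u y - ψ y) (closure Ω) ξ →
      (ξ ∈ Ω → F ξ (u ξ) (gradient ψ ξ) (hess ψ ξ) ≤ 0) ∧
      (ξ ∈ frontier Ω → min (u ξ) (F ξ (u ξ) (gradient ψ ξ) (hess ψ ξ)) ≤ 0)

/-- The Maximum Principle for `F` in `Ω`. -/
def MaximumPrinciple {N : ℕ} (F : Operator N) (Ω : Set (Eu N)) : Prop :=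
  ∀ u : Eu N → ℝ, UpperSemicontinuousOn u (closure Ω) → IsDirichletSubsolution F Ω u →
    ∀ x ∈ closure Ω, u x ≤ 0

/-- The boundary point `ξ` admits a continuous barrier. -/
def AdmitsBarrier {N : ℕ} (F : Operator N) (Ω : Set (Eu N)) (ξ : Eu N) : Prop :=
  ∃ ρ > 0, ∃ w : Eu N → ℝ,
    ContinuousOn w (closure (Ω ∩ Metric.ball ξ ρ)) ∧
    (∀ x ∈ closure (Ω ∩ Metric.ball ξ ρ), 0 ≤ w x) ∧ w ξ = 0 ∧
    IsViscositySupersolution (fun x r p X => F x r p X - 1) (Ω ∩ Metric.ball ξ ρ) w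

/-- The boundary of the open set `Ω` is smooth: near each of its boundary points, `Ω` is the
positivity set of a smooth function with nonvanishing differential. -/
def HasSmoothBoundary {N : ℕ} (Ω : Set (Eu N)) : Prop :=
  ∀ ξ ∈ frontier Ω, ∃ W : Set (Eu N), IsOpen W ∧ ξ ∈ W ∧ ∃ g : Eu N → ℝ,
    ContDiffOn ℝ ∞ g W ∧ (∀ x ∈ W, fderiv ℝ g x ≠ 0) ∧ Ω ∩ W = {x ∈ W | 0 < g x}

end DegElliptic

end

/-!
Applying everything to `F[u] - l |u| ^ α`, which satisfies the same hypotheses as `F`, reduces the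
theorem to two implications.

If there is a strict supersolution `φ` with positive infimum, then `F` satisfies the maximum
principle. A subsolution `u` is first shown to be nonpositive on `∂Ω`, by comparing it with a
barrier: the doubled function is penalised in a direction pointing into `Ω`, so that the point at
which the barrier is evaluated is interior. Then, if `u` were positive somewhere, the smallest
multiple of `φ` lying above `u` would touch `u` inside `Ω`; the doubling of variables and the
theorem on sums, which comes from Jensen's lemma and Alexandrov's theorem for sup-convolutions, then
contradict the strictness of `φ`.

Conversely, assume the maximum principle. On compact neighbourhoods `K` of `closure Ω` shrinking to
`closure Ω`, and `ε` decreasing to `0`, consider the functions with values in `[0, 1]` that vanish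
off `K` and are subsolutions of `F = ε` where they are positive. Were `1` attained by such functions
for all `K` and `ε`, their relaxed limit would violate the maximum principle. So for some `K` and
`ε` the greatest of them stays below `1`; the constraint `u ≤ 1` being inactive, Perron's
method shows that its lower semicontinuous envelope `φ` satisfies `F[φ] ≥ ε` in the interior of `K`,
and `φ > 0` there because `F(x, 0, 0, 0) = 0`.
-/

noncomputable section

open scoped RealInnerProductSpace Topology
open Filter MeasureTheory

namespace DegElliptic

/-! ### Strong convexity, Alexandrov's theorem and Jensen's lemma -/

section Expansion

variable {E : Type*} [NormedAddCommGroup E] [InnerProductSpace ℝ E]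

/-- `f` has the second order expansion `f x + ⟪p, h⟫ + ⟪S h, h⟫ / 2 + o(‖h‖²)` at `x`. No
differentiability of `f` away from `x` is implied. -/
def HasExpansion (f : E → ℝ) (x p : E) (S : E →ₗ[ℝ] E) : Prop :=
  ∀ ε > 0, ∀ᶠ h in 𝓝 (0 : E), |f (x + h) - f x - ⟪p, h⟫ - ⟪S h, h⟫ / 2| ≤ ε * ‖h‖ ^ 2

theorem abs_sub_sub_sub_le_of_hasFDerivAt {F : Type*} [NormedAddCommGroup F] [NormedSpace ℝ F]
    {f : F → ℝ} {f' : F → F →L[ℝ] ℝ} {f'' : F →L[ℝ] F →L[ℝ] ℝ} {x : F}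
    (hf : ∀ᶠ y in 𝓝 x, HasFDerivAt f (f' y) y) (hx : HasFDerivAt f' f'' x) {ε : ℝ} (hε : 0 < ε) :
    ∀ᶠ h in 𝓝 (0 : F), |f (x + h) - f x - f' x h - f'' h h / 2| ≤ ε * ‖h‖ ^ 2 := by
  have hsymm := second_derivative_symmetric_of_eventually hf hx
  have hsmall : ∀ᶠ h in 𝓝 (0 : F), ‖f' (x + h) - f' x - f'' h‖ ≤ ε * ‖h‖ := by
    simpa using (hasFDerivAt_iff_isLittleO_nhds_zero.1 hx).def hε
  rw [← map_add_left_nhds_zero, eventually_map] at hf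
  obtain ⟨r, hr, hball⟩ := Metric.eventually_nhds_iff_ball.1 (hsmall.and hf)
  filter_upwards [Metric.ball_mem_nhds (0 : F) hr] with h hh
  have hderiv : ∀ k ∈ Metric.closedBall (0 : F) ‖h‖,
      HasFDerivAt (fun k => f (x + k) - f x - f' x k - f'' k k / 2)
        (f' (x + k) - f' x - f'' k) k ∧ ‖f' (x + k) - f' x - f'' k‖ ≤ ε * ‖h‖ := by
    intro k hk
    rw [mem_closedBall_zero_iff] at hk
    obtain ⟨hle, hdiff⟩ := hball k (mem_ball_zero_iff.2 (hk.trans_lt (mem_ball_zero_iff.1 hh)))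
    refine ⟨?_, hle.trans (by gcongr)⟩
    have hquad := (f''.hasFDerivAt.clm_apply (hasFDerivAt_id k)).mul_const (2⁻¹ : ℝ)
    refine ((((hasFDerivAt_comp_add_left x).2 hdiff).sub_const (f x)).sub
      (f' x).hasFDerivAt |>.sub hquad).congr_fderiv ?_
    ext v
    simp [hsymm v k]
    ring
  have hmvt := (convex_closedBall (0 : F) ‖h‖).norm_image_sub_le_of_norm_hasFDerivWithin_le
    (fun k hk => (hderiv k hk).1.hasFDerivWithinAt) (fun k hk => (hderiv k hk).2)
    (Metric.mem_closedBall_self (norm_nonneg h)) (mem_closedBall_zero_iff.2 le_rfl)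
  simpa [pow_two, mul_assoc] using hmvt

theorem eventually_smul_of_eventually {F : Type*} [NormedAddCommGroup F] [NormedSpace ℝ F]
    {P : F → Prop} (hP : ∀ᶠ h in 𝓝 (0 : F), P h) (v : F) : ∀ᶠ t in 𝓝[>] (0 : ℝ), P (t • v) := by
  have hcont : Continuous fun t : ℝ => t • v := by fun_prop
  have hlim : Tendsto (fun t : ℝ => t • v) (𝓝 0) (𝓝 0) := by simpa using hcont.tendsto 0
  exact (hlim.mono_left nhdsWithin_le_nhds).eventually hP

theorem nonpos_of_eventually_le_sq_norm {F : Type*} [NormedAddCommGroup F] [NormedSpace ℝ F]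
    {Q : F → ℝ} (hQ : ∀ (t : ℝ) (h : F), Q (t • h) = t ^ 2 * Q h)
    (hle : ∀ ε > 0, ∀ᶠ h in 𝓝 (0 : F), Q h ≤ ε * ‖h‖ ^ 2) (h : F) : Q h ≤ 0 := by
  have hbound : ∀ ε > 0, Q h ≤ ε * ‖h‖ ^ 2 := by
    intro ε hε
    obtain ⟨t, ht, ht0 : 0 < t⟩ :=
      ((eventually_smul_of_eventually (hle ε hε) h).and self_mem_nhdsWithin).exists
    rw [hQ, norm_smul, mul_pow, Real.norm_eq_abs, sq_abs, mul_left_comm] at ht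
    exact le_of_mul_le_mul_left ht (by positivity)
  have hlim : Tendsto (fun ε : ℝ => ε * ‖h‖ ^ 2) (𝓝[>] 0) (𝓝 0) :=
    tendsto_nhdsWithin_of_tendsto_nhds (Continuous.tendsto' (by fun_prop) _ _ (by simp))
  exact ge_of_tendsto hlim (eventually_mem_nhdsWithin.mono fun ε hε => hbound ε hε)

theorem eq_zero_of_eventually_inner_le {v : E} {C : ℝ}
    (h : ∀ᶠ k in 𝓝 (0 : E), ⟪v, k⟫ ≤ C * ‖k‖ ^ 2) : v = 0 := by
  have hscaled : ∀ᶠ t in 𝓝[>] (0 : ℝ), ‖v‖ ^ 2 ≤ t * (C * ‖v‖ ^ 2) := by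
    filter_upwards [eventually_smul_of_eventually h v, self_mem_nhdsWithin] with t ht ht0
    rw [inner_smul_right, real_inner_self_eq_norm_sq, norm_smul, mul_pow, Real.norm_eq_abs, sq_abs,
      show C * (t ^ 2 * ‖v‖ ^ 2) = t * (t * (C * ‖v‖ ^ 2)) by ring] at ht
    exact le_of_mul_le_mul_left ht ht0
  have hlim : Tendsto (fun t : ℝ => t * (C * ‖v‖ ^ 2)) (𝓝[>] 0) (𝓝 0) :=
    tendsto_nhdsWithin_of_tendsto_nhds (Continuous.tendsto' (by fun_prop) _ _ (by simp))
  exact norm_eq_zero.1 (pow_eq_zero_iff two_ne_zero |>.1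
    (le_antisymm (ge_of_tendsto hlim hscaled) (sq_nonneg _)))

end Expansion

section StronglyConvex

variable {E : Type*} [NormedAddCommGroup E] [InnerProductSpace ℝ E]

/-- `s` is a subgradient of `H` at `x`. -/
def IsSubgradient (H : E → ℝ) (x s : E) : Prop :=
  ∀ x', H x + ⟪s, x' - x⟫ ≤ H x'

/-- Strong convexity with modulus `1`, in the form needed for conjugation: a paraboloid of opening
`1` touches the graph of `H` from below at each point. -/
def StronglyConvex (H : E → ℝ) : Prop :=
  ∀ x, ∃ s : E, ∀ z, H x + ⟪s, z - x⟫ + ‖z - x‖ ^ 2 / 2 ≤ H z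

variable {H : E → ℝ} {x x' y s s' : E} {C : ℝ}

theorem StronglyConvex.exists_isSubgradient (hH : StronglyConvex H) (x : E) :
    ∃ s, IsSubgradient H x s := by
  obtain ⟨s, hs⟩ := hH x
  exact ⟨s, fun x' => by linarith [hs x', sq_nonneg ‖x' - x‖]⟩

theorem StronglyConvex.strongConvexOn (hH : StronglyConvex H) : StrongConvexOn Set.univ 1 H := by
  refine ⟨convex_univ, fun x _ y _ a b ha hb hab => ?_⟩
  obtain ⟨s, hs⟩ := hH (a • x + b • y)
  have hx := hs x
  have hy := hs y
  rw [show x - (a • x + b • y) = b • (x - y) by rw [← eq_sub_iff_add_eq'] at hab; subst hab; module,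
    inner_smul_right, norm_smul, mul_pow, Real.norm_eq_abs, sq_abs] at hx
  rw [show y - (a • x + b • y) = -a • (x - y) by rw [← eq_sub_iff_add_eq] at hab; subst hab; module,
    inner_smul_right, norm_smul, mul_pow, Real.norm_eq_abs, sq_abs] at hy
  obtain rfl : b = 1 - a := by linarith
  simp only [smul_eq_mul]
  nlinarith [mul_le_mul_of_nonneg_left hx ha, mul_le_mul_of_nonneg_left hy hb]

theorem IsSubgradient.add_sq_norm_le (hs : IsSubgradient H x s) (hH : StronglyConvex H) (x' : E) :
    H x + ⟪s, x' - x⟫ + ‖x' - x‖ ^ 2 / 2 ≤ H x' := by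
  have hsegment : ∀ t ∈ Set.Ioo (0 : ℝ) 1,
      H x + ⟪s, x' - x⟫ + (1 - t) * (‖x' - x‖ ^ 2 / 2) ≤ H x' := by
    rintro t ⟨ht0, ht1⟩
    have hsub := hs ((1 - t) • x + t • x')
    have hconv := hH.strongConvexOn.2 (Set.mem_univ x) (Set.mem_univ x') (sub_nonneg.2 ht1.le)
      ht0.le (sub_add_cancel 1 t)
    rw [show (1 - t) • x + t • x' - x = t • (x' - x) by module, inner_smul_right] at hsub
    simp only [smul_eq_mul, norm_sub_rev x] at hconv
    exact le_of_mul_le_mul_left (by linarith) ht0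
  have hlim : Tendsto (fun t : ℝ => H x + ⟪s, x' - x⟫ + (1 - t) * (‖x' - x‖ ^ 2 / 2)) (𝓝[>] 0)
      (𝓝 (H x + ⟪s, x' - x⟫ + (1 - 0) * (‖x' - x‖ ^ 2 / 2))) :=
    (Continuous.tendsto (by fun_prop) 0).mono_left nhdsWithin_le_nhds
  rw [sub_zero, one_mul] at hlim
  exact le_of_tendsto hlim (eventually_of_mem (Ioo_mem_nhdsGT one_pos) hsegment)

theorem StronglyConvex.norm_sub_le (hH : StronglyConvex H) (hs : IsSubgradient H x s)
    (hs' : IsSubgradient H x' s') : ‖x - x'‖ ≤ ‖s - s'‖ := by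
  have hx' := hs.add_sq_norm_le hH x'
  have hx := hs'.add_sq_norm_le hH x
  rw [← neg_sub x x', inner_neg_right, norm_neg] at hx'
  have hmono : ‖x - x'‖ ^ 2 ≤ ⟪s - s', x - x'⟫ := by rw [inner_sub_left]; linarith
  have hcs := hmono.trans (real_inner_le_norm _ _)
  by_contra! hlt
  nlinarith [norm_nonneg (s - s')]

theorem IsSubgradient.eq_of_touch (hs : IsSubgradient H x s)
    (htouch : ∀ h, H (x + h) ≤ H x + ⟪y, h⟫ + C / 2 * ‖h‖ ^ 2) : s = y := by
  refine sub_eq_zero.1 (eq_zero_of_eventually_inner_le (C := C / 2) (.of_forall fun k => ?_))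
  have hk := hs (x + k)
  rw [add_sub_cancel_left] at hk
  rw [inner_sub_left]
  linarith [htouch k]

theorem StronglyConvex.isSubgradient_of_touch (hH : StronglyConvex H)
    (htouch : ∀ h, H (x + h) ≤ H x + ⟪y, h⟫ + C / 2 * ‖h‖ ^ 2) : IsSubgradient H x y := by
  obtain ⟨s, hs⟩ := hH.exists_isSubgradient x
  exact hs.eq_of_touch htouch ▸ hs

theorem IsSubgradient.sq_norm_le_of_hasExpansion {S : E →ₗ[ℝ] E} (hs : IsSubgradient H x y)
    (hH : StronglyConvex H) (hexp : HasExpansion H x y S) (h : E) : ‖h‖ ^ 2 ≤ ⟪S h, h⟫ := by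
  refine sub_nonpos.1 (nonpos_of_eventually_le_sq_norm
    (Q := fun h => ‖h‖ ^ 2 - ⟪S h, h⟫) (fun t h => ?_) (fun ε hε => ?_) h)
  · simp only [norm_smul, mul_pow, Real.norm_eq_abs, sq_abs, map_smul, inner_smul_left,
      inner_smul_right, conj_trivial]
    ring
  · filter_upwards [hexp (ε / 2) (by positivity)] with h hh
    have hlow := hs.add_sq_norm_le hH (x + h)
    rw [add_sub_cancel_left] at hlow
    linarith [(abs_le.1 hh).2]

variable [FiniteDimensional ℝ E]

theorem IsSubgradient.eq_of_hasExpansion {S : E →ₗ[ℝ] E} (hs : IsSubgradient H x s)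
    (hexp : HasExpansion H x y S) : s = y := by
  let S' := LinearMap.toContinuousLinearMap S
  refine sub_eq_zero.1 (eq_zero_of_eventually_inner_le (C := ‖S'‖ / 2 + 1) ?_)
  filter_upwards [hexp 1 one_pos] with k hk
  have hlow := hs (x + k)
  rw [add_sub_cancel_left] at hlow
  have hSk : ⟪S' k, k⟫ ≤ ‖S'‖ * ‖k‖ * ‖k‖ :=
    (real_inner_le_norm _ _).trans (by gcongr; exact S'.le_opNorm k)
  rw [inner_sub_left]
  linarith [(abs_le.1 hk).2, show ⟪S' k, k⟫ = ⟪S k, k⟫ from rfl]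

theorem StronglyConvex.continuous (hH : StronglyConvex H) : Continuous H :=
  (strongConvexOn_zero.1 (hH.strongConvexOn.mono zero_le_one)).locallyLipschitz.continuous

theorem StronglyConvex.exists_isSubgradient_at (hH : StronglyConvex H) (y : E) :
    ∃ x, IsSubgradient H x y := by
  obtain ⟨s, hs⟩ := hH 0
  have hcoercive : ∀ᶠ x in cocompact E, H 0 - ⟪y, (0 : E)⟫ ≤ H x - ⟪y, x⟫ := by
    rw [← Metric.cobounded_eq_cocompact]
    filter_upwards [tendsto_norm_cobounded_atTop.eventually_ge_atTop (2 * ‖s - y‖)] with x hx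
    have hlow := hs x
    have hcs := neg_le_of_abs_le (abs_real_inner_le_norm (s - y) x)
    rw [inner_sub_left] at hcs
    simp only [sub_zero, inner_zero_right] at hlow ⊢
    nlinarith [norm_nonneg x]
  have hcont : Continuous fun x => H x - ⟪y, x⟫ := by
    have := hH.continuous
    fun_prop
  obtain ⟨x, hx⟩ := hcont.exists_forall_le' 0 hcoercive
  refine ⟨x, fun x' => ?_⟩
  rw [inner_sub_right]
  linarith [hx x']

/-- The resolvent of the subdifferential of `H`: the point at which `y` is a subgradient. -/
def prox (hH : StronglyConvex H) (y : E) : E := (hH.exists_isSubgradient_at y).choose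

theorem isSubgradient_prox (hH : StronglyConvex H) (y : E) : IsSubgradient H (prox hH y) y :=
  (hH.exists_isSubgradient_at y).choose_spec

theorem lipschitzWith_prox (hH : StronglyConvex H) : LipschitzWith 1 (prox hH) := by
  refine LipschitzWith.of_dist_le_mul fun y y' => ?_
  simpa [dist_eq_norm] using hH.norm_sub_le (isSubgradient_prox hH y) (isSubgradient_prox hH y')

theorem IsSubgradient.prox_eq (hs : IsSubgradient H x s) (hH : StronglyConvex H) :
    prox hH s = x := by
  have hle := hH.norm_sub_le (isSubgradient_prox hH s) hs
  rw [sub_self, norm_zero] at hle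
  exact sub_eq_zero.1 (norm_le_zero_iff.1 hle)

/-- The convex conjugate `y ↦ sup_x (⟪y, x⟫ - H x)`, the supremum being attained at `prox hH y`. -/
def conj (hH : StronglyConvex H) (y : E) : ℝ := ⟪y, prox hH y⟫ - H (prox hH y)

theorem inner_sub_le_conj (hH : StronglyConvex H) (x y : E) : ⟪y, x⟫ - H x ≤ conj hH y := by
  have hx := isSubgradient_prox hH y x
  rw [inner_sub_right] at hx
  rw [conj]
  linarith

theorem IsSubgradient.eq_inner_sub_conj (hs : IsSubgradient H x s) (hH : StronglyConvex H) :
    H x = ⟪s, x⟫ - conj hH s := by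
  rw [conj, hs.prox_eq hH, sub_sub_cancel]

theorem conj_add_inner_le (hH : StronglyConvex H) (y k : E) :
    conj hH y + ⟪prox hH y, k⟫ ≤ conj hH (y + k) := by
  have hle := inner_sub_le_conj hH (prox hH y) (y + k)
  rw [inner_add_left, real_inner_comm (prox hH y) k] at hle
  rw [conj]
  linarith

theorem conj_le_add_inner (hH : StronglyConvex H) (y k : E) :
    conj hH (y + k) ≤ conj hH y + ⟪prox hH (y + k), k⟫ := by
  have hle := conj_add_inner_le hH (y + k) (-k)
  rw [add_neg_cancel_right, inner_neg_right] at hle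
  linarith

theorem hasFDerivAt_conj (hH : StronglyConvex H) (y : E) :
    HasFDerivAt (conj hH) (innerSL ℝ (prox hH y)) y := by
  rw [hasFDerivAt_iff_isLittleO_nhds_zero]
  refine Asymptotics.IsBigO.trans_isLittleO (g := fun h : E => ‖h‖ ^ 2) ?_
    (Asymptotics.isLittleO_norm_pow_id one_lt_two)
  refine Asymptotics.IsBigO.of_bound 1 (.of_forall fun k => ?_)
  have hlip : ‖prox hH (y + k) - prox hH y‖ ≤ ‖k‖ := by
    simpa [dist_eq_norm] using (lipschitzWith_prox hH).dist_le_mul (y + k) y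
  have hinner : ⟪prox hH (y + k) - prox hH y, k⟫ ≤ ‖k‖ ^ 2 :=
    (real_inner_le_norm _ _).trans (by rw [pow_two]; gcongr)
  rw [inner_sub_left] at hinner
  rw [innerSL_apply_apply, norm_pow, norm_norm, one_mul, Real.norm_eq_abs, abs_le]
  constructor <;> linarith [conj_add_inner_le hH y k, conj_le_add_inner hH y k, sq_nonneg ‖k‖]

theorem hasFDerivAt_innerSL_prox (hH : StronglyConvex H) (hd : DifferentiableAt ℝ (prox hH) y) :
    HasFDerivAt (fun z => innerSL ℝ (prox hH z)) ((innerSL ℝ).comp (fderiv ℝ (prox hH) y)) y :=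
  (innerSL ℝ : E →L[ℝ] E →L[ℝ] ℝ).hasFDerivAt.comp y hd.hasFDerivAt

theorem isSymmetric_fderiv_prox (hH : StronglyConvex H) (hd : DifferentiableAt ℝ (prox hH) y) :
    (fderiv ℝ (prox hH) y : E →ₗ[ℝ] E).IsSymmetric := by
  intro h k
  have hsymm := second_derivative_symmetric_of_eventually
    (.of_forall (hasFDerivAt_conj hH)) (hasFDerivAt_innerSL_prox hH hd) h k
  rw [real_inner_comm _ h]
  exact hsymm

theorem hasExpansion_conj (hH : StronglyConvex H) (hd : DifferentiableAt ℝ (prox hH) y) :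
    HasExpansion (conj hH) y (prox hH y) (fderiv ℝ (prox hH) y) := fun _ hε =>
  abs_sub_sub_sub_le_of_hasFDerivAt (.of_forall (hasFDerivAt_conj hH))
    (hasFDerivAt_innerSL_prox hH hd) hε

theorem conj_add_sq_norm_le_of_touch (hH : StronglyConvex H) (hC : 0 < C)
    (htouch : ∀ h, H (x + h) ≤ H x + ⟪y, h⟫ + C / 2 * ‖h‖ ^ 2) (k : E) :
    conj hH y + ⟪x, k⟫ + ‖k‖ ^ 2 / (2 * C) ≤ conj hH (y + k) := by
  have hx := (hH.isSubgradient_of_touch htouch).eq_inner_sub_conj hH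
  have hyoung := inner_sub_le_conj hH (x + C⁻¹ • k) (y + k)
  have hCk := htouch (C⁻¹ • k)
  rw [norm_smul, mul_pow, Real.norm_eq_abs, sq_abs, inner_smul_right] at hCk
  simp only [inner_add_left, inner_add_right, inner_smul_right, real_inner_self_eq_norm_sq,
    real_inner_comm x k] at hyoung
  have hcalc : C / 2 * (C⁻¹ ^ 2 * ‖k‖ ^ 2) = C⁻¹ * ‖k‖ ^ 2 - ‖k‖ ^ 2 / (2 * C) := by
    field_simp
    ring
  linarith

theorem sq_norm_div_le_inner_fderiv_prox (hH : StronglyConvex H) (hC : 0 < C)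
    (htouch : ∀ h, H (x + h) ≤ H x + ⟪y, h⟫ + C / 2 * ‖h‖ ^ 2)
    (hd : DifferentiableAt ℝ (prox hH) y) (k : E) :
    ‖k‖ ^ 2 / C ≤ ⟪fderiv ℝ (prox hH) y k, k⟫ := by
  have hexp := hasExpansion_conj hH hd
  rw [(hH.isSubgradient_of_touch htouch).prox_eq hH] at hexp
  refine sub_nonpos.1 (nonpos_of_eventually_le_sq_norm
    (Q := fun k => ‖k‖ ^ 2 / C - ⟪fderiv ℝ (prox hH) y k, k⟫) (fun t k => ?_) (fun ε hε => ?_) k)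
  · simp only [norm_smul, mul_pow, Real.norm_eq_abs, sq_abs, map_smul, inner_smul_left,
      inner_smul_right, conj_trivial]
    ring
  · filter_upwards [hexp (ε / 2) (by positivity)] with k hk
    have hlow := conj_add_sq_norm_le_of_touch hH hC htouch k
    rw [mul_comm, ← div_div] at hlow
    rw [ContinuousLinearMap.coe_coe] at hk
    linarith [(abs_le.1 hk).2]

theorem exists_symmetric_right_inverse {T : E →ₗ[ℝ] E} (hT : T.IsSymmetric) {c : ℝ} (hc : 0 < c)
    (hpos : ∀ k, c * ‖k‖ ^ 2 ≤ ⟪T k, k⟫) :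
    ∃ S : E →ₗ[ℝ] E, S.IsSymmetric ∧ ∀ h, T (S h) = h := by
  have hinj : Function.Injective T := by
    refine (injective_iff_map_eq_zero T).2 fun k hk => ?_
    have hle := hpos k
    rw [hk, inner_zero_left] at hle
    exact norm_eq_zero.1 (pow_eq_zero_iff two_ne_zero |>.1
      (le_antisymm (nonpos_of_mul_nonpos_right hle hc) (sq_nonneg _)))
  let e := LinearEquiv.ofInjectiveEndo T hinj
  have hinv : ∀ h, T (e.symm h) = h := e.apply_symm_apply
  refine ⟨e.symm, fun h k => ?_, hinv⟩
  have hsymm := hT (e.symm h) (e.symm k)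
  rw [hinv, hinv] at hsymm
  exact hsymm.symm

theorem IsSubgradient.eventually_expansion_le {T S : E →ₗ[ℝ] E} (hy : IsSubgradient H x y)
    (hH : StronglyConvex H) (hT : HasExpansion (conj hH) y x T) (hTS : ∀ h, T (S h) = h)
    {ε : ℝ} (hε : 0 < ε) :
    ∀ᶠ h in 𝓝 (0 : E), H x + ⟪y, h⟫ + ⟪S h, h⟫ / 2 - ε * ‖h‖ ^ 2 ≤ H (x + h) := by
  set L := LinearMap.toContinuousLinearMap S
  have hlim : Tendsto (fun h => S h) (𝓝 0) (𝓝 0) := L.continuous.tendsto' 0 0 (map_zero S)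
  have hL : 0 < ‖L‖ ^ 2 + 1 := by positivity
  filter_upwards [hlim.eventually (hT (ε / (‖L‖ ^ 2 + 1)) (by positivity))] with h hh
  have hconj := (abs_le.1 hh).2
  rw [hTS] at hconj
  have hyoung := inner_sub_le_conj hH (x + h) (y + S h)
  simp only [inner_add_left, inner_add_right] at hyoung
  have hSh : ‖S h‖ ^ 2 ≤ ‖L‖ ^ 2 * ‖h‖ ^ 2 := by
    rw [← mul_pow]
    exact pow_le_pow_left₀ (norm_nonneg _) (L.le_opNorm h) 2
  have herror : ε / (‖L‖ ^ 2 + 1) * ‖S h‖ ^ 2 ≤ ε * ‖h‖ ^ 2 := by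
    rw [div_mul_eq_mul_div, div_le_iff₀ hL]
    nlinarith [mul_nonneg hε.le (sq_nonneg ‖h‖)]
  linarith [real_inner_comm x (S h), real_inner_comm (S h) h, hy.eq_inner_sub_conj hH]

theorem norm_sub_le_of_touch (hH : StronglyConvex H) (hC : 0 < C)
    (htouch : ∀ h, H (x + h) ≤ H x + ⟪y, h⟫ + C / 2 * ‖h‖ ^ 2) {h k : E}
    (hk : IsSubgradient H (x + h) (y + k)) : ‖k‖ ≤ 2 * C * ‖h‖ := by
  have hle := conj_le_add_inner hH y k
  rw [hk.prox_eq hH, inner_add_left] at hle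
  have hsq : ‖k‖ ^ 2 / (2 * C) ≤ ‖h‖ * ‖k‖ := by
    linarith [real_inner_le_norm h k, conj_add_sq_norm_le_of_touch hH hC htouch k]
  rw [div_le_iff₀ (by positivity)] at hsq
  by_contra! hlt
  nlinarith [norm_nonneg h, norm_nonneg k, mul_nonneg hC.le (norm_nonneg h)]

theorem StronglyConvex.eventually_le_expansion {T S : E →ₗ[ℝ] E} (hH : StronglyConvex H)
    (hC : 0 < C) (htouch : ∀ h, H (x + h) ≤ H x + ⟪y, h⟫ + C / 2 * ‖h‖ ^ 2)
    (hT : HasExpansion (conj hH) y x T) (hTsymm : T.IsSymmetric) (hTpos : ∀ k, 0 ≤ ⟪T k, k⟫)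
    (hTS : ∀ h, T (S h) = h) {ε : ℝ} (hε : 0 < ε) :
    ∀ᶠ h in 𝓝 (0 : E), H (x + h) ≤ H x + ⟪y, h⟫ + ⟪S h, h⟫ / 2 + ε * ‖h‖ ^ 2 := by
  obtain ⟨r, hr, hball⟩ := Metric.eventually_nhds_iff_ball.1
    (hT (ε / (2 * C) ^ 2) (by positivity))
  filter_upwards [Metric.ball_mem_nhds (0 : E) (show 0 < r / (2 * C) by positivity)] with h hh
  rw [mem_ball_zero_iff, lt_div_iff₀' (by positivity)] at hh
  obtain ⟨y', hy'⟩ := hH.exists_isSubgradient (x + h)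
  obtain ⟨k, rfl⟩ : ∃ k, y' = y + k := ⟨y' - y, by abel⟩
  have hk : ‖k‖ ≤ 2 * C * ‖h‖ := norm_sub_le_of_touch hH hC htouch hy'
  have hconj := (abs_le.1 (hball k (mem_ball_zero_iff.2 (hk.trans_lt hh)))).1
  have hsquare : 2 * ⟪k, h⟫ ≤ ⟪T k, k⟫ + ⟪S h, h⟫ := by
    have hpos := hTpos (k - S h)
    simp only [map_sub, hTS, inner_sub_left, inner_sub_right] at hpos
    have hcross := hTsymm k (S h)
    rw [hTS] at hcross
    linarith [real_inner_comm h k, real_inner_comm (S h) h]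
  have herror : ε / (2 * C) ^ 2 * ‖k‖ ^ 2 ≤ ε * ‖h‖ ^ 2 := by
    rw [div_mul_eq_mul_div, div_le_iff₀ (by positivity), mul_assoc, mul_comm (‖h‖ ^ 2), ← mul_pow]
    gcongr
  rw [hy'.eq_inner_sub_conj hH, (hH.isSubgradient_of_touch htouch).eq_inner_sub_conj hH]
  simp only [inner_add_left, inner_add_right]
  linarith [real_inner_comm x k]

theorem StronglyConvex.exists_hasExpansion (hH : StronglyConvex H) (hC : 0 < C)
    (htouch : ∀ h, H (x + h) ≤ H x + ⟪y, h⟫ + C / 2 * ‖h‖ ^ 2)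
    (hd : DifferentiableAt ℝ (prox hH) y) :
    ∃ S : E →ₗ[ℝ] E, S.IsSymmetric ∧ HasExpansion H x y S := by
  have hy := hH.isSubgradient_of_touch htouch
  have hTsymm := isSymmetric_fderiv_prox hH hd
  have hTpos := sq_norm_div_le_inner_fderiv_prox hH hC htouch hd
  have hT := hasExpansion_conj hH hd
  rw [hy.prox_eq hH] at hT
  obtain ⟨S, hS, hTS⟩ := exists_symmetric_right_inverse hTsymm (inv_pos.2 hC) fun k => by
    simpa [div_eq_inv_mul] using hTpos k
  refine ⟨S, hS, fun ε hε => ?_⟩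
  filter_upwards [hy.eventually_expansion_le hH hT hTS hε,
    hH.eventually_le_expansion hC htouch hT hTsymm
      (fun k => le_trans (by positivity) (hTpos k)) hTS hε] with h hlower hupper
  rw [abs_le]
  constructor <;> linarith

end StronglyConvex

section Jensen

theorem exists_mem_ball_notMem_image {G : Type*} [NormedAddCommGroup G] [NormedSpace ℝ G]
    [FiniteDimensional ℝ G] [MeasurableSpace G] [BorelSpace G] (μ : Measure G) [μ.IsAddHaarMeasure]
    {Ψ : G → G} {K : NNReal} (hΨ : LipschitzWith K Ψ) {A : Set G} (hA : μ A = 0) {δ : ℝ}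
    (hδ : 0 < δ) : ∃ q ∈ Metric.ball (0 : G) δ, q ∉ Ψ '' A := by
  by_contra! hcon
  let ν : Measure G := Measure.hausdorffMeasure (Module.finrank ℝ G)
  have hνA : ν A = 0 := Measure.absolutelyContinuous_isAddHaarMeasure ν μ hA
  have hνΨ : ν (Ψ '' A) = 0 := by
    have hle := hΨ.hausdorffMeasure_image_le (d := Module.finrank ℝ G) (by positivity) A
    rw [show Measure.hausdorffMeasure (Module.finrank ℝ G : ℝ) A = 0 from hνA, mul_zero] at hle
    exact le_antisymm hle zero_le
  exact (Metric.measure_ball_pos ν (0 : G) hδ).ne' (measure_mono_null hcon hνΨ)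

variable {E : Type*} [NormedAddCommGroup E] [InnerProductSpace ℝ E] [FiniteDimensional ℝ E]
  {H : E → ℝ} {A : E →L[ℝ] E} {η δ : ℝ}

theorem StronglyConvex.exists_perturbed_max (hH : StronglyConvex H)
    (hA : (A : E →ₗ[ℝ] E).IsSymmetric) (hη : 0 < η)
    (hmax : ∀ z, H z ≤ H 0 + ⟪A z, z⟫ / 2) (q : E) :
    ∃ x, ‖x‖ ≤ 2 * ‖q‖ / η ∧
      ∀ h, H (x + h) ≤ H x + ⟪A x + η • x + q, h⟫ + (⟪A h, h⟫ + η * ‖h‖ ^ 2) / 2 := by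
  let W : E → ℝ := fun z => ⟪A z, z⟫ / 2 + η / 2 * ‖z‖ ^ 2 + ⟪q, z⟫ - H z
  have hWc : Continuous W := by
    have := hH.continuous
    fun_prop
  have hsmall : ∀ z, W z ≤ W 0 → ‖z‖ ≤ 2 * ‖q‖ / η := by
    intro z hz
    have hcs := neg_le_of_abs_le (abs_real_inner_le_norm q z)
    simp only [W, map_zero, inner_zero_right, norm_zero] at hz
    rw [le_div_iff₀ hη]
    by_contra! hlt
    nlinarith [hmax z, norm_nonneg z, norm_nonneg q]
  have hcoercive : ∀ᶠ z in cocompact E, W 0 ≤ W z := by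
    rw [← Metric.cobounded_eq_cocompact]
    filter_upwards [tendsto_norm_cobounded_atTop.eventually_gt_atTop (2 * ‖q‖ / η)] with z hz
    exact le_of_not_ge fun hle => hz.not_ge (hsmall z hle)
  obtain ⟨x, hx⟩ := hWc.exists_forall_le' 0 hcoercive
  refine ⟨x, hsmall x (hx 0), fun h => ?_⟩
  have hle := hx (x + h)
  have hsymm : ⟪A h, x⟫ = ⟪A x, h⟫ := (hA h x).trans (real_inner_comm _ _)
  simp only [W, map_add, inner_add_left, inner_add_right, hsymm, norm_add_sq_real] at hle
  simp only [inner_add_left, inner_smul_left, conj_trivial]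
  linarith

/-- By Sard, almost no `q` is of the form `y - (A + η) (prox y)` with `prox` not differentiable at
`y`; the maximum point of `H` minus its quadratic bound, tilted by such a small `q`, is as
desired. -/
theorem StronglyConvex.exists_touch_of_le_quadratic (hH : StronglyConvex H)
    (hA : (A : E →ₗ[ℝ] E).IsSymmetric) (hη : 0 < η) (hδ : 0 < δ)
    (hmax : ∀ z, H z ≤ H 0 + ⟪A z, z⟫ / 2) :
    ∃ x y : E, ‖x‖ ≤ δ ∧ ‖y‖ ≤ δ ∧ DifferentiableAt ℝ (prox hH) y ∧
      ∀ h, H (x + h) ≤ H x + ⟪y, h⟫ + (⟪A h, h⟫ + η * ‖h‖ ^ 2) / 2 := by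
  let _ : MeasurableSpace E := borel E
  have _ : BorelSpace E := ⟨rfl⟩
  let B : E →L[ℝ] E := A + η • ContinuousLinearMap.id ℝ E
  obtain ⟨r, ⟨hrx, hry⟩, hr0 : 0 < r⟩ : ∃ r : ℝ,
      (2 * r / η < δ ∧ ‖B‖ * (2 * r / η) + r < δ) ∧ 0 < r := by
    have hx : Tendsto (fun r : ℝ => 2 * r / η) (𝓝 0) (𝓝 0) :=
      Continuous.tendsto' (by fun_prop) _ _ (by simp)
    have hy : Tendsto (fun r : ℝ => ‖B‖ * (2 * r / η) + r) (𝓝 0) (𝓝 0) :=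
      Continuous.tendsto' (by fun_prop) _ _ (by simp)
    exact ((((hx.eventually_lt_const hδ).and (hy.eventually_lt_const hδ)).filter_mono
      nhdsWithin_le_nhds).and (self_mem_nhdsWithin (s := Set.Ioi (0 : ℝ)))).exists
  have hΨ := LipschitzWith.id.sub (B.lipschitz.comp (lipschitzWith_prox hH))
  have hnull := ae_iff.1 ((lipschitzWith_prox hH).ae_differentiableAt (μ := Measure.addHaar))
  obtain ⟨q, hq, hqn⟩ := exists_mem_ball_notMem_image Measure.addHaar hΨ hnull hr0
  replace hq : ‖q‖ ≤ r := (mem_ball_zero_iff.1 hq).le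
  obtain ⟨x, hx, htouch⟩ := hH.exists_perturbed_max hA hη hmax q
  have hxr : ‖x‖ ≤ 2 * r / η := hx.trans (by gcongr)
  have hsub : IsSubgradient H x (A x + η • x + q) := by
    refine hH.isSubgradient_of_touch (C := ‖A‖ + η) fun h => (htouch h).trans ?_
    have hAh := (real_inner_le_norm (A h) h).trans
      (mul_le_mul_of_nonneg_right (A.le_opNorm h) (norm_nonneg h))
    linarith
  refine ⟨x, A x + η • x + q, hxr.trans hrx.le, ?_, ?_, htouch⟩
  · calc ‖B x + q‖ ≤ ‖B‖ * ‖x‖ + ‖q‖ := (norm_add_le _ _).trans (by gcongr; exact B.le_opNorm x)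
      _ ≤ ‖B‖ * (2 * r / η) + r := by gcongr
      _ ≤ δ := hry.le
  · by_contra hnd
    refine hqn ⟨A x + η • x + q, hnd, ?_⟩
    simp [hsub.prox_eq hH, B]

theorem StronglyConvex.exists_hasExpansion_of_le_quadratic (hH : StronglyConvex H)
    (hA : (A : E →ₗ[ℝ] E).IsSymmetric) (hδ : 0 < δ) (hmax : ∀ z, H z ≤ H 0 + ⟪A z, z⟫ / 2) :
    ∃ (x y : E) (S : E →ₗ[ℝ] E), ‖x‖ ≤ δ ∧ ‖y‖ ≤ δ ∧ HasExpansion H x y S ∧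
      S.IsSymmetric ∧ ∀ h, H (x + h) ≤ H x + ⟪y, h⟫ + (⟪A h, h⟫ + δ * ‖h‖ ^ 2) / 2 := by
  obtain ⟨x, y, hx, hy, hd, htouch⟩ := hH.exists_touch_of_le_quadratic hA hδ hδ hmax
  have htouch' : ∀ h, H (x + h) ≤ H x + ⟪y, h⟫ + (‖A‖ + δ) / 2 * ‖h‖ ^ 2 := fun h => by
    have hAh := (real_inner_le_norm (A h) h).trans
      (mul_le_mul_of_nonneg_right (A.le_opNorm h) (norm_nonneg h))
    linarith [htouch h]
  obtain ⟨S, hS, hexp⟩ := hH.exists_hasExpansion (by positivity) htouch' hd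
  exact ⟨x, y, S, hx, hy, hexp, hS, htouch⟩

end Jensen

variable {N : ℕ}

/-- The quadratic form of a matrix. -/
def qf (X : Mat N) (h : Eu N) : ℝ := ⟪X.toEuclideanLin h, h⟫

theorem qf_eq_dotProduct (X : Mat N) (h : Eu N) :
    qf X h = dotProduct h.ofLp (X.mulVec h.ofLp) := by
  rw [qf, EuclideanSpace.inner_eq_star_dotProduct]
  rfl

theorem qf_add (X Y : Mat N) (h : Eu N) : qf (X + Y) h = qf X h + qf Y h := by
  simp [qf, inner_add_left]

theorem qf_sub (X Y : Mat N) (h : Eu N) : qf (X - Y) h = qf X h - qf Y h := by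
  simp [qf, inner_sub_left]

theorem qf_neg (X : Mat N) (h : Eu N) : qf (-X) h = -qf X h := by
  simp [qf]

theorem qf_smul (c : ℝ) (X : Mat N) (h : Eu N) : qf (c • X) h = c * qf X h := by
  simp [qf, inner_smul_left]

theorem qf_one (h : Eu N) : qf (1 : Mat N) h = ‖h‖ ^ 2 := by
  simp [qf]

theorem qf_zero_right (X : Mat N) : qf X 0 = 0 := by
  simp [qf]

theorem qf_smul_right (X : Mat N) (t : ℝ) (h : Eu N) : qf X (t • h) = t ^ 2 * qf X h := by
  simp only [qf, map_smul, inner_smul_left, inner_smul_right, conj_trivial]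
  ring

theorem isHermitian_iff_isSymm {X : Mat N} : X.IsHermitian ↔ X.IsSymm := by
  rw [Matrix.IsHermitian, Matrix.conjTranspose_eq_transpose_of_trivial, Matrix.IsSymm]

theorem isSymmetric_toEuclideanLin_iff {X : Mat N} : X.toEuclideanLin.IsSymmetric ↔ X.IsSymm := by
  rw [Matrix.isSymmetric_toEuclideanLin_iff, isHermitian_iff_isSymm]

theorem qf_add_right {X : Mat N} (hX : X.IsSymm) (h k : Eu N) :
    qf X (h + k) = qf X h + 2 * ⟪X.toEuclideanLin h, k⟫ + qf X k := by
  have hsymm := isSymmetric_toEuclideanLin_iff.2 hX h k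
  simp only [qf, map_add, inner_add_left, inner_add_right]
  linarith [real_inner_comm (X.toEuclideanLin k) h]

theorem posSemidef_of_qf_nonneg {X : Mat N} (hX : X.IsSymm) (hqf : ∀ v, 0 ≤ qf X v) :
    X.PosSemidef := by
  refine Matrix.PosSemidef.of_dotProduct_mulVec_nonneg (isHermitian_iff_isSymm.2 hX) fun x => ?_
  simpa [qf_eq_dotProduct] using hqf (WithLp.toLp 2 x)

theorem continuous_qf_left (v : Eu N) : Continuous fun X : Mat N => qf X v := by
  simp only [qf_eq_dotProduct]
  exact continuous_const.dotProduct (continuous_id.matrix_mulVec continuous_const)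

theorem inner_toEuclideanLin_single (X : Mat N) (i j : Fin N) :
    ⟪X.toEuclideanLin (EuclideanSpace.single j 1), EuclideanSpace.single i 1⟫ = X i j := by
  rw [real_inner_comm, EuclideanSpace.inner_single_left]
  simp [Matrix.toLpLin_apply]

theorem abs_entry_le {X : Mat N} (hX : X.IsSymm) {C : ℝ} (hqf : ∀ v, |qf X v| ≤ C * ‖v‖ ^ 2)
    (i j : Fin N) : |X i j| ≤ 3 * C := by
  have hunit : ∀ l : Fin N, |qf X (EuclideanSpace.single l 1)| ≤ C := fun l => by
    simpa using hqf (EuclideanSpace.single l 1)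
  set v := EuclideanSpace.single j 1 + EuclideanSpace.single i (1 : ℝ) with hv
  have hentry : qf X v = qf X (EuclideanSpace.single j 1) + 2 * X i j
      + qf X (EuclideanSpace.single i 1) := by
    rw [hv, qf_add_right hX, inner_toEuclideanLin_single]
  have hnorm : ‖v‖ ≤ 2 := by
    refine (norm_add_le _ _).trans ?_
    simp only [PiLp.norm_single, norm_one]
    norm_num
  have hC : 0 ≤ C := (abs_nonneg _).trans (hunit i)
  have hsum : |qf X v| ≤ C * 2 ^ 2 := (hqf v).trans (by gcongr)
  rw [abs_le]
  constructor <;> linarith [abs_le.1 hsum, abs_le.1 (hunit i), abs_le.1 (hunit j)]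

theorem posSemidef_fromBlocks {A B D : Mat N} (hA : A.IsSymm) (hB : B.IsSymm) (hD : D.IsSymm)
    (hqf : ∀ h k, 0 ≤ qf A h + 2 * ⟪B.toEuclideanLin h, k⟫ + qf D k) :
    (Matrix.fromBlocks A B B D).PosSemidef := by
  have hsymm : (Matrix.fromBlocks A B B D).IsSymm := hA.fromBlocks hB.eq hD
  refine Matrix.PosSemidef.of_dotProduct_mulVec_nonneg ?_ fun x => ?_
  · rw [Matrix.IsHermitian, Matrix.conjTranspose_eq_transpose_of_trivial, hsymm.eq]
  have hx := hqf (WithLp.toLp 2 (x ∘ Sum.inl)) (WithLp.toLp 2 (x ∘ Sum.inr))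
  have hcross := isSymmetric_toEuclideanLin_iff.2 hB (WithLp.toLp 2 (x ∘ Sum.inl))
    (WithLp.toLp 2 (x ∘ Sum.inr))
  rw [real_inner_comm (WithLp.toLp 2 (x ∘ Sum.inr))] at hcross
  simp only [qf_eq_dotProduct] at hx
  rw [Matrix.fromBlocks_mulVec, star_trivial]
  conv_rhs => rw [← Sum.elim_comp_inl_inr x, sumElim_dotProduct_sumElim]
  simp only [EuclideanSpace.inner_eq_star_dotProduct, Matrix.toLpLin_apply,
    star_trivial] at hx hcross
  simp only [dotProduct_add, Sum.elim_comp_inl, Sum.elim_comp_inr]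
  linarith [dotProduct_comm (B.mulVec (x ∘ Sum.inl)) (x ∘ Sum.inr),
    dotProduct_comm (B.mulVec (x ∘ Sum.inr)) (x ∘ Sum.inl)]

theorem blockIneq_of_qf {c : ℝ} {X Y : Mat N} (hX : X.IsSymm) (hY : Y.IsSymm)
    (hlower : ∀ h k, -(c * (‖h‖ ^ 2 + ‖k‖ ^ 2)) ≤ qf X h - qf Y k)
    (hupper : ∀ h k, qf X h - qf Y k ≤ c * ‖h - k‖ ^ 2) : BlockIneq c X Y := by
  have hc : (c • (1 : Mat N)).IsSymm := Matrix.isSymm_one.smul c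
  have hpos₁ : (Matrix.fromBlocks (X + c • 1) 0 0 (-Y + c • 1)).PosSemidef := by
    refine posSemidef_fromBlocks (hX.add hc) Matrix.isSymm_zero (hY.neg.add hc) fun h k => ?_
    simp only [qf_add, qf_neg, qf_smul, qf_one, map_zero, LinearMap.zero_apply, inner_zero_left]
    linarith [hlower h k]
  have hpos₂ : (Matrix.fromBlocks (c • 1 - X) (-(c • 1)) (-(c • 1)) (c • 1 + Y)).PosSemidef := by
    refine posSemidef_fromBlocks (hc.sub hX) hc.neg (hc.add hY) fun h k => ?_
    have hhk := hupper h k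
    rw [norm_sub_sq_real] at hhk
    simp only [qf_add, qf_sub, qf_smul, qf_one, map_neg, map_smul, LinearMap.neg_apply,
      LinearMap.smul_apply, Matrix.toLpLin_one, LinearMap.id_apply, inner_neg_left,
      inner_smul_left, conj_trivial]
    linarith
  constructor
  · convert hpos₁ using 1
    rw [neg_smul, sub_neg_eq_add, Matrix.fromBlocks_smul, Matrix.fromBlocks_add]
    simp only [smul_zero, add_zero]
  · convert hpos₂ using 1
    simp [Matrix.fromBlocks_smul, sub_eq_add_neg, Matrix.fromBlocks_neg, Matrix.fromBlocks_add]

/-! ### The theorem on sums -/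

section Sums

variable {E : Type*} [NormedAddCommGroup E] [InnerProductSpace ℝ E]

theorem StronglyConvex.add_prod {H₁ H₂ : E → ℝ} (hH₁ : StronglyConvex H₁)
    (hH₂ : StronglyConvex H₂) :
    StronglyConvex fun z : WithLp 2 (E × E) => H₁ z.fst + H₂ z.snd := by
  intro z
  obtain ⟨s₁, hs₁⟩ := hH₁ z.fst
  obtain ⟨s₂, hs₂⟩ := hH₂ z.snd
  refine ⟨WithLp.toLp 2 (s₁, s₂), fun w => ?_⟩
  have hinner : ⟪WithLp.toLp 2 (s₁, s₂), w - z⟫ = ⟪s₁, w.fst - z.fst⟫ + ⟪s₂, w.snd - z.snd⟫ :=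
    WithLp.prod_inner_apply _ _
  rw [hinner, WithLp.prod_norm_sq_eq_of_L2, WithLp.sub_fst, WithLp.sub_snd]
  linarith [hs₁ w.fst, hs₂ w.snd]

theorem HasExpansion.inner_add_inner_le {H₁ H₂ : E → ℝ} {x₁ x₂ y₁ y₂ : E} {S₁ S₂ : E →ₗ[ℝ] E}
    {c τ : ℝ} (hexp₁ : HasExpansion H₁ x₁ y₁ S₁) (hexp₂ : HasExpansion H₂ x₂ y₂ S₂)
    (htouch : ∀ h k, H₁ (x₁ + h) + H₂ (x₂ + k) ≤ H₁ x₁ + H₂ x₂ + ⟪y₁, h⟫ + ⟪y₂, k⟫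
      + (c * (‖h‖ ^ 2 + ‖k‖ ^ 2) + τ * ‖h - k‖ ^ 2) / 2) (h k : E) :
    ⟪S₁ h, h⟫ + ⟪S₂ k, k⟫ ≤ c * (‖h‖ ^ 2 + ‖k‖ ^ 2) + τ * ‖h - k‖ ^ 2 := by
  refine sub_nonpos.1 (nonpos_of_eventually_le_sq_norm (F := E × E)
    (Q := fun z => ⟪S₁ z.1, z.1⟫ + ⟪S₂ z.2, z.2⟫
      - (c * (‖z.1‖ ^ 2 + ‖z.2‖ ^ 2) + τ * ‖z.1 - z.2‖ ^ 2))
    (fun t z => ?_) (fun ε hε => ?_) (h, k))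
  · simp only [Prod.smul_fst, Prod.smul_snd, ← smul_sub, norm_smul, mul_pow, Real.norm_eq_abs,
      sq_abs, map_smul, inner_smul_left, inner_smul_right, conj_trivial]
    ring
  · have hfst : Tendsto Prod.fst (𝓝 (0 : E × E)) (𝓝 0) := continuous_fst.tendsto 0
    have hsnd : Tendsto Prod.snd (𝓝 (0 : E × E)) (𝓝 0) := continuous_snd.tendsto 0
    filter_upwards [hfst.eventually (hexp₁ (ε / 4) (by positivity)),
      hsnd.eventually (hexp₂ (ε / 4) (by positivity))] with z hz₁ hz₂
    have hfst_le : ε / 4 * ‖z.1‖ ^ 2 ≤ ε / 4 * ‖z‖ ^ 2 := by gcongr; exact norm_fst_le z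
    have hsnd_le : ε / 4 * ‖z.2‖ ^ 2 ≤ ε / 4 * ‖z‖ ^ 2 := by gcongr; exact norm_snd_le z
    linarith [htouch z.1 z.2, (abs_le.1 hz₁).1, (abs_le.1 hz₂).1]

/-- The isometric embedding of `E` as the first factor of the Hilbert product `E × E`. -/
def inlL2 (E : Type*) [NormedAddCommGroup E] [InnerProductSpace ℝ E] :
    E →ₗᵢ[ℝ] WithLp 2 (E × E) where
  toLinearMap := (WithLp.linearEquiv 2 ℝ (E × E)).symm ∘ₗ LinearMap.inl ℝ E E
  norm_map' h := by simp

/-- The isometric embedding of `E` as the second factor of the Hilbert product `E × E`. -/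
def inrL2 (E : Type*) [NormedAddCommGroup E] [InnerProductSpace ℝ E] :
    E →ₗᵢ[ℝ] WithLp 2 (E × E) where
  toLinearMap := (WithLp.linearEquiv 2 ℝ (E × E)).symm ∘ₗ LinearMap.inr ℝ E E
  norm_map' h := by simp

theorem inlL2_apply (h : E) : inlL2 E h = WithLp.toLp 2 (h, 0) := rfl

theorem inrL2_apply (h : E) : inrL2 E h = WithLp.toLp 2 (0, h) := rfl

variable {G : Type*} [FiniteDimensional ℝ E]
  [NormedAddCommGroup G] [InnerProductSpace ℝ G] [FiniteDimensional ℝ G]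
  {f : G → ℝ} {g : E → ℝ} {x p : G} {a : E} {S : G →ₗ[ℝ] G} {ι : E →ₗᵢ[ℝ] G}

theorem norm_adjoint_le (ι : E →ₗᵢ[ℝ] G) (p : G) : ‖LinearMap.adjoint ι.toLinearMap p‖ ≤ ‖p‖ := by
  have hcs := real_inner_le_norm p (ι.toLinearMap (LinearMap.adjoint ι.toLinearMap p))
  rw [← LinearMap.adjoint_inner_left, real_inner_self_eq_norm_mul_norm,
    LinearIsometry.coe_toLinearMap, ι.norm_map] at hcs
  by_contra! hlt
  nlinarith [norm_nonneg p]

theorem HasExpansion.of_section (hf : HasExpansion f x p S)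
    (hg : ∀ h, g (a + h) - g a = f (x + ι h) - f x) :
    HasExpansion g a (LinearMap.adjoint ι.toLinearMap p)
      (LinearMap.adjoint ι.toLinearMap ∘ₗ S ∘ₗ ι.toLinearMap) := by
  intro ε hε
  filter_upwards [(ι.continuous.tendsto' 0 0 ι.map_zero).eventually (hf ε hε)] with h hh
  rw [ι.norm_map, ← hg] at hh
  simpa [LinearMap.adjoint_inner_left] using hh

theorem isSymmetric_adjoint_comp_comp (hS : S.IsSymmetric) (ι : E →ₗᵢ[ℝ] G) :
    (LinearMap.adjoint ι.toLinearMap ∘ₗ S ∘ₗ ι.toLinearMap).IsSymmetric := fun h k => by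
  simp only [LinearMap.comp_apply, LinearMap.adjoint_inner_left, LinearMap.adjoint_inner_right]
  exact hS _ _

theorem exists_isSymmetric_inner_eq (E : Type*) [NormedAddCommGroup E] [InnerProductSpace ℝ E]
    [FiniteDimensional ℝ E] (c τ : ℝ) :
    ∃ A : WithLp 2 (E × E) →L[ℝ] WithLp 2 (E × E), (A : _ →ₗ[ℝ] WithLp 2 (E × E)).IsSymmetric ∧
      ∀ z, ⟪A z, z⟫ = c * ‖z‖ ^ 2 + τ * ‖z.fst - z.snd‖ ^ 2 := by
  obtain ⟨D, hD⟩ : ∃ D : WithLp 2 (E × E) →ₗ[ℝ] E, ∀ z, D z = z.fst - z.snd :=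
    ⟨(WithLp.fstL 2 ℝ E E - WithLp.sndL 2 ℝ E E).toLinearMap, fun _ => rfl⟩
  refine ⟨LinearMap.toContinuousLinearMap (c • LinearMap.id + τ • (LinearMap.adjoint D ∘ₗ D)),
    fun z w => ?_, fun z => ?_⟩
  · simp [inner_add_left, inner_add_right, inner_smul_left, inner_smul_right,
      LinearMap.adjoint_inner_left, LinearMap.adjoint_inner_right]
  · simp only [LinearMap.coe_toContinuousLinearMap', LinearMap.add_apply, LinearMap.smul_apply,
      LinearMap.id_apply, LinearMap.comp_apply, inner_add_left, inner_smul_left, conj_trivial,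
      LinearMap.adjoint_inner_left, real_inner_self_eq_norm_sq, hD]

theorem StronglyConvex.exists_hasExpansion_pair {H₁ H₂ : E → ℝ} (hH₁ : StronglyConvex H₁)
    (hH₂ : StronglyConvex H₂) {c τ δ : ℝ} (hδ : 0 < δ)
    (hmax : ∀ x y, H₁ x + H₂ y ≤
      H₁ 0 + H₂ 0 + (c * (‖x‖ ^ 2 + ‖y‖ ^ 2) + τ * ‖x - y‖ ^ 2) / 2) :
    ∃ (x₁ x₂ y₁ y₂ : E) (S₁ S₂ : E →ₗ[ℝ] E), (‖x₁‖ ≤ δ ∧ ‖x₂‖ ≤ δ ∧ ‖y₁‖ ≤ δ ∧ ‖y₂‖ ≤ δ) ∧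
      (HasExpansion H₁ x₁ y₁ S₁ ∧ S₁.IsSymmetric) ∧
      (HasExpansion H₂ x₂ y₂ S₂ ∧ S₂.IsSymmetric) ∧
      ∀ h k, H₁ (x₁ + h) + H₂ (x₂ + k) ≤ H₁ x₁ + H₂ x₂ + ⟪y₁, h⟫ + ⟪y₂, k⟫
        + ((c + δ) * (‖h‖ ^ 2 + ‖k‖ ^ 2) + τ * ‖h - k‖ ^ 2) / 2 := by
  obtain ⟨A, hA, hAz⟩ := exists_isSymmetric_inner_eq E c τ
  obtain ⟨x, y, S, hx, hy, hexp, hS, htouch⟩ :=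
    (hH₁.add_prod hH₂).exists_hasExpansion_of_le_quadratic hA hδ fun z => by
      simpa [hAz, WithLp.prod_norm_sq_eq_of_L2] using hmax z.fst z.snd
  have hsec₁ : ∀ h, H₁ (x.fst + h) - H₁ x.fst =
      H₁ (x + inlL2 E h).fst + H₂ (x + inlL2 E h).snd - (H₁ x.fst + H₂ x.snd) := fun h => by
    simp [inlL2_apply]
  have hsec₂ : ∀ k, H₂ (x.snd + k) - H₂ x.snd =
      H₁ (x + inrL2 E k).fst + H₂ (x + inrL2 E k).snd - (H₁ x.fst + H₂ x.snd) := fun k => by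
    simp [inrL2_apply]
  refine ⟨x.fst, x.snd, _, _, _, _,
    ⟨?_, ?_, (norm_adjoint_le _ y).trans hy, (norm_adjoint_le _ y).trans hy⟩,
    ⟨hexp.of_section hsec₁, isSymmetric_adjoint_comp_comp hS _⟩,
    ⟨hexp.of_section hsec₂, isSymmetric_adjoint_comp_comp hS _⟩, fun h k => ?_⟩
  · exact (WithLp.norm_fst_le _ x).trans hx
  · exact (WithLp.norm_snd_le _ x).trans hx
  · have hhk := htouch (inlL2 E h + inrL2 E k)
    simp only [hAz, WithLp.prod_norm_sq_eq_of_L2, inner_add_right] at hhk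
    simp only [LinearMap.adjoint_inner_left, LinearIsometry.coe_toLinearMap]
    simp only [inlL2_apply, inrL2_apply, WithLp.add_fst, WithLp.add_snd, WithLp.toLp_fst,
      WithLp.toLp_snd, add_zero, zero_add] at hhk ⊢
    linarith

theorem StronglyConvex.exists_hasExpansion_seq {H₁ H₂ : E → ℝ} (hH₁ : StronglyConvex H₁)
    (hH₂ : StronglyConvex H₂) {c τ : ℝ}
    (hmax : ∀ x y, H₁ x + H₂ y ≤
      H₁ 0 + H₂ 0 + (c * (‖x‖ ^ 2 + ‖y‖ ^ 2) + τ * ‖x - y‖ ^ 2) / 2) :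
    ∃ (x₁ x₂ y₁ y₂ : ℕ → E) (S₁ S₂ : ℕ → E →ₗ[ℝ] E),
      (Tendsto x₁ atTop (𝓝 0) ∧ Tendsto x₂ atTop (𝓝 0) ∧
        Tendsto y₁ atTop (𝓝 0) ∧ Tendsto y₂ atTop (𝓝 0)) ∧
      (∀ n, HasExpansion H₁ (x₁ n) (y₁ n) (S₁ n) ∧ (S₁ n).IsSymmetric) ∧
      (∀ n, HasExpansion H₂ (x₂ n) (y₂ n) (S₂ n) ∧ (S₂ n).IsSymmetric) ∧
      ∀ n h k, ⟪S₁ n h, h⟫ + ⟪S₂ n k, k⟫ ≤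
        (c + 1 / ((n : ℝ) + 1)) * (‖h‖ ^ 2 + ‖k‖ ^ 2) + τ * ‖h - k‖ ^ 2 := by
  choose x₁ x₂ y₁ y₂ S₁ S₂ hnorm hexp₁ hexp₂ htouch using fun n : ℕ =>
    hH₁.exists_hasExpansion_pair hH₂ (Nat.one_div_pos_of_nat (α := ℝ) (n := n)) hmax
  have hδ : Tendsto (fun n : ℕ => 1 / ((n : ℝ) + 1)) atTop (𝓝 0) :=
    tendsto_one_div_add_atTop_nhds_zero_nat
  exact ⟨x₁, x₂, y₁, y₂, S₁, S₂, ⟨squeeze_zero_norm (fun n => (hnorm n).1) hδ,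
    squeeze_zero_norm (fun n => (hnorm n).2.1) hδ, squeeze_zero_norm (fun n => (hnorm n).2.2.1) hδ,
    squeeze_zero_norm (fun n => (hnorm n).2.2.2) hδ⟩, hexp₁, hexp₂,
    fun n => (hexp₁ n).1.inner_add_inner_le (hexp₂ n).1 (htouch n)⟩

end Sums

section SupConvolution

variable {E : Type*} [NormedAddCommGroup E]

/-- `W` is the sup-convolution `x ↦ sup_z (U z - τ / 2 * ‖x - z‖ ^ 2)` of `U`, and the supremum at
`x` is attained at `Z x`. -/
structure IsSupConvolution (τ : ℝ) (U W : E → ℝ) (Z : E → E) : Prop where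
  le : ∀ x z, U z - τ / 2 * ‖x - z‖ ^ 2 ≤ W x
  eq : ∀ x, W x = U (Z x) - τ / 2 * ‖x - Z x‖ ^ 2

variable {τ : ℝ} {U W : E → ℝ} {Z : E → E}

theorem IsSupConvolution.le_self (h : IsSupConvolution τ U W Z) (x : E) : U x ≤ W x := by
  simpa using h.le x x

theorem IsSupConvolution.le_apply (h : IsSupConvolution τ U W Z) (hτ : 0 ≤ τ) (x : E) :
    W x ≤ U (Z x) := by
  rw [h.eq]
  exact sub_le_self _ (by positivity)

theorem IsSupConvolution.add_le {U₁ U₂ W₁ W₂ : E → ℝ} {Z₁ Z₂ : E → E} {σ : ℝ}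
    (h₁ : IsSupConvolution (3 * σ) U₁ W₁ Z₁) (h₂ : IsSupConvolution (3 * σ) U₂ W₂ Z₂) (hσ : 0 ≤ σ)
    (hmax : ∀ h k, U₁ h + U₂ k ≤ U₁ 0 + U₂ 0 + σ / 2 * ‖h - k‖ ^ 2) (x y : E) :
    W₁ x + W₂ y ≤ U₁ 0 + U₂ 0 + 3 * σ / 2 * ‖x - y‖ ^ 2 := by
  have hsq : ‖Z₁ x - Z₂ y‖ ^ 2 ≤
      3 * (‖x - y‖ ^ 2 + ‖x - Z₁ x‖ ^ 2 + ‖y - Z₂ y‖ ^ 2) := by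
    have htri : ‖Z₁ x - Z₂ y‖ ≤ ‖x - Z₁ x‖ + ‖x - y‖ + ‖y - Z₂ y‖ := by
      have hsum := norm_add₃_le (a := Z₁ x - x) (b := x - y) (c := y - Z₂ y)
      rwa [sub_add_sub_cancel, sub_add_sub_cancel, norm_sub_rev (Z₁ x) x] at hsum
    nlinarith [norm_nonneg (Z₁ x - Z₂ y), sq_nonneg (‖x - Z₁ x‖ - ‖x - y‖),
      sq_nonneg (‖x - y‖ - ‖y - Z₂ y‖), sq_nonneg (‖x - Z₁ x‖ - ‖y - Z₂ y‖)]
  rw [h₁.eq, h₂.eq]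
  linarith [hmax (Z₁ x) (Z₂ y), mul_le_mul_of_nonneg_left hsq hσ]

variable [InnerProductSpace ℝ E]

theorem exists_forall_sub_sq_le [ProperSpace E] {U : E → ℝ} (hU : UpperSemicontinuous U)
    {A B τ : ℝ} (hB : 0 ≤ B) (hτ : 0 < τ) (hUle : ∀ z, U z ≤ A + B * ‖z‖) (x : E) :
    ∃ z, ∀ z', U z' - τ / 2 * ‖x - z'‖ ^ 2 ≤ U z - τ / 2 * ‖x - z‖ ^ 2 := by
  set m := U 0 - τ / 2 * ‖x - 0‖ ^ 2
  set R := 1 + 2 / τ * (B + τ * ‖x‖ + |A - m|) with hR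
  have hR1 : 1 ≤ R := le_add_of_nonneg_right (by positivity)
  have husc : UpperSemicontinuous fun z => U z + -(τ / 2 * ‖x - z‖ ^ 2) :=
    hU.add (Continuous.upperSemicontinuous (by fun_prop))
  obtain ⟨z, -, hmax⟩ := (husc.upperSemicontinuousOn (Metric.closedBall 0 R)).exists_isMaxOn
    ⟨0, Metric.mem_closedBall_self (by linarith)⟩ (isCompact_closedBall 0 R)
  simp only [← sub_eq_add_neg] at hmax
  refine ⟨z, fun z' => ?_⟩
  rcases le_or_gt ‖z'‖ R with hz' | hz'
  · exact hmax (mem_closedBall_zero_iff.2 hz')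
  have hm : m ≤ U z - τ / 2 * ‖x - z‖ ^ 2 := hmax (Metric.mem_closedBall_self (by linarith))
  refine le_trans ?_ hm
  have hsq : ‖z'‖ ^ 2 - 2 * ‖x‖ * ‖z'‖ ≤ ‖x - z'‖ ^ 2 := by
    rw [norm_sub_sq_real]
    nlinarith [real_inner_le_norm x z', sq_nonneg ‖x‖]
  have hlinear : B + τ * ‖x‖ + |A - m| ≤ τ / 2 * ‖z'‖ := by
    have hfar : 2 / τ * (B + τ * ‖x‖ + |A - m|) ≤ ‖z'‖ := by linarith [hR]
    rw [div_mul_eq_mul_div, div_le_iff₀ hτ] at hfar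
    linarith
  have hAm : A - m ≤ |A - m| * ‖z'‖ :=
    (le_abs_self _).trans (le_mul_of_one_le_right (abs_nonneg _) (hR1.trans hz'.le))
  nlinarith [mul_le_mul_of_nonneg_left hsq hτ.le, hUle z',
    mul_le_mul_of_nonneg_right hlinear (norm_nonneg z')]

theorem exists_isSupConvolution [ProperSpace E] {U : E → ℝ} (hU : UpperSemicontinuous U)
    {A B τ : ℝ} (hB : 0 ≤ B) (hτ : 0 < τ) (hUle : ∀ z, U z ≤ A + B * ‖z‖) :
    ∃ W Z, IsSupConvolution τ U W Z := by
  choose Z hZ using exists_forall_sub_sq_le hU hB hτ hUle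
  exact ⟨fun x => U (Z x) - τ / 2 * ‖x - Z x‖ ^ 2, Z, fun x z => hZ x z, fun _ => rfl⟩

namespace IsSupConvolution

theorem add_inner_add_sq_le (h : IsSupConvolution τ U W Z) (x x' : E) :
    W x + (τ + 1) / 2 * ‖x‖ ^ 2 + ⟪τ • Z x + x, x' - x⟫ + ‖x' - x‖ ^ 2 / 2 ≤
      W x' + (τ + 1) / 2 * ‖x'‖ ^ 2 :=
  calc W x + (τ + 1) / 2 * ‖x‖ ^ 2 + ⟪τ • Z x + x, x' - x⟫ + ‖x' - x‖ ^ 2 / 2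
      = U (Z x) - τ / 2 * ‖x' - Z x‖ ^ 2 + (τ + 1) / 2 * ‖x'‖ ^ 2 := by
        rw [h.eq]
        simp only [norm_sub_sq_real, inner_add_left, inner_sub_right, inner_smul_left,
          conj_trivial, real_inner_self_eq_norm_sq]
        rw [real_inner_comm x (Z x), real_inner_comm x' (Z x), real_inner_comm x x']
        ring
    _ ≤ W x' + (τ + 1) / 2 * ‖x'‖ ^ 2 := by gcongr; exact h.le x' (Z x)

theorem stronglyConvex (h : IsSupConvolution τ U W Z) :
    StronglyConvex fun x => W x + (τ + 1) / 2 * ‖x‖ ^ 2 :=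
  fun x => ⟨_, h.add_inner_add_sq_le x⟩

theorem isSubgradient (h : IsSupConvolution τ U W Z) (x : E) :
    IsSubgradient (fun x => W x + (τ + 1) / 2 * ‖x‖ ^ 2) x (τ • Z x + x) :=
  fun x' => (le_add_of_nonneg_right (by positivity)).trans (h.add_inner_add_sq_le x x')

theorem continuous [FiniteDimensional ℝ E] (h : IsSupConvolution τ U W Z) : Continuous W := by
  have hsub : Continuous fun x => W x + (τ + 1) / 2 * ‖x‖ ^ 2 - (τ + 1) / 2 * ‖x‖ ^ 2 :=
    h.stronglyConvex.continuous.sub (by fun_prop)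
  simpa using hsub

end IsSupConvolution

end SupConvolution

section TheoremOnSums

/-- `(p, X)` belongs to the second order superjet of `u` at `x`. -/
def SuperJet (u : Eu N → ℝ) (x p : Eu N) (X : Mat N) : Prop :=
  X.IsSymm ∧ ∀ ε > 0, ∀ᶠ h in 𝓝 (0 : Eu N),
    u (x + h) ≤ u x + ⟪p, h⟫ + qf X h / 2 + ε * ‖h‖ ^ 2

/-- `(p, X)` belongs to the closed second order superjet of `u` at `x`: it is a limit of elements
`(pₙ, Xₙ)` of the superjets at points `xₙ → x` with `u xₙ → u x`. -/
def ClosedSuperJet (u : Eu N → ℝ) (x p : Eu N) (X : Mat N) : Prop :=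
  ∃ (xs ps : ℕ → Eu N) (Xs : ℕ → Mat N), (∀ n, SuperJet u (xs n) (ps n) (Xs n)) ∧
    Tendsto xs atTop (𝓝 x) ∧ Tendsto (fun n => u (xs n)) atTop (𝓝 (u x)) ∧
    Tendsto ps atTop (𝓝 p) ∧ Tendsto Xs atTop (𝓝 X)

theorem IsSupConvolution.exists_superJet {U W : Eu N → ℝ} {Z : Eu N → Eu N} {τ c : ℝ}
    {x y : Eu N} {S : Eu N →ₗ[ℝ] Eu N} (hW : IsSupConvolution τ U W Z)
    (hexp : HasExpansion (fun x => W x + c / 2 * ‖x‖ ^ 2) x y S) (hS : S.IsSymmetric) :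
    ∃ X : Mat N, (∀ h, qf X h = ⟪S h, h⟫ - c * ‖h‖ ^ 2) ∧ SuperJet U (Z x) (y - c • x) X := by
  obtain ⟨A, rfl⟩ := Matrix.toEuclideanLin.surjective S
  have hq : ∀ h, qf (A - c • 1) h = ⟪A.toEuclideanLin h, h⟫ - c * ‖h‖ ^ 2 := fun h => by
    rw [qf_sub, qf_smul, qf_one, qf]
  refine ⟨A - c • 1, hq, (isSymmetric_toEuclideanLin_iff.1 hS).sub (Matrix.isSymm_one.smul c),
    fun ε hε => ?_⟩
  filter_upwards [hexp ε hε] with h hh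
  have hle := hW.le (x + h) (Z x + h)
  have hup := (abs_le.1 hh).2
  rw [add_sub_add_right_eq_sub] at hle
  rw [norm_add_sq_real, hW.eq x] at hup
  rw [hq, inner_sub_left, inner_smul_left, conj_trivial]
  linarith

theorem tendsto_of_upperSemicontinuousAt {E : Type*} [TopologicalSpace E] {U : E → ℝ} {x : E}
    (hU : UpperSemicontinuousAt U x) {z : ℕ → E} {b : ℕ → ℝ} (hz : Tendsto z atTop (𝓝 x))
    (hb : Tendsto b atTop (𝓝 (U x))) (hle : ∀ n, b n ≤ U (z n)) :
    Tendsto (fun n => U (z n)) atTop (𝓝 (U x)) :=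
  tendsto_order.2 ⟨fun _ ha => (hb.eventually_const_lt ha).mono fun n hn => hn.trans_le (hle n),
    fun a ha => hz.eventually (hU a ha)⟩

theorem exists_subseq_tendsto_matrix {X : ℕ → Mat N} {C : ℝ} (hX : ∀ n i j, |X n i j| ≤ C) :
    ∃ (Y : Mat N) (φ : ℕ → ℕ), StrictMono φ ∧ Tendsto (X ∘ φ) atTop (𝓝 Y) := by
  have hc : IsCompact (Set.univ.pi fun _ : Fin N => Set.univ.pi fun _ : Fin N => Set.Icc (-C) C) :=
    isCompact_univ_pi fun _ => isCompact_univ_pi fun _ => isCompact_Icc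
  obtain ⟨Y, -, φ, hφ, hlim⟩ := IsCompact.tendsto_subseq (X := Fin N → Fin N → ℝ) hc (x := X)
    (fun n i _ j _ => abs_le.1 (hX n i j))
  exact ⟨Y, φ, hφ, hlim⟩

theorem isSymm_of_tendsto {X : ℕ → Mat N} {Y : Mat N} (h : Tendsto X atTop (𝓝 Y))
    (hX : ∀ n, (X n).IsSymm) : Y.IsSymm :=
  (isClosed_eq (Continuous.matrix_transpose continuous_id) continuous_id).mem_of_tendsto h
    (.of_forall hX)

theorem IsSupConvolution.exists_closedSuperJet {U W : Eu N → ℝ} {Z : Eu N → Eu N} {τ C : ℝ}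
    {x y : ℕ → Eu N} {S : ℕ → Eu N →ₗ[ℝ] Eu N} (hτ : 0 < τ) (hU : UpperSemicontinuousAt U 0)
    (hW : IsSupConvolution τ U W Z) (hW0 : W 0 = U 0)
    (hexp : ∀ n, HasExpansion (fun x => W x + (τ + 1) / 2 * ‖x‖ ^ 2) (x n) (y n) (S n))
    (hS : ∀ n, (S n).IsSymmetric) (hSle : ∀ n h, ⟪S n h, h⟫ ≤ C * ‖h‖ ^ 2)
    (hx : Tendsto x atTop (𝓝 0)) (hy : Tendsto y atTop (𝓝 0)) :
    ∃ (X : Mat N) (φ : ℕ → ℕ), StrictMono φ ∧ X.IsSymm ∧ ClosedSuperJet U 0 0 X ∧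
      (∀ h, -(τ * ‖h‖ ^ 2) ≤ qf X h) ∧
      ∀ h, Tendsto (fun n => ⟪S (φ n) h, h⟫) atTop (𝓝 (qf X h + (τ + 1) * ‖h‖ ^ 2)) := by
  have hgrad : ∀ n, τ • Z (x n) + x n = y n := fun n =>
    (hW.isSubgradient (x n)).eq_of_hasExpansion (hexp n)
  have hZ : Tendsto (fun n => Z (x n)) atTop (𝓝 0) := by
    have hlim := (hy.sub hx).const_smul τ⁻¹
    rw [sub_zero, smul_zero] at hlim
    refine hlim.congr fun n => ?_
    rw [← hgrad, add_sub_cancel_right, inv_smul_smul₀ hτ.ne']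
  choose X hX hjet using fun n => hW.exists_superJet (hexp n) (hS n)
  have hlow : ∀ n h, ‖h‖ ^ 2 ≤ ⟪S n h, h⟫ := fun n =>
    (hgrad n ▸ hW.isSubgradient (x n)).sq_norm_le_of_hasExpansion hW.stronglyConvex (hexp n)
  have hbdd : ∀ n i j, |X n i j| ≤ 3 * (C + τ) := fun n => abs_entry_le (hjet n).1 fun h => by
    rw [hX, abs_le]
    constructor <;> linarith [hlow n h, hSle n h, sq_nonneg ‖h‖, mul_nonneg hτ.le (sq_nonneg ‖h‖)]
  obtain ⟨Y, φ, hφ, hY⟩ := exists_subseq_tendsto_matrix hbdd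
  have hqf : ∀ h, Tendsto (fun n => qf (X (φ n)) h) atTop (𝓝 (qf Y h)) := fun h =>
    ((continuous_qf_left h).tendsto Y).comp hY
  refine ⟨Y, φ, hφ, isSymm_of_tendsto hY fun n => (hjet _).1,
    ⟨_, _, _, fun n => hjet (φ n), hZ.comp hφ.tendsto_atTop, ?_, ?_, hY⟩, fun h => ?_, fun h => ?_⟩
  · refine tendsto_of_upperSemicontinuousAt hU (hZ.comp hφ.tendsto_atTop) ?_
      fun n => hW.le_apply hτ.le _
    exact hW0 ▸ (hW.continuous.tendsto 0).comp (hx.comp hφ.tendsto_atTop)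
  · simpa [Function.comp_def] using (hy.sub (hx.const_smul (τ + 1))).comp hφ.tendsto_atTop
  · refine ge_of_tendsto' (hqf h) fun n => ?_
    rw [hX]
    linarith [hlow (φ n) h]
  · exact ((hqf h).add_const ((τ + 1) * ‖h‖ ^ 2)).congr fun n => by rw [hX, sub_add_cancel]

theorem exists_closedSuperJet_pair {U₁ U₂ : Eu N → ℝ} (hU₁ : UpperSemicontinuous U₁)
    (hU₂ : UpperSemicontinuous U₂) {A B σ : ℝ} (hB : 0 ≤ B) (hσ : 0 < σ)
    (hle₁ : ∀ z, U₁ z ≤ A + B * ‖z‖) (hle₂ : ∀ z, U₂ z ≤ A + B * ‖z‖)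
    (hmax : ∀ h k, U₁ h + U₂ k ≤ U₁ 0 + U₂ 0 + σ / 2 * ‖h - k‖ ^ 2) :
    ∃ X₁ X₂ : Mat N, X₁.IsSymm ∧ X₂.IsSymm ∧ ClosedSuperJet U₁ 0 0 X₁ ∧ ClosedSuperJet U₂ 0 0 X₂ ∧
      BlockIneq (3 * σ) X₁ (-X₂) := by
  have hτ : 0 < 3 * σ := by positivity
  obtain ⟨W₁, Z₁, hW₁⟩ := exists_isSupConvolution hU₁ hB hτ hle₁
  obtain ⟨W₂, Z₂, hW₂⟩ := exists_isSupConvolution hU₂ hB hτ hle₂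
  have hsum := hW₁.add_le hW₂ hσ.le hmax
  have hsum0 : W₁ 0 + W₂ 0 ≤ U₁ 0 + U₂ 0 := by simpa using hsum 0 0
  have hW₁0 : W₁ 0 = U₁ 0 := by linarith [hW₁.le_self 0, hW₂.le_self 0]
  have hW₂0 : W₂ 0 = U₂ 0 := by linarith [hW₁.le_self 0, hW₂.le_self 0]
  obtain ⟨x₁, x₂, y₁, y₂, S₁, S₂, ⟨hx₁, hx₂, hy₁, hy₂⟩, hexp₁, hexp₂, hSle⟩ :=
    hW₁.stronglyConvex.exists_hasExpansion_seq hW₂.stronglyConvex (c := 3 * σ + 1) (τ := 3 * σ)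
      fun x y => by
        simp only [norm_zero]
        linarith [hsum x y]
  have hSle' : ∀ n h k, ⟪S₁ n h, h⟫ + ⟪S₂ n k, k⟫ ≤
      (3 * σ + 1 + 1) * (‖h‖ ^ 2 + ‖k‖ ^ 2) + 3 * σ * ‖h - k‖ ^ 2 := fun n h k =>
    (hSle n h k).trans (by
      gcongr
      simpa using Nat.one_div_le_one_div (α := ℝ) (Nat.zero_le n))
  obtain ⟨X₁, φ, hφ, hX₁, hjet₁, hlow₁, hlim₁⟩ := hW₁.exists_closedSuperJet hτ
    (hU₁.upperSemicontinuousAt 0) hW₁0 (fun n => (hexp₁ n).1) (fun n => (hexp₁ n).2)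
    (C := 6 * σ + 2) (fun n h => by
      have := hSle' n h 0
      simp only [map_zero, inner_zero_left, norm_zero, sub_zero] at this
      linarith)
    hx₁ hy₁
  have hφ' := hφ.tendsto_atTop
  obtain ⟨X₂, ψ, hψ, hX₂, hjet₂, hlow₂, hlim₂⟩ := hW₂.exists_closedSuperJet hτ
    (hU₂.upperSemicontinuousAt 0) hW₂0 (fun n => (hexp₂ (φ n)).1) (fun n => (hexp₂ (φ n)).2)
    (C := 6 * σ + 2) (fun n h => by
      have := hSle' (φ n) 0 h
      simp only [map_zero, inner_zero_left, norm_zero, zero_sub, norm_neg] at this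
      linarith)
    (hx₂.comp hφ') (hy₂.comp hφ')
  refine ⟨X₁, X₂, hX₁, hX₂, hjet₁, hjet₂, blockIneq_of_qf hX₁ hX₂.neg (fun h k => ?_)
    fun h k => ?_⟩ <;> rw [qf_neg]
  · linarith [hlow₁ h, hlow₂ k]
  · have hδ : Tendsto (fun n => 1 / ((φ (ψ n) : ℝ) + 1)) atTop (𝓝 0) :=
      tendsto_one_div_add_atTop_nhds_zero_nat.comp (hφ'.comp hψ.tendsto_atTop)
    have hlim := le_of_tendsto_of_tendsto' (((hlim₁ h).comp hψ.tendsto_atTop).add (hlim₂ k))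
      (((hδ.const_add (3 * σ + 1)).mul_const (‖h‖ ^ 2 + ‖k‖ ^ 2)).add_const
        (3 * σ * ‖h - k‖ ^ 2)) fun n => hSle _ h k
    linarith

theorem SuperJet.of_translate {u : Eu N → ℝ} {a p z q : Eu N} {X : Mat N}
    (h : SuperJet (fun z => u (a + z) - ⟪p, z⟫) z q X) : SuperJet u (a + z) (q + p) X := by
  refine ⟨h.1, fun ε hε => ?_⟩
  filter_upwards [h.2 ε hε] with k hk
  rw [inner_add_right] at hk
  rw [add_assoc, inner_add_left]
  linarith

theorem ClosedSuperJet.of_translate {u : Eu N → ℝ} {a p : Eu N} {X : Mat N}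
    (h : ClosedSuperJet (fun z => u (a + z) - ⟪p, z⟫) 0 0 X) : ClosedSuperJet u a p X := by
  obtain ⟨xs, ps, Xs, hjet, hx, hu, hp, hX⟩ := h
  refine ⟨fun n => a + xs n, fun n => ps n + p, Xs, fun n => (hjet n).of_translate, ?_, ?_, ?_, hX⟩
  · simpa using hx.const_add a
  · simpa using hu.add (tendsto_const_nhds.inner hx : Tendsto (fun n => ⟪p, xs n⟫) atTop _)
  · simpa using hp.add_const p

theorem upperSemicontinuous_translate {U : Eu N → ℝ} (hU : UpperSemicontinuous U) (a p : Eu N) :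
    UpperSemicontinuous fun z => U (a + z) - ⟪p, z⟫ := by
  have hlinear : Continuous fun z : Eu N => -⟪p, z⟫ := by fun_prop
  simpa only [sub_eq_add_neg, Function.comp_def] using
    (hU.comp (continuous_const_add a)).add hlinear.upperSemicontinuous

theorem translate_le {U : Eu N → ℝ} {M : ℝ} (hU : ∀ x, U x ≤ M) (a p z : Eu N) :
    U (a + z) - ⟪p, z⟫ ≤ M + ‖p‖ * ‖z‖ := by
  linarith [hU (a + z), neg_le_of_abs_le (abs_real_inner_le_norm p z)]

/-- `(x, y)` is a global maximum point of the doubled functional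
`(x, y) ↦ U x - V y - σ / 2 * ‖x - y + e‖ ^ 2` with penalty `σ` and shift `e`. -/
def IsDoublingMax (U V : Eu N → ℝ) (σ : ℝ) (e x y : Eu N) : Prop :=
  ∀ x' y', U x' - V y' - σ / 2 * ‖x' - y' + e‖ ^ 2 ≤ U x - V y - σ / 2 * ‖x - y + e‖ ^ 2

theorem upperSemicontinuous_neg_of_lowerSemicontinuous {V : Eu N → ℝ}
    (hV : LowerSemicontinuous V) : UpperSemicontinuous fun y => -V y :=
  continuous_neg.comp_lowerSemicontinuous_antitone hV fun _ _ => neg_le_neg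

theorem theorem_on_sums {U V : Eu N → ℝ} (hU : UpperSemicontinuous U)
    (hV : LowerSemicontinuous V) {M σ : ℝ} (hσ : 0 < σ) (hUle : ∀ x, U x ≤ M)
    (hVge : ∀ y, -M ≤ V y) {e x₀ y₀ : Eu N}
    (hmax : IsDoublingMax U V σ e x₀ y₀) :
    ∃ X Y : Mat N, X.IsSymm ∧ Y.IsSymm ∧ BlockIneq (3 * σ) X Y ∧
      ClosedSuperJet U x₀ (σ • (x₀ - y₀ + e)) X ∧
      ClosedSuperJet (fun y => -V y) y₀ (-(σ • (x₀ - y₀ + e))) (-Y) := by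
  set p := σ • (x₀ - y₀ + e) with hp
  have hV' := upperSemicontinuous_neg_of_lowerSemicontinuous hV
  obtain ⟨X₁, X₂, hX₁, hX₂, hjet₁, hjet₂, hblock⟩ := exists_closedSuperJet_pair
    (upperSemicontinuous_translate hU x₀ p) (upperSemicontinuous_translate hV' y₀ (-p))
    (norm_nonneg p) hσ (translate_le hUle x₀ p)
    (by simpa using translate_le (fun y => neg_le.1 (hVge y)) y₀ (-p)) fun h k => by
      have hhk := hmax (x₀ + h) (y₀ + k)
      have hsplit : x₀ + h - (y₀ + k) + e = (x₀ - y₀ + e) + (h - k) := by abel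
      have hinner : ⟪p, h⟫ - ⟪p, k⟫ = σ * ⟪x₀ - y₀ + e, h - k⟫ := by
        rw [← inner_sub_right, hp, inner_smul_left, conj_trivial]
      rw [hsplit, norm_add_sq_real (x₀ - y₀ + e)] at hhk
      simp only [inner_neg_left, inner_zero_right, add_zero]
      linarith
  refine ⟨X₁, -X₂, hX₁, hX₂.neg, hblock, hjet₁.of_translate, ?_⟩
  rw [neg_neg]
  exact hjet₂.of_translate

end TheoremOnSums

theorem qf_of_bilin (B : Eu N →L[ℝ] Eu N →L[ℝ] ℝ) (h : Eu N) :
    qf (Matrix.of fun i j => B (EuclideanSpace.single i 1) (EuclideanSpace.single j 1)) h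
      = B h h := by
  have hsum : h = ∑ i, h i • EuclideanSpace.single i (1 : ℝ) := by
    simpa using ((EuclideanSpace.basisFun (Fin N) ℝ).sum_repr h).symm
  conv_rhs => rw [hsum]
  rw [qf_eq_dotProduct]
  simp only [dotProduct, Matrix.mulVec, Matrix.of_apply, map_sum, map_smul, smul_eq_mul,
    sum_apply, smul_apply, Finset.mul_sum]
  rw [Finset.sum_comm]
  exact Finset.sum_congr rfl fun i _ => Finset.sum_congr rfl fun j _ => by ring

theorem exists_abs_qf_le (X : Mat N) : ∃ C, 0 ≤ C ∧ ∀ h, |qf X h| ≤ C * ‖h‖ ^ 2 := by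
  let T := LinearMap.toContinuousLinearMap X.toEuclideanLin
  refine ⟨‖T‖, norm_nonneg _, fun h => ?_⟩
  calc |qf X h| ≤ ‖T h‖ * ‖h‖ := abs_real_inner_le_norm _ h
    _ ≤ ‖T‖ * ‖h‖ * ‖h‖ := by gcongr; exact T.le_opNorm h
    _ = ‖T‖ * ‖h‖ ^ 2 := by ring

theorem eq_of_qf_eq {X Y : Mat N} (hX : X.IsSymm) (hY : Y.IsSymm) (h : ∀ v, qf X v = qf Y v) :
    X = Y := by
  have hzero : ∀ v, |qf (X - Y) v| ≤ 0 * ‖v‖ ^ 2 := fun v => by simp [qf_sub, h v]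
  ext i j
  have hentry := abs_entry_le (hX.sub hY) hzero i j
  rw [mul_zero, abs_nonpos_iff] at hentry
  exact sub_eq_zero.1 hentry

/-- `(p, X)` is the second order jet of `ψ` at `x`: the matrix `X` is symmetric and
`ψ (x + h) = ψ x + ⟪p, h⟫ + qf X h / 2 + o(‖h‖ ^ 2)`. -/
def HasJet (ψ : Eu N → ℝ) (x p : Eu N) (X : Mat N) : Prop :=
  X.IsSymm ∧ HasExpansion ψ x p X.toEuclideanLin

theorem HasJet.eventually_abs_le {ψ : Eu N → ℝ} {x p : Eu N} {X : Mat N} (h : HasJet ψ x p X)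
    {ε : ℝ} (hε : 0 < ε) :
    ∀ᶠ k in 𝓝 (0 : Eu N), |ψ (x + k) - ψ x - ⟪p, k⟫ - qf X k / 2| ≤ ε * ‖k‖ ^ 2 :=
  h.2 ε hε

theorem eq_and_qf_le_of_jets_le {p q : Eu N} {X Y : Mat N}
    (h : ∀ ε > 0, ∀ᶠ k in 𝓝 (0 : Eu N),
      ⟪q, k⟫ + qf Y k / 2 ≤ ⟪p, k⟫ + qf X k / 2 + ε * ‖k‖ ^ 2) :
    q = p ∧ ∀ k, qf Y k ≤ qf X k := by
  have hqp : q = p := by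
    obtain ⟨C, -, hC⟩ := exists_abs_qf_le (X - Y)
    refine sub_eq_zero.1 (eq_zero_of_eventually_inner_le (C := C / 2 + 1) ?_)
    filter_upwards [h 1 one_pos] with k hk
    have hXY := (abs_le.1 (hC k)).2
    rw [qf_sub] at hXY
    rw [inner_sub_left]
    linarith
  subst hqp
  have hdiff : ∀ k, qf (Y - X) k / 2 ≤ 0 := nonpos_of_eventually_le_sq_norm
    (fun t k => by rw [qf_smul_right]; ring) fun ε hε => by
      filter_upwards [h ε hε] with k hk
      rw [qf_sub]
      linarith
  refine ⟨rfl, fun k => ?_⟩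
  have hk := hdiff k
  rw [qf_sub] at hk
  linarith

theorem HasJet.unique {ψ : Eu N → ℝ} {x p q : Eu N} {X Y : Mat N} (h : HasJet ψ x p X)
    (h' : HasJet ψ x q Y) : p = q ∧ X = Y := by
  have hle : ∀ {p q : Eu N} {X Y : Mat N}, HasJet ψ x p X → HasJet ψ x q Y →
      q = p ∧ ∀ k, qf Y k ≤ qf X k := fun h h' =>
    eq_and_qf_le_of_jets_le fun ε hε => by
      filter_upwards [h.eventually_abs_le (half_pos hε), h'.eventually_abs_le (half_pos hε)]
        with k hk hk'
      linarith [(abs_le.1 hk).2, (abs_le.1 hk').1]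
  exact ⟨(hle h' h).1, eq_of_qf_eq h.1 h'.1 fun v => le_antisymm ((hle h' h).2 v) ((hle h h').2 v)⟩

theorem hasJet_of_contDiffAt {ψ : Eu N → ℝ} {x : Eu N} (h : ContDiffAt ℝ 2 ψ x) :
    HasJet ψ x (gradient ψ x) (hess ψ x) := by
  have hfst : ∀ᶠ y in 𝓝 x, HasFDerivAt ψ (fderiv ℝ ψ y) y := by
    filter_upwards [h.eventually (by simp)] with y hy
    exact (hy.differentiableAt (by simp)).hasFDerivAt
  have hsnd : HasFDerivAt (fderiv ℝ ψ) (fderiv ℝ (fderiv ℝ ψ) x) x :=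
    ((h.fderiv_right (m := 1) (by norm_num)).differentiableAt (by simp)).hasFDerivAt
  refine ⟨?_, fun ε hε => ?_⟩
  · ext i j
    exact second_derivative_symmetric_of_eventually (𝕜 := ℝ) hfst hsnd _ _
  · have hgrad : ∀ k, ⟪gradient ψ x, k⟫ = fderiv ℝ ψ x k := fun k => by simp [gradient]
    have hhess : ∀ k, qf (hess ψ x) k = fderiv ℝ (fderiv ℝ ψ) x k k := qf_of_bilin _
    filter_upwards [abs_sub_sub_sub_le_of_hasFDerivAt hfst hsnd hε] with k hk
    rwa [← hgrad, ← hhess] at hk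

theorem HasJet.gradient_hess_eq {ψ : Eu N → ℝ} {x p : Eu N} {X : Mat N} (hj : HasJet ψ x p X)
    (h : ContDiffAt ℝ 2 ψ x) : gradient ψ x = p ∧ hess ψ x = X :=
  (hasJet_of_contDiffAt h).unique hj

theorem eventually_add_of_eventually {x : Eu N} {P : Eu N → Prop} (h : ∀ᶠ y in 𝓝 x, P y) :
    ∀ᶠ k in 𝓝 0, P (x + k) :=
  ((continuous_const.add continuous_id).tendsto' 0 x (add_zero x)).eventually h

theorem SuperJet.of_touch {u ψ : Eu N → ℝ} {x p : Eu N} {X : Mat N} (hψ : HasJet ψ x p X)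
    (h : ∀ᶠ y in 𝓝 x, u y - ψ y ≤ u x - ψ x) : SuperJet u x p X := by
  refine ⟨hψ.1, fun ε hε => ?_⟩
  filter_upwards [hψ.eventually_abs_le hε, eventually_add_of_eventually h] with k hjet htouch
  linarith [(abs_le.1 hjet).2]

theorem SuperJet.mono {u v : Eu N → ℝ} {x p : Eu N} {X : Mat N} (h : SuperJet v x p X)
    (hle : ∀ᶠ y in 𝓝 x, u y ≤ v y) (hx : u x = v x) : SuperJet u x p X := by
  refine ⟨h.1, fun ε hε => ?_⟩
  filter_upwards [h.2 ε hε, eventually_add_of_eventually hle] with k hjet huv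
  linarith

theorem SuperJet.eq_and_qf_le {u ψ : Eu N → ℝ} {x p q : Eu N} {X Y : Mat N} (h : SuperJet u x p X)
    (hψ : HasJet ψ x q Y) (hle : ∀ᶠ y in 𝓝 x, ψ y ≤ u y) (hx : ψ x = u x) :
    q = p ∧ ∀ k, qf Y k ≤ qf X k := by
  refine eq_and_qf_le_of_jets_le fun ε hε => ?_
  filter_upwards [h.2 (ε / 2) (half_pos hε), hψ.eventually_abs_le (half_pos hε),
    eventually_add_of_eventually hle] with k hu hjet hψu
  linarith [(abs_le.1 hjet).1]

/-- The test function vanishing at `x` with jet `(p, X)` there; the quartic term makes it large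
away from `x`. -/
def testFun (x p : Eu N) (X : Mat N) (K : ℝ) (y : Eu N) : ℝ :=
  ⟪p, y - x⟫ + qf X (y - x) / 2 + K * ‖y - x‖ ^ 4

theorem contDiff_qf (X : Mat N) : ContDiff ℝ 2 fun v : Eu N => qf X v :=
  (LinearMap.toContinuousLinearMap X.toEuclideanLin).contDiff.inner ℝ contDiff_id

theorem contDiff_testFun (x p : Eu N) (X : Mat N) (K : ℝ) : ContDiff ℝ 2 (testFun x p X K) := by
  have hsub : ContDiff ℝ 2 fun y : Eu N => y - x := contDiff_id.sub contDiff_const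
  have hfour : ContDiff ℝ 2 fun y : Eu N => ‖y - x‖ ^ 4 := by
    simpa only [← pow_mul] using (hsub.norm_sq ℝ).pow 2
  exact ((contDiff_const.inner ℝ hsub).add (((contDiff_qf X).comp hsub).div_const 2)).add
    (contDiff_const.mul hfour)

theorem testFun_self (x p : Eu N) (X : Mat N) (K : ℝ) : testFun x p X K x = 0 := by
  simp [testFun, qf_zero_right]

theorem hasJet_testFun (x p : Eu N) {X : Mat N} (hX : X.IsSymm) (K : ℝ) :
    HasJet (testFun x p X K) x p X := by
  refine ⟨hX, fun ε hε => ?_⟩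
  have hsmall : Tendsto (fun h : Eu N => |K| * ‖h‖ ^ 2) (𝓝 0) (𝓝 0) :=
    Continuous.tendsto' (by fun_prop) _ _ (by simp)
  filter_upwards [hsmall.eventually_lt_const hε] with h hh
  have hrem : testFun x p X K (x + h) - testFun x p X K x - ⟪p, h⟫ - qf X h / 2
      = K * ‖h‖ ^ 2 * ‖h‖ ^ 2 := by
    rw [testFun_self, testFun, add_sub_cancel_left]
    ring
  change |testFun x p X K (x + h) - testFun x p X K x - ⟪p, h⟫ - qf X h / 2| ≤ _
  rw [hrem, abs_mul, abs_mul, abs_of_nonneg (sq_nonneg ‖h‖)]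
  gcongr

theorem gradient_testFun (x p : Eu N) {X : Mat N} (hX : X.IsSymm) (K : ℝ) :
    gradient (testFun x p X K) x = p :=
  ((hasJet_testFun x p hX K).gradient_hess_eq (contDiff_testFun x p X K).contDiffAt).1

theorem hess_testFun (x p : Eu N) {X : Mat N} (hX : X.IsSymm) (K : ℝ) :
    hess (testFun x p X K) x = X :=
  ((hasJet_testFun x p hX K).gradient_hess_eq (contDiff_testFun x p X K).contDiffAt).2

theorem exists_testFun_ge {x p : Eu N} {X : Mat N} {r M : ℝ} (hr : 0 < r) (hM : 0 ≤ M) :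
    ∃ K, 0 ≤ K ∧ ∀ y, r ≤ ‖y - x‖ → M ≤ testFun x p X K y := by
  obtain ⟨C, hC, hq⟩ := exists_abs_qf_le X
  refine ⟨M / r ^ 4 + ‖p‖ / r ^ 3 + C / r ^ 2, by positivity, fun y hy => ?_⟩
  have hinner := (abs_le.1 (abs_real_inner_le_norm p (y - x))).1
  have hquad := (abs_le.1 (hq (y - x))).1
  set a := ‖y - x‖
  have ha : 0 < a := hr.trans_le hy
  have hconst : M ≤ M / r ^ 4 * a ^ 4 := by
    rw [div_mul_eq_mul_div, le_div_iff₀ (by positivity)]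
    gcongr
  have hlin : ‖p‖ * a ≤ ‖p‖ / r ^ 3 * a ^ 4 := by
    rw [div_mul_eq_mul_div, le_div_iff₀ (by positivity)]
    calc ‖p‖ * a * r ^ 3 ≤ ‖p‖ * a * a ^ 3 := by gcongr
      _ = ‖p‖ * a ^ 4 := by ring
  have hsq : C * a ^ 2 ≤ C / r ^ 2 * a ^ 4 := by
    rw [div_mul_eq_mul_div, le_div_iff₀ (by positivity)]
    calc C * a ^ 2 * r ^ 2 ≤ C * a ^ 2 * a ^ 2 := by gcongr
      _ = C * a ^ 4 := by ring
  have hCa : 0 ≤ C * a ^ 2 := by positivity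
  rw [testFun]
  linarith

theorem IsContinuousOperator.tendsto {F : Operator N} {O : Set (Eu N)}
    (hF : IsContinuousOperator F O) {ι : Type*} {l : Filter ι} {xs ps : ι → Eu N} {rs : ι → ℝ}
    {Xs : ι → Mat N} {x p : Eu N} {r : ℝ} {X : Mat N} (hx : Tendsto xs l (𝓝 x))
    (hr : Tendsto rs l (𝓝 r)) (hp : Tendsto ps l (𝓝 p)) (hX : Tendsto Xs l (𝓝 X))
    (hxO : x ∈ O) (hXs : X.IsSymm) (hO : ∀ᶠ n in l, xs n ∈ O) (hs : ∀ᶠ n in l, (Xs n).IsSymm) :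
    Tendsto (fun n => F (xs n) (rs n) (ps n) (Xs n)) l (𝓝 (F x r p X)) := by
  have hlim : Tendsto (fun n => (xs n, rs n, ps n, Xs n)) l (𝓝 (x, r, p, X)) :=
    hx.prodMk_nhds (hr.prodMk_nhds (hp.prodMk_nhds hX))
  exact (hF (x, r, p, X) ⟨hxO, hXs⟩).tendsto.comp (tendsto_nhdsWithin_iff.2 ⟨hlim, hO.and hs⟩)

theorem IsContinuousOperator.tendsto_add_smul_one {F : Operator N} {O : Set (Eu N)}
    (hF : IsContinuousOperator F O) {x : Eu N} (hx : x ∈ O) (r : ℝ) (p : Eu N) {X : Mat N}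
    (hX : X.IsSymm) :
    Tendsto (fun ε : ℝ => F x r p (X + ε • 1)) (𝓝 0) (𝓝 (F x r p X)) :=
  hF.tendsto tendsto_const_nhds tendsto_const_nhds tendsto_const_nhds
    (Continuous.tendsto' (by fun_prop) _ _ (by simp)) hx hX (Eventually.of_forall fun _ => hx)
    (Eventually.of_forall fun _ => hX.add (Matrix.isSymm_one.smul _))

theorem IsViscositySupersolution.le_of_subJet {F : Operator N} {O U : Set (Eu N)}
    (hF : IsContinuousOperator F O) (hUO : U ⊆ O) {g : Eu N → ℝ → ℝ}
    {φ : Eu N → ℝ} (hφ : IsViscositySupersolution (fun x r p X => F x r p X - g x r) U φ)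
    {x p : Eu N} {Y : Mat N} (hx : x ∈ U) (hj : SuperJet (fun y => -φ y) x (-p) (-Y)) :
    g x (φ x) ≤ F x (φ x) p Y := by
  have hY : Y.IsSymm := by simpa using hj.1.neg
  have hperturbed : ∀ ε : ℝ, 0 < ε → g x (φ x) ≤ F x (φ x) p (Y + (-ε) • 1) := by
    intro ε hε
    have hsymm : (Y + (-ε) • (1 : Mat N)).IsSymm := hY.add (Matrix.isSymm_one.smul _)
    have hmin : IsLocalMin (fun y => φ y - testFun x p (Y + (-ε) • 1) 0 y) x := by
      have hsub : Tendsto (fun y => y - x) (𝓝 x) (𝓝 0) :=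
        Continuous.tendsto' (by fun_prop) _ _ (sub_self x)
      filter_upwards [hsub.eventually (hj.2 (ε / 2) (half_pos hε))] with y hy
      rw [add_sub_cancel] at hy
      rw [testFun_self]
      simp only [testFun, inner_neg_left, qf_neg, qf_add, qf_smul, qf_one] at hy ⊢
      linarith
    have hineq := hφ x hx _ (contDiff_testFun x p (Y + (-ε) • 1) 0).contDiffAt (hmin.on U)
    rw [gradient_testFun _ _ hsymm, hess_testFun _ _ hsymm] at hineq
    linarith
  have hneg : Tendsto (fun ε : ℝ => -ε) (𝓝[>] 0) (𝓝 0) :=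
    (continuous_neg.tendsto' 0 0 neg_zero).mono_left nhdsWithin_le_nhds
  exact ge_of_tendsto ((hF.tendsto_add_smul_one (hUO hx) (φ x) p hY).comp hneg)
    (eventually_nhdsWithin_of_forall hperturbed)

/-- The positive part of `u` on `closure Ω`, extended by zero. -/
def posExt (Ω : Set (Eu N)) (u : Eu N → ℝ) : Eu N → ℝ :=
  (closure Ω).indicator fun x => max (u x) 0

section PosExt

variable {Ω : Set (Eu N)} {u : Eu N → ℝ}

theorem posExt_nonneg (Ω : Set (Eu N)) (u : Eu N → ℝ) (x : Eu N) : 0 ≤ posExt Ω u x :=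
  Set.indicator_nonneg (fun _ _ => le_max_right _ _) x

theorem posExt_of_mem {x : Eu N} (hx : x ∈ closure Ω) : posExt Ω u x = max (u x) 0 :=
  Set.indicator_of_mem hx _

theorem mem_closure_of_posExt_pos {x : Eu N} (hx : 0 < posExt Ω u x) : x ∈ closure Ω :=
  Set.mem_of_indicator_ne_zero hx.ne'

theorem posExt_eq_of_pos {x : Eu N} (hx : 0 < posExt Ω u x) : posExt Ω u x = u x := by
  have hmax := posExt_of_mem (u := u) (mem_closure_of_posExt_pos hx)
  rw [hmax] at hx ⊢
  exact max_eq_left ((lt_max_iff.1 hx).resolve_right (lt_irrefl 0)).le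

theorem upperSemicontinuous_posExt (hu : UpperSemicontinuousOn u (closure Ω)) :
    UpperSemicontinuous (posExt Ω u) := by
  intro x c hc
  change ∀ᶠ y in 𝓝 x, posExt Ω u y < c
  by_cases hx : x ∈ closure Ω
  · obtain ⟨huc, hc0⟩ := max_lt_iff.1 ((posExt_of_mem hx).symm.trans_lt hc)
    filter_upwards [eventually_nhdsWithin_iff.1 (hu x hx c huc)] with y hy
    by_cases hyΩ : y ∈ closure Ω
    · rw [posExt_of_mem hyΩ]
      exact max_lt (hy hyΩ) hc0
    · rwa [posExt, Set.indicator_of_notMem hyΩ]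
  · rw [posExt, Set.indicator_of_notMem hx] at hc
    filter_upwards [isClosed_closure.isOpen_compl.mem_nhds hx] with y hy
    rwa [posExt, Set.indicator_of_notMem hy]

theorem exists_posExt_le (hΩ : Bornology.IsBounded Ω)
    (hu : UpperSemicontinuousOn u (closure Ω)) : ∃ M > 0, ∀ x, posExt Ω u x ≤ M := by
  obtain ⟨M, hM⟩ := ((upperSemicontinuous_posExt hu).upperSemicontinuousOn
    (closure Ω)).bddAbove_of_isCompact hΩ.isCompact_closure
  refine ⟨max M 1, by positivity, fun x => ?_⟩
  by_cases hx : x ∈ closure Ω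
  · exact (hM ⟨x, hx, rfl⟩).trans (le_max_left _ _)
  · rw [posExt, Set.indicator_of_notMem hx]
    positivity

theorem exists_isMaxOn_sub_testFun (hΩ : Bornology.IsBounded Ω)
    (hu : UpperSemicontinuousOn u (closure Ω)) {x p : Eu N} {X : Mat N} (hx : 0 < posExt Ω u x)
    (hj : SuperJet (posExt Ω u) x p X) {ε : ℝ} (hε : 0 < ε) :
    ∃ K, IsMaxOn (fun y => u y - testFun x p (X + ε • 1) K y) (closure Ω) x := by
  obtain ⟨M, hM, hle⟩ := exists_posExt_le hΩ hu
  obtain ⟨r, hr, hball⟩ := Metric.eventually_nhds_iff_ball.1 (hj.2 (ε / 2) (half_pos hε))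
  obtain ⟨K, hK, hbig⟩ := exists_testFun_ge (x := x) (p := p) (X := X + ε • 1) hr hM.le
  refine ⟨K, fun y hy => ?_⟩
  have huy : u y ≤ posExt Ω u y := (le_max_left _ _).trans (posExt_of_mem hy).ge
  change u y - testFun x p (X + ε • 1) K y ≤ u x - testFun x p (X + ε • 1) K x
  rw [testFun_self, ← posExt_eq_of_pos hx]
  rcases lt_or_ge ‖y - x‖ r with hyr | hyr
  · have hjet := hball (y - x) (by rwa [mem_ball_zero_iff])
    rw [add_sub_cancel] at hjet
    have hquartic : 0 ≤ K * ‖y - x‖ ^ 4 := by positivity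
    simp only [testFun, qf_add, qf_smul, qf_one]
    linarith
  · linarith [hbig y hyr, hle y]

variable {F : Operator N} {O : Set (Eu N)}

theorem IsDirichletSubsolution.le_of_superJet (hF : IsContinuousOperator F O)
    (hΩO : closure Ω ⊆ O) (hΩ : Bornology.IsBounded Ω)
    (hu : UpperSemicontinuousOn u (closure Ω)) (hsub : IsDirichletSubsolution F Ω u)
    {x p : Eu N} {X : Mat N} (hx : 0 < posExt Ω u x) (hj : SuperJet (posExt Ω u) x p X) :
    F x (posExt Ω u x) p X ≤ 0 := by
  have hxcl := mem_closure_of_posExt_pos hx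
  have hperturbed : ∀ ε : ℝ, 0 < ε → F x (posExt Ω u x) p (X + ε • 1) ≤ 0 := by
    intro ε hε
    have hsymm : (X + ε • (1 : Mat N)).IsSymm := hj.1.add (Matrix.isSymm_one.smul _)
    obtain ⟨K, hmax⟩ := exists_isMaxOn_sub_testFun hΩ hu hx hj hε
    have hineq := hsub _ (contDiff_testFun x p (X + ε • 1) K) x hxcl hmax
    rw [gradient_testFun _ _ hsymm, hess_testFun _ _ hsymm, ← posExt_eq_of_pos hx] at hineq
    by_cases hxΩ : x ∈ Ω
    · exact hineq.1 hxΩ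
    · have hxfr : x ∈ frontier Ω := ⟨hxcl, fun h => hxΩ (interior_subset h)⟩
      exact (min_le_iff.1 (hineq.2 hxfr)).resolve_left hx.not_ge
  have hlim := hF.tendsto_add_smul_one (hΩO hxcl) (posExt Ω u x) p hj.1
  exact le_of_tendsto (hlim.mono_left (nhdsWithin_le_nhds (s := Set.Ioi 0)))
    (eventually_nhdsWithin_of_forall hperturbed)

theorem IsDirichletSubsolution.le_of_closedSuperJet (hF : IsContinuousOperator F O)
    (hΩO : closure Ω ⊆ O) (hΩ : Bornology.IsBounded Ω)
    (hu : UpperSemicontinuousOn u (closure Ω)) (hsub : IsDirichletSubsolution F Ω u)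
    {x p : Eu N} {X : Mat N} (hx : 0 < posExt Ω u x) (hj : ClosedSuperJet (posExt Ω u) x p X) :
    F x (posExt Ω u x) p X ≤ 0 := by
  obtain ⟨xs, ps, Xs, hjs, hxs, hus, hps, hXs⟩ := hj
  have hpos : ∀ᶠ n in atTop, 0 < posExt Ω u (xs n) := hus.eventually_const_lt hx
  have hlim := hF.tendsto hxs hus hps hXs (hΩO (mem_closure_of_posExt_pos hx))
    (isSymm_of_tendsto hXs fun n => (hjs n).1)
    (hpos.mono fun n hn => hΩO (mem_closure_of_posExt_pos hn))
    (Eventually.of_forall fun n => (hjs n).1)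
  exact le_of_tendsto hlim (hpos.mono fun n hn => hsub.le_of_superJet hF hΩO hΩ hu hn (hjs n))

end PosExt

/-! ### Comparison in the interior -/

section Truncation

variable {E : Type*}

open Classical in
/-- The function equal to `min f M` on `K` and to `M` elsewhere. It extends a supersolution given
on `K` only to the whole space. -/
def trunc (K : Set E) (f : E → ℝ) (M : ℝ) (y : E) : ℝ :=
  if y ∈ K then min (f y) M else M

variable {K : Set E} {f : E → ℝ} {M c : ℝ} {y : E}

theorem trunc_of_mem (hy : y ∈ K) : trunc K f M y = min (f y) M := if_pos hy

theorem trunc_of_notMem (hy : y ∉ K) : trunc K f M y = M := if_neg hy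

theorem mem_of_trunc_lt (h : trunc K f M y < M) : y ∈ K := by
  by_contra hy
  exact h.ne (trunc_of_notMem hy)

theorem trunc_eq_of_lt (h : trunc K f M y < M) : trunc K f M y = f y := by
  have hy := mem_of_trunc_lt h
  rw [trunc_of_mem hy] at h ⊢
  exact min_eq_left ((min_lt_iff.1 h).resolve_right (lt_irrefl M)).le

theorem le_trunc (hM : c ≤ M) (hf : y ∈ K → c ≤ f y) : c ≤ trunc K f M y := by
  by_cases hy : y ∈ K
  · rw [trunc_of_mem hy]
    exact le_min (hf hy) hM
  · rwa [trunc_of_notMem hy]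

theorem lowerSemicontinuous_trunc [TopologicalSpace E] (hK : IsClosed K)
    (hf : LowerSemicontinuousOn f K) : LowerSemicontinuous (trunc K f M) := by
  intro x a (ha : a < trunc K f M x)
  change ∀ᶠ y in 𝓝 x, a < trunc K f M y
  by_cases hx : x ∈ K
  · rw [trunc_of_mem hx, lt_min_iff] at ha
    filter_upwards [eventually_nhdsWithin_iff.1 (hf x hx a ha.1)] with y hy
    by_cases hyK : y ∈ K
    · rw [trunc_of_mem hyK]
      exact lt_min (hy hyK) ha.2
    · rw [trunc_of_notMem hyK]
      exact ha.2
  · rw [trunc_of_notMem hx] at ha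
    filter_upwards [hK.isOpen_compl.mem_nhds hx] with y hy
    rwa [trunc_of_notMem hy]

end Truncation

section Touching

variable {E : Type*}

theorem upperSemicontinuousOn_div [TopologicalSpace E] {U φ : E → ℝ} {S : Set E}
    (hU : UpperSemicontinuousOn U S) (hφ : LowerSemicontinuousOn φ S)
    (hU0 : ∀ x ∈ S, 0 ≤ U x) (hφ0 : ∀ x ∈ S, 0 < φ x) :
    UpperSemicontinuousOn (fun x => U x / φ x) S := by
  intro x hx a (ha : U x / φ x < a)
  have ha0 : 0 < a := (div_nonneg (hU0 x hx) (hφ0 x hx).le).trans_lt ha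
  rw [div_lt_iff₀ (hφ0 x hx)] at ha
  obtain ⟨t, hUt, hta⟩ := exists_between ha
  filter_upwards [hU x hx t hUt, hφ x hx (t / a) ((div_lt_iff₀' ha0).2 hta),
    self_mem_nhdsWithin] with y hyU hyφ hyS
  rw [div_lt_iff₀ (hφ0 y hyS)]
  exact hyU.trans ((div_lt_iff₀' ha0).1 hyφ)

theorem exists_smul_touching [TopologicalSpace E] {Ω : Set E} {U φ : E → ℝ} {c : ℝ} {x₀ : E}
    (hU : UpperSemicontinuous U) (hφ : LowerSemicontinuousOn φ Ω) (hc : 0 < c)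
    (hcφ : ∀ x ∈ Ω, c ≤ φ x) (hcomp : ∀ s > 0, IsCompact {x | s ≤ U x})
    (hsub : ∀ x, 0 < U x → x ∈ Ω) (hx₀ : 0 < U x₀) :
    ∃ k > 0, (∀ x ∈ Ω, U x ≤ k * φ x) ∧ ∃ z ∈ Ω, U z = k * φ z := by
  have hφpos : ∀ x ∈ Ω, 0 < φ x := fun x hx => hc.trans_le (hcφ x hx)
  have hratio₀ : 0 < U x₀ / φ x₀ := div_pos hx₀ (hφpos x₀ (hsub x₀ hx₀))
  set s := min (U x₀) (c * (U x₀ / φ x₀))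
  have hs : 0 < s := lt_min hx₀ (mul_pos hc hratio₀)
  have hSΩ : {x | s ≤ U x} ⊆ Ω := fun x hx => hsub x (hs.trans_le hx)
  have hx₀S : s ≤ U x₀ := min_le_left _ _
  obtain ⟨z, hz, hmax⟩ := (upperSemicontinuousOn_div (hU.upperSemicontinuousOn _) (hφ.mono hSΩ)
    (fun x hx => hs.le.trans hx) fun x hx => hφpos x (hSΩ hx)).exists_isMaxOn ⟨x₀, hx₀S⟩
    (hcomp s hs)
  have hφz := hφpos z (hSΩ hz)
  refine ⟨U z / φ z, div_pos (hs.trans_le hz) hφz, fun x hx => ?_, z, hSΩ hz,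
    (div_mul_cancel₀ _ hφz.ne').symm⟩
  rcases le_total s (U x) with hxS | hxS
  · exact (div_le_iff₀ (hφpos x hx)).1 (hmax hxS)
  · calc U x ≤ c * (U x₀ / φ x₀) := hxS.trans (min_le_right _ _)
      _ ≤ φ x * (U z / φ z) :=
        mul_le_mul (hcφ x hx) (hmax hx₀S) hratio₀.le (hφpos x hx).le
      _ = U z / φ z * φ x := mul_comm _ _

theorem exists_trunc_touching [MetricSpace E] [ProperSpace E] {Ω : Set E} {U φ : E → ℝ}
    {c M : ℝ} {x₀ : E} (hΩ : IsOpen Ω) (hU : UpperSemicontinuous U)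
    (hUM : ∀ x, U x ≤ M) (hφ : LowerSemicontinuousOn φ Ω) (hc : 0 < c) (hcφ : ∀ x ∈ Ω, c ≤ φ x)
    (hcomp : ∀ s > 0, IsCompact {x | s ≤ U x}) (hsub : ∀ x, 0 < U x → x ∈ Ω) (hx₀ : 0 < U x₀) :
    ∃ k > 0, ∃ K ⊆ Ω, IsCompact K ∧
      LowerSemicontinuous (trunc K (fun y => k * φ y) (M + 1)) ∧
      (∀ y, k * c ≤ trunc K (fun y => k * φ y) (M + 1) y) ∧
      (∀ x, U x ≤ trunc K (fun y => k * φ y) (M + 1) x) ∧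
      (∃ z, U z = trunc K (fun y => k * φ y) (M + 1) z) ∧
      ∃ r > 0, ∀ x y, k * c ≤ U x → dist x y < r → K ∈ 𝓝 y := by
  obtain ⟨k, hk, hle, z, hz, hzk⟩ := exists_smul_touching hU hφ hc hcφ hcomp hsub hx₀
  have hkc : 0 < k * c := mul_pos hk hc
  have hkcφ : ∀ x ∈ Ω, k * c ≤ k * φ x := fun x hx => mul_le_mul_of_nonneg_left (hcφ x hx) hk.le
  set K₀ := {x | k * c ≤ U x}
  obtain ⟨r, hr, hrΩ⟩ := (hcomp _ hkc).exists_cthickening_subset_open hΩ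
    fun x hx => hsub x (hkc.trans_le hx)
  have hKcomp : IsCompact (Metric.cthickening r K₀) := (hcomp _ hkc).cthickening
  have hzK₀ : z ∈ K₀ := (hkcφ z hz).trans hzk.ge
  refine ⟨k, hk, Metric.cthickening r K₀, hrΩ, hKcomp,
    lowerSemicontinuous_trunc hKcomp.isClosed ((continuous_const_mul k).comp_lowerSemicontinuousOn
      (hφ.mono hrΩ) fun _ _ h => mul_le_mul_of_nonneg_left h hk.le),
    fun y => le_trunc (by linarith [hkcφ z hz, hUM z]) fun hy => hkcφ y (hrΩ hy),
    fun x => le_trunc (by linarith [hUM x]) fun hx => hle x (hrΩ hx), ⟨z, ?_⟩, r, hr,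
    fun x y hx hxy => ?_⟩
  · rw [trunc_of_mem (Metric.self_subset_cthickening K₀ hzK₀), ← hzk,
      min_eq_left (by linarith [hUM z])]
  · refine mem_of_superset (Metric.isOpen_thickening.mem_nhds ?_)
      (Metric.thickening_subset_cthickening r K₀)
    exact Metric.mem_thickening_iff.2 ⟨x, hx, by rwa [dist_comm]⟩

end Touching

section Doubling

variable {U V : Eu N → ℝ} {σ : ℝ} {e : Eu N}

theorem exists_isDoublingMax (hU : UpperSemicontinuous U) (hV : LowerSemicontinuous V)
    {A B : Set (Eu N)} (hA : IsCompact A) (hB : IsCompact B) {a b : Eu N} (ha : a ∈ A)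
    (hb : b ∈ B) (hout : ∀ x y, x ∉ A ∨ y ∉ B → U x - V y - σ / 2 * ‖x - y + e‖ ^ 2
      ≤ U a - V b - σ / 2 * ‖a - b + e‖ ^ 2) :
    ∃ x ∈ A, ∃ y ∈ B, IsDoublingMax U V σ e x y := by
  have hpenalty : Continuous fun z : Eu N × Eu N => -(σ / 2 * ‖z.1 - z.2 + e‖ ^ 2) := by fun_prop
  have husc : UpperSemicontinuous fun z : Eu N × Eu N =>
      U z.1 - V z.2 - σ / 2 * ‖z.1 - z.2 + e‖ ^ 2 := by
    simpa only [sub_eq_add_neg, Function.comp_def] using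
      ((hU.comp continuous_fst).add ((upperSemicontinuous_neg_of_lowerSemicontinuous hV).comp
        continuous_snd)).add hpenalty.upperSemicontinuous
  obtain ⟨z, hz, hmax⟩ := (husc.upperSemicontinuousOn (A ×ˢ B)).exists_isMaxOn
    ⟨(a, b), Set.mk_mem_prod ha hb⟩ (hA.prod hB)
  refine ⟨z.1, hz.1, z.2, hz.2, fun x' y' => ?_⟩
  by_cases h : x' ∈ A ∧ y' ∈ B
  · exact hmax (show (x', y') ∈ A ×ˢ B from h)
  · exact (hout x' y' (by tauto)).trans (hmax (show (a, b) ∈ A ×ˢ B from ⟨ha, hb⟩))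

theorem tendsto_of_doubling_gap (hU : UpperSemicontinuous U) (hV : LowerSemicontinuous V)
    (hUV : ∀ x, U x ≤ V x) {M : ℝ} (hUM : ∀ x, U x ≤ M) (hV0 : ∀ y, 0 ≤ V y) {s : ℕ → ℝ}
    (hs0 : ∀ n, 0 < s n) (hs : Tendsto s atTop atTop) {xs ys : ℕ → Eu N} {xb : Eu N}
    (hx : Tendsto xs atTop (𝓝 xb))
    (hgap : ∀ n, s n / 2 * ‖xs n - ys n‖ ^ 2 ≤ U (xs n) - V (ys n)) :
    Tendsto (fun n => U (xs n)) atTop (𝓝 (U xb)) ∧ Tendsto (fun n => V (ys n)) atTop (𝓝 (U xb)) ∧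
      Tendsto (fun n => ‖xs n - ys n‖) atTop (𝓝 0) ∧
      Tendsto (fun n => s n * ‖xs n - ys n‖ ^ 2) atTop (𝓝 0) := by
  have hpen : ∀ n, 0 ≤ s n * ‖xs n - ys n‖ ^ 2 := fun n => by
    have := hs0 n
    positivity
  have hVU : ∀ n, V (ys n) ≤ U (xs n) := fun n => by linarith [hgap n, hpen n]
  have hdist : Tendsto (fun n => ‖xs n - ys n‖) atTop (𝓝 0) := by
    have hsq : Tendsto (fun n => ‖xs n - ys n‖ ^ 2) atTop (𝓝 0) := by
      refine squeeze_zero (fun n => by positivity) (fun n => ?_) (hs.const_div_atTop (2 * M))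
      rw [le_div_iff₀ (hs0 n)]
      linarith [hgap n, hUM (xs n), hV0 (ys n)]
    simpa using hsq.sqrt
  have hy : Tendsto ys atTop (𝓝 xb) := by
    simpa using hx.sub (tendsto_zero_iff_norm_tendsto_zero.2 hdist)
  have hlow : ∀ a < U xb, ∀ᶠ n in atTop, a < V (ys n) := fun a ha =>
    hy.eventually (hV xb a (ha.trans_le (hUV xb)))
  have hup : ∀ a, U xb < a → ∀ᶠ n in atTop, U (xs n) < a := fun a ha => hx.eventually (hU xb a ha)
  have hUlim : Tendsto (fun n => U (xs n)) atTop (𝓝 (U xb)) := tendsto_order.2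
    ⟨fun a ha => (hlow a ha).mono fun n hn => hn.trans_le (hVU n), hup⟩
  have hVlim : Tendsto (fun n => V (ys n)) atTop (𝓝 (U xb)) := tendsto_order.2
    ⟨hlow, fun a ha => (hup a ha).mono fun n hn => (hVU n).trans_lt hn⟩
  refine ⟨hUlim, hVlim, hdist, squeeze_zero hpen (fun n => ?_)
    (by simpa using (hUlim.sub hVlim).const_mul 2)⟩
  linarith [hgap n]

theorem exists_doubling_seq (hU : UpperSemicontinuous U) (hV : LowerSemicontinuous V)
    (hUV : ∀ x, U x ≤ V x) {a M : ℝ} (ha : 0 < a) (haV : ∀ y, a ≤ V y) (hUM : ∀ x, U x ≤ M)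
    (hcomp : IsCompact {x | a ≤ U x}) {K : Set (Eu N)} (hK : IsCompact K)
    (hVK : ∀ y ∉ K, M < V y) {z : Eu N} (hz : U z = V z) :
    ∃ (xb : Eu N) (xs ys : ℕ → Eu N) (s : ℕ → ℝ), (∀ n, 0 < s n) ∧
      (∀ n, IsDoublingMax U V (s n) 0 (xs n) (ys n)) ∧ (∀ n, V (ys n) ≤ U (xs n)) ∧
      Tendsto (fun n => U (xs n)) atTop (𝓝 (U xb)) ∧
      Tendsto (fun n => V (ys n)) atTop (𝓝 (U xb)) ∧
      Tendsto (fun n => ‖xs n - ys n‖) atTop (𝓝 0) ∧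
      Tendsto (fun n => s n * ‖xs n - ys n‖ ^ 2) atTop (𝓝 0) := by
  have hzK : z ∈ K := by
    by_contra hz'
    linarith [hVK z hz', hUM z]
  have hdoubling : ∀ n : ℕ, ∃ x ∈ {x | a ≤ U x}, ∃ y ∈ K, IsDoublingMax U V (n + 1) 0 x y :=
    fun n => exists_isDoublingMax hU hV hcomp hK ((haV z).trans hz.ge) hzK fun x y hxy => by
      have hpen : 0 ≤ ((n : ℝ) + 1) / 2 * ‖x - y + 0‖ ^ 2 := by positivity
      simp only [hz, sub_self, add_zero, norm_zero] at hpen ⊢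
      rcases hxy with hx | hy
      · linarith [haV y, not_le.1 (show ¬a ≤ U x from hx)]
      · linarith [hUM x, hVK y hy]
  choose xs hxs ys _ hmax using hdoubling
  have hgap : ∀ n : ℕ, ((n : ℝ) + 1) / 2 * ‖xs n - ys n‖ ^ 2 ≤ U (xs n) - V (ys n) := fun n => by
    have hzn := hmax n z z
    simp only [hz, sub_self, add_zero, norm_zero] at hzn
    linarith
  obtain ⟨xb, -, θ, hθ, hxlim⟩ := hcomp.tendsto_subseq hxs
  have hs : Tendsto (fun n => (θ n : ℝ) + 1) atTop atTop :=
    tendsto_atTop_add_const_right _ _ (tendsto_natCast_atTop_atTop.comp hθ.tendsto_atTop)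
  refine ⟨xb, xs ∘ θ, ys ∘ θ, fun n => θ n + 1, fun n => by positivity, fun n => hmax (θ n),
    fun n => ?_, tendsto_of_doubling_gap hU hV hUV hUM (fun y => ha.le.trans (haV y))
      (fun n => by positivity) hs hxlim fun n => hgap (θ n)⟩
  have hpen : 0 ≤ ((θ n : ℝ) + 1) / 2 * ‖xs (θ n) - ys (θ n)‖ ^ 2 := by positivity
  exact sub_nonneg.1 (hpen.trans (hgap (θ n)))

end Doubling

section InteriorComparison

theorem SuperJet.inv_smul {φ : Eu N → ℝ} {k : ℝ} (hk : 0 < k) {x p : Eu N} {Y : Mat N}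
    (h : SuperJet (fun y => -(k * φ y)) x (-p) (-Y)) :
    SuperJet (fun y => -φ y) x (-(k⁻¹ • p)) (-(k⁻¹ • Y)) := by
  have hY : Y.IsSymm := by simpa using h.1.neg
  refine ⟨(hY.smul _).neg, fun ε hε => ?_⟩
  filter_upwards [h.2 (k * ε) (by positivity)] with v hv
  rw [qf_neg, inner_neg_left] at hv ⊢
  rw [qf_smul, inner_smul_left, conj_trivial]
  calc -φ (x + v) = k⁻¹ * -(k * φ (x + v)) := by field_simp
    _ ≤ k⁻¹ * (-(k * φ x) + -⟪p, v⟫ + -qf Y v / 2 + k * ε * ‖v‖ ^ 2) := by gcongr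
    _ = -φ x + -(k⁻¹ * ⟪p, v⟫) + -(k⁻¹ * qf Y v) / 2 + ε * ‖v‖ ^ 2 := by field_simp

variable {F : Operator N} {O Ω : Set (Eu N)} {α : ℝ}

theorem IsViscositySupersolution.le_of_subJet_smul (hF : IsContinuousOperator F O)
    (h_hom : IsHomogeneous F O α) (hΩO : Ω ⊆ O) {β k : ℝ} {φ : Eu N → ℝ}
    (hφ : IsViscositySupersolution (fun x r p X => F x r p X - β) Ω φ) (hk : 0 < k)
    {y p : Eu N} {Y : Mat N} (hy : y ∈ Ω)
    (hj : SuperJet (fun z => -(k * φ z)) y (-p) (-Y)) : k ^ α * β ≤ F y (k * φ y) p Y := by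
  have hsuper := hφ.le_of_subJet hF hΩO hy (hj.inv_smul hk)
  have hY : Y.IsSymm := by simpa using hj.1.neg
  have hhom := h_hom y (hΩO hy) (φ y) (k⁻¹ • p) (k⁻¹ • Y) (hY.smul _) k hk.le
  rw [smul_inv_smul₀ hk.ne', smul_inv_smul₀ hk.ne'] at hhom
  rw [hhom]
  exact mul_le_mul_of_nonneg_left hsuper (Real.rpow_nonneg hk.le α)

theorem IsViscositySupersolution.le_of_closedSubJet (hF : IsContinuousOperator F O)
    (h_hom : IsHomogeneous F O α) (hΩ : IsOpen Ω) (hΩO : Ω ⊆ O) {β k M : ℝ} {φ : Eu N → ℝ}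
    (hφ : IsViscositySupersolution (fun x r p X => F x r p X - β) Ω φ) (hk : 0 < k)
    {K : Set (Eu N)} {y p : Eu N} {Y : Mat N} (hy : y ∈ Ω) (hyK : K ∈ 𝓝 y)
    (hyM : trunc K (fun z => k * φ z) M y < M)
    (hj : ClosedSuperJet (fun z => -trunc K (fun z => k * φ z) M z) y (-p) (-Y)) :
    k ^ α * β ≤ F y (trunc K (fun z => k * φ z) M y) p Y := by
  obtain ⟨ys, ps, Ys, hjs, hys, hVs, hps, hYs⟩ := hj
  replace hVs : Tendsto (fun n => trunc K (fun z => k * φ z) M (ys n)) atTop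
    (𝓝 (trunc K (fun z => k * φ z) M y)) := by simpa using hVs.neg
  replace hps : Tendsto (fun n => -ps n) atTop (𝓝 p) := by simpa using hps.neg
  replace hYs : Tendsto (fun n => -Ys n) atTop (𝓝 Y) := by simpa using hYs.neg
  have hmemΩ : ∀ᶠ n in atTop, ys n ∈ Ω := hys.eventually (hΩ.mem_nhds hy)
  refine ge_of_tendsto (hF.tendsto hys hVs hps hYs (hΩO hy)
    (isSymm_of_tendsto hYs fun n => (hjs n).1.neg) (hmemΩ.mono fun n hn => hΩO hn)
    (Eventually.of_forall fun n => (hjs n).1.neg)) ?_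
  filter_upwards [hmemΩ, hys.eventually (eventually_eventually_nhds.2 hyK),
    hVs.eventually_lt_const hyM] with n hnΩ hnK hnM
  have hval := trunc_eq_of_lt hnM
  rw [hval]
  refine hφ.le_of_subJet_smul hF h_hom hΩO hk hnΩ ?_
  rw [neg_neg, neg_neg]
  refine (hjs n).mono ?_ (by rw [hval])
  filter_upwards [hnK] with z (hz : z ∈ K)
  rw [neg_le_neg_iff, trunc_of_mem hz]
  exact min_le_left _ _

theorem mem_of_posExt_pos {u : Eu N → ℝ} (hfr : ∀ ξ ∈ frontier Ω, u ξ ≤ 0) {x : Eu N}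
    (hx : 0 < posExt Ω u x) : x ∈ Ω := by
  by_contra hxΩ
  have hxfr := hfr x ⟨mem_closure_of_posExt_pos hx, fun h => hxΩ (interior_subset h)⟩
  exact hxfr.not_gt (posExt_eq_of_pos hx ▸ hx)

theorem isCompact_le_posExt {u : Eu N → ℝ} (hΩ : Bornology.IsBounded Ω)
    (hu : UpperSemicontinuousOn u (closure Ω)) {s : ℝ} (hs : 0 < s) :
    IsCompact {x | s ≤ posExt Ω u x} :=
  hΩ.isCompact_closure.of_isClosed_subset ((upperSemicontinuous_posExt hu).isClosed_preimage s)
    fun _ hx => mem_closure_of_posExt_pos (hs.trans_le hx)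

theorem exists_blockIneq_of_isDoublingMax {β k M M' s : ℝ} {φ u : Eu N → ℝ} (hΩo : IsOpen Ω)
    (hΩ : Bornology.IsBounded Ω) (hΩO : closure Ω ⊆ O) (hF : IsContinuousOperator F O)
    (h_hom : IsHomogeneous F O α)
    (hsuper : IsViscositySupersolution (fun x r p X => F x r p X - β) Ω φ)
    (hu : UpperSemicontinuousOn u (closure Ω)) (hsub : IsDirichletSubsolution F Ω u)
    (hUM : ∀ x, posExt Ω u x ≤ M) (hk : 0 < k) {K : Set (Eu N)}
    (hVsc : LowerSemicontinuous (trunc K (fun z => k * φ z) M'))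
    (hV : ∀ z, -M ≤ trunc K (fun z => k * φ z) M' z) (hs : 0 < s) {x y : Eu N}
    (hmax : IsDoublingMax (posExt Ω u) (trunc K (fun z => k * φ z) M') s 0 x y)
    (hUx : 0 < posExt Ω u x) (hyΩ : y ∈ Ω) (hyK : K ∈ 𝓝 y)
    (hyM : trunc K (fun z => k * φ z) M' y < M') :
    ∃ X Y : Mat N, X.IsSymm ∧ Y.IsSymm ∧ BlockIneq (3 * s) X Y ∧
      F x (posExt Ω u x) (s • (x - y)) X ≤ 0 ∧
      k ^ α * β ≤ F y (trunc K (fun z => k * φ z) M' y) (s • (x - y)) Y := by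
  obtain ⟨X, Y, hX, hY, hblock, hjX, hjY⟩ :=
    theorem_on_sums (upperSemicontinuous_posExt hu) hVsc hs hUM hV hmax
  rw [add_zero] at hjX hjY
  exact ⟨X, Y, hX, hY, hblock, hsub.le_of_closedSuperJet hF hΩO hΩ hu hUx hjX,
    hsuper.le_of_closedSubJet hF h_hom hΩo (subset_closure.trans hΩO) hk hyΩ hyK hyM hjY⟩

theorem tendsto_modulus {m : ℝ → ℝ} (hm : ContinuousOn m (Set.Ici 0)) (hm0 : m 0 = 0) {a : ℕ → ℝ}
    (ha : ∀ n, 0 ≤ a n) (hlim : Tendsto a atTop (𝓝 0)) :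
    Tendsto (fun n => m (a n)) atTop (𝓝 0) := by
  have hm_at := (hm 0 Set.self_mem_Ici).tendsto
  rw [hm0] at hm_at
  exact hm_at.comp (tendsto_nhdsWithin_iff.2 ⟨hlim, Eventually.of_forall ha⟩)

theorem posExt_nonpos_of_frontier {β c : ℝ} {φ u : Eu N → ℝ} (hβ : 0 < β) (hΩo : IsOpen Ω)
    (hΩ : Bornology.IsBounded Ω) (hΩO : closure Ω ⊆ O) (hF : IsContinuousOperator F O)
    (h_hom : IsHomogeneous F O α) (h_val : IsUniformlyContinuousInValue F O)
    (h_struct : StructureCondition F O) (hφ : LowerSemicontinuousOn φ Ω) (hc : 0 < c)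
    (hcφ : ∀ x ∈ Ω, c ≤ φ x)
    (hsuper : IsViscositySupersolution (fun x r p X => F x r p X - β) Ω φ)
    (hu : UpperSemicontinuousOn u (closure Ω)) (hsub : IsDirichletSubsolution F Ω u)
    (hfr : ∀ ξ ∈ frontier Ω, u ξ ≤ 0) (x : Eu N) : posExt Ω u x ≤ 0 := by
  by_contra! hx₀
  set U := posExt Ω u
  have hUsc : UpperSemicontinuous U := upperSemicontinuous_posExt hu
  obtain ⟨M, hM, hUM⟩ := exists_posExt_le hΩ hu
  have hposΩ : ∀ x, 0 < U x → x ∈ Ω := fun x hx => mem_of_posExt_pos hfr hx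
  have hcomp : ∀ s > 0, IsCompact {x | s ≤ U x} := fun s hs => isCompact_le_posExt hΩ hu hs
  obtain ⟨k, hk, K, hKΩ, hKcomp, hVsc, hVlow, hUV, ⟨z, hz⟩, r, hr, hKnhds⟩ :=
    exists_trunc_touching hΩo hUsc hUM hφ hc hcφ hcomp hposΩ hx₀
  set V := trunc K (fun y => k * φ y) (M + 1) with hV
  have hkc : 0 < k * c := mul_pos hk hc
  obtain ⟨xb, xs, ys, s, hs, hmax, hVU, hUlim, hVlim, hdist, hpen⟩ := exists_doubling_seq hUsc
    hVsc hUV hkc hVlow hUM (hcomp _ hkc) hKcomp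
    (fun y hy => by rw [hV, trunc_of_notMem hy]; exact lt_add_one M) hz
  obtain ⟨m, hmc, hm0, hm⟩ := h_struct M hM
  have hmlim : Tendsto (fun n => m (s n * ‖xs n - ys n‖ ^ 2 + ‖xs n - ys n‖)) atTop (𝓝 0) :=
    tendsto_modulus hmc hm0 (fun n => add_nonneg (mul_nonneg (hs n).le (sq_nonneg _))
      (norm_nonneg _)) (by simpa only [add_zero] using hpen.add hdist)
  have hη : 0 < k ^ α * β := by positivity
  obtain ⟨δ, hδ, hmod⟩ := h_val (U xb) (k ^ α * β / 4) (by positivity)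
  obtain ⟨n, hnr, hnm, hnU, hnV⟩ := ((hdist.eventually_lt_const hr).and
    ((hmlim.eventually_lt_const (half_pos hη)).and ((Metric.tendsto_nhds.1 hUlim δ hδ).and
      (Metric.tendsto_nhds.1 hVlim δ hδ)))).exists
  have hxU : k * c ≤ U (xs n) := (hVlow _).trans (hVU n)
  have hxΩ : xs n ∈ Ω := hposΩ _ (hkc.trans_le hxU)
  have hyK : K ∈ 𝓝 (ys n) := hKnhds _ _ hxU (by rwa [dist_eq_norm])
  have hyΩ : ys n ∈ Ω := hKΩ (mem_of_mem_nhds hyK)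
  have hΩ' : Ω ⊆ O := subset_closure.trans hΩO
  obtain ⟨X, Y, hX, hY, hblock, hsubX, hsuperY⟩ := exists_blockIneq_of_isDoublingMax hΩo hΩ hΩO hF
    h_hom hsuper hu hsub hUM hk hVsc (fun y => by linarith [hVlow y]) (hs n) (hmax n)
    (hkc.trans_le hxU) hyΩ hyK (by linarith [hVU n, hUM (xs n)])
  have hmodX := (abs_lt.1 (hmod _ hnU _ (hΩ' hxΩ) (s n • (xs n - ys n)) X hX)).1
  have hmodY := (abs_lt.1 (hmod _ hnV _ (hΩ' hyΩ) (s n • (xs n - ys n)) Y hY)).2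
  have hstruct := hm X Y hX hY _ (hs n) hblock _ (hΩ' hxΩ) _ (hΩ' hyΩ) (U xb)
    (by rw [abs_of_nonneg (posExt_nonneg Ω u xb)]; exact hUM xb)
  linarith

end InteriorComparison

/-! ### Comparison at the boundary -/

section InwardCone

/-- Near `z`, the set `Ω` contains a truncated cone of fixed aperture and axis `n` issued from each
point of `closure Ω`; that is, `Ω` satisfies a uniform interior cone condition near `z`. The axis
is normalised by `‖n‖ ≤ 1` only, so that `n = 0` is allowed at interior points. -/
def HasInwardCone (Ω : Set (Eu N)) (z : Eu N) : Prop :=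
  ∃ n : Eu N, ‖n‖ ≤ 1 ∧ ∀ᶠ q : Eu N × Eu N × ℝ in 𝓝 (z, n, 0),
    q.1 ∈ closure Ω → 0 < q.2.2 → q.1 + q.2.2 • q.2.1 ∈ Ω

variable {Ω : Set (Eu N)} {z : Eu N}

theorem HasInwardCone.exists_radius (h : HasInwardCone Ω z) :
    ∃ n : Eu N, ‖n‖ ≤ 1 ∧ ∃ ρ > 0, ∀ x ∈ closure Ω, ‖x - z‖ < ρ → ∀ v, ‖v - n‖ < ρ →
      ∀ ε, 0 < ε → ε < ρ → x + ε • v ∈ Ω := by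
  obtain ⟨n, hn, hev⟩ := h
  obtain ⟨ρ, hρ, hball⟩ := Metric.eventually_nhds_iff.1 hev
  refine ⟨n, hn, ρ, hρ, fun x hx hxz v hv ε hε hερ => @hball (x, v, ε) ?_ hx hε⟩
  rw [Prod.dist_eq, Prod.dist_eq]
  exact max_lt (by rwa [dist_eq_norm]) (max_lt (by rwa [dist_eq_norm])
    (by rwa [Real.dist_eq, sub_zero, abs_of_pos hε]))

theorem hasInwardCone_of_mem (hΩ : IsOpen Ω) (hz : z ∈ Ω) : HasInwardCone Ω z := by
  have hcont : Continuous fun q : Eu N × Eu N × ℝ => q.1 + q.2.2 • q.2.1 := by fun_prop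
  have hlim : Tendsto (fun q : Eu N × Eu N × ℝ => q.1 + q.2.2 • q.2.1) (𝓝 (z, 0, 0)) (𝓝 z) := by
    simpa using hcont.tendsto (z, 0, 0)
  exact ⟨0, by simp, (hlim.eventually (hΩ.mem_nhds hz)).mono fun _ hq _ _ => hq⟩

theorem nonneg_of_mem_closure {E : Type*} [TopologicalSpace E] {Ω W : Set E} {g : E → ℝ}
    (hW : IsOpen W) (hg : ContinuousOn g W) (hΩW : Ω ∩ W = {x ∈ W | 0 < g x}) {x : E}
    (hx : x ∈ closure Ω) (hxW : x ∈ W) : 0 ≤ g x := by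
  by_contra! hlt
  obtain ⟨y, ⟨hgy, hyW⟩, hyΩ⟩ := mem_closure_iff_nhds.1 hx _
    (((hg.continuousAt (hW.mem_nhds hxW)).eventually_lt_const hlt).and (hW.mem_nhds hxW))
  have hpos : y ∈ {x ∈ W | 0 < g x} := hΩW ▸ ⟨hyΩ, hyW⟩
  exact lt_asymm hgy hpos.2

theorem exists_norm_le_one_pos {E : Type*} [NormedAddCommGroup E] [NormedSpace ℝ E]
    {L : E →L[ℝ] ℝ} (hL : L ≠ 0) : ∃ n : E, ‖n‖ ≤ 1 ∧ 0 < L n := by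
  obtain ⟨v, hv⟩ : ∃ v, L v ≠ 0 := by
    by_contra! h
    exact hL (ContinuousLinearMap.ext h)
  obtain ⟨w, hw⟩ : ∃ w, 0 < L w := by
    rcases hv.lt_or_gt with h | h
    · exact ⟨-v, by rw [map_neg]; linarith⟩
    · exact ⟨v, h⟩
  have hwn : 0 < ‖w‖ := norm_pos_iff.2 fun h => by simp [h] at hw
  refine ⟨‖w‖⁻¹ • w, ?_, ?_⟩
  · rw [norm_smul, norm_inv, norm_norm, inv_mul_cancel₀ hwn.ne']
  · rw [map_smul, smul_eq_mul]
    positivity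

theorem HasSmoothBoundary.hasInwardCone (hs : HasSmoothBoundary Ω) (hz : z ∈ frontier Ω) :
    HasInwardCone Ω z := by
  obtain ⟨W, hW, hzW, g, hg, hdg, hΩW⟩ := hs z hz
  have hstrict : HasStrictFDerivAt g (fderiv ℝ g z) z :=
    ((hg z hzW).contDiffAt (hW.mem_nhds hzW)).hasStrictFDerivAt (by simp)
  set L := fderiv ℝ g z
  obtain ⟨n, hn, hLn⟩ := exists_norm_le_one_pos (hdg z hzW)
  refine ⟨n, hn, ?_⟩
  have hpair : Tendsto (fun q : Eu N × Eu N × ℝ => (q.1 + q.2.2 • q.2.1, q.1)) (𝓝 (z, n, 0))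
      (𝓝 (z, z)) := by
    have hcont : Continuous fun q : Eu N × Eu N × ℝ => (q.1 + q.2.2 • q.2.1, q.1) := by fun_prop
    simpa using hcont.tendsto (z, n, 0)
  have hremainder := hpair.eventually (hstrict.isLittleO.def (half_pos hLn))
  have hmemW := hpair.eventually ((hW.prod hW).mem_nhds (Set.mk_mem_prod hzW hzW))
  have hdir : ∀ᶠ v in 𝓝 n, L n / 2 * ‖v‖ < L v :=
    (Continuous.tendsto (by fun_prop) n).eventually_lt (L.continuous.tendsto n) (by nlinarith)
  have hsnd : Tendsto (fun q : Eu N × Eu N × ℝ => q.2.1) (𝓝 (z, n, 0)) (𝓝 n) :=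
    (show Continuous fun q : Eu N × Eu N × ℝ => q.2.1 by fun_prop).tendsto (z, n, 0)
  filter_upwards [hremainder, hmemW, hsnd.eventually hdir] with ⟨x, v, ε⟩ hle hxW hv hx hε
  simp only [add_sub_cancel_left, map_smul, smul_eq_mul, norm_smul, Real.norm_eq_abs,
    abs_of_pos hε] at hle hxW hv hε
  have hgx := nonneg_of_mem_closure hW hg.continuousOn hΩW hx hxW.2
  have hgain := mul_lt_mul_of_pos_left hv hε
  have hpos : 0 < g (x + ε • v) := by linarith [(abs_le.1 hle).1]
  have hmem : x + ε • v ∈ Ω ∩ W := hΩW ▸ ⟨hxW.1, hpos⟩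
  exact hmem.1

theorem hasInwardCone_of_mem_closure (hΩ : IsOpen Ω)
    (hcone : ∀ z ∈ frontier Ω, HasInwardCone Ω z) (hz : z ∈ closure Ω) : HasInwardCone Ω z := by
  by_cases hzΩ : z ∈ Ω
  · exact hasInwardCone_of_mem hΩ hzΩ
  · exact hcone z ⟨hz, fun h => hzΩ (interior_subset h)⟩

end InwardCone

section ShiftedDoubling

variable {Ω : Set (Eu N)} {x y z n : Eu N} {ε s : ℝ}

theorem shifted_penalty_eq (hε : 0 < ε) :
    1 / ε ^ 2 / 2 * ‖x - y + ε • n‖ ^ 2 = ‖ε⁻¹ • (y - x) - n‖ ^ 2 / 2 := by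
  have hfactor : x - y + ε • n = (-ε) • (ε⁻¹ • (y - x) - n) := by
    rw [smul_sub, smul_smul, neg_mul, mul_inv_cancel₀ hε.ne']
    module
  rw [hfactor, norm_smul, norm_neg, mul_pow, Real.norm_eq_abs, sq_abs]
  field_simp

theorem norm_le_of_shifted_penalty_le {M : ℝ} (hε : 0 < ε) (hs0 : 0 ≤ s) (hs : s ^ 2 = 2 * M)
    (hn : ‖n‖ ≤ 1) (hpen : 1 / ε ^ 2 / 2 * ‖x - y + ε • n‖ ^ 2 ≤ M) :
    ‖x - y + ε • n‖ ≤ ε * s ∧ ‖x - y‖ ≤ ε * (s + 1) := by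
  have hshift : ‖x - y + ε • n‖ ≤ ε * s := by
    refine le_of_sq_le_sq ?_ (by positivity)
    rw [div_div, one_div_mul_eq_div, div_le_iff₀ (by positivity)] at hpen
    rw [mul_pow, hs]
    linarith
  refine ⟨hshift, ?_⟩
  calc ‖x - y‖ = ‖(x - y + ε • n) - ε • n‖ := by rw [add_sub_cancel_right]
    _ ≤ ‖x - y + ε • n‖ + ‖ε • n‖ := norm_sub_le _ _
    _ ≤ ε * s + ε * 1 := by
      rw [norm_smul, Real.norm_of_nonneg hε.le]
      gcongr
    _ = ε * (s + 1) := by ring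

theorem mem_of_shifted_penalty_lt {ρ : ℝ} (hε : 0 < ε) (hρ : 0 < ρ)
    (hcone : ‖x - z‖ < ρ → ∀ v, ‖v - n‖ < ρ → x + ε • v ∈ Ω)
    (hpen : ‖x - z‖ ^ 2 + 1 / ε ^ 2 / 2 * ‖x - y + ε • n‖ ^ 2 < ρ ^ 2 / 2) : y ∈ Ω := by
  rw [shifted_penalty_eq hε] at hpen
  have hxz : ‖x - z‖ < ρ := lt_of_pow_lt_pow_left₀ 2 hρ.le
    (by linarith [sq_nonneg ‖ε⁻¹ • (y - x) - n‖, sq_nonneg ρ])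
  have hv : ‖ε⁻¹ • (y - x) - n‖ < ρ := lt_of_pow_lt_pow_left₀ 2 hρ.le
    (by linarith [sq_nonneg ‖x - z‖])
  simpa [smul_inv_smul₀ hε.ne'] using hcone hxz _ hv

theorem upperSemicontinuous_sub_continuous {E : Type*} [TopologicalSpace E] {f g : E → ℝ}
    (hf : UpperSemicontinuous f) (hg : Continuous g) : UpperSemicontinuous fun x => f x - g x := by
  simpa only [sub_eq_add_neg] using
    hf.add (Continuous.upperSemicontinuous (f := fun x => -g x) (by fun_prop))

theorem exists_isDoublingMax_of_shift {A D : Set (Eu N)} {W V : Eu N → ℝ} {M σ : ℝ} {e : Eu N}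
    (hA : IsCompact A) (hD : IsCompact D) (hW : UpperSemicontinuous W) (hWM : ∀ x, W x ≤ M)
    (hWA : ∀ x ∉ A, W x ≤ 0) (hV : LowerSemicontinuous V) (hV0 : ∀ y, 0 ≤ V y)
    (hMV : ∀ y ∉ D, M ≤ V y) (hσ : 0 ≤ σ) (hz : z ∈ A) (hb : z + e ∈ D) (hVW : V (z + e) ≤ W z) :
    ∃ x ∈ A, ∃ y ∈ D, IsDoublingMax (fun x => W x - ‖x - z‖ ^ 2) V σ e x y ∧
      W z - V (z + e) ≤ W x - ‖x - z‖ ^ 2 - V y - σ / 2 * ‖x - y + e‖ ^ 2 := by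
  have hbase : W z - ‖z - z‖ ^ 2 - V (z + e) - σ / 2 * ‖z - (z + e) + e‖ ^ 2
      = W z - V (z + e) := by simp
  obtain ⟨x, hx, y, hy, hmax⟩ := exists_isDoublingMax (U := fun x => W x - ‖x - z‖ ^ 2)
    (e := e) (σ := σ)
    (upperSemicontinuous_sub_continuous hW (by fun_prop))
    hV hA hD hz hb fun x y hxy => by
      have hpen : 0 ≤ σ / 2 * ‖x - y + e‖ ^ 2 := by positivity
      rw [hbase]
      rcases hxy with hx | hy
      · linarith [hWA x hx, hV0 y, sq_nonneg ‖x - z‖]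
      · linarith [hWM x, hMV y hy, sq_nonneg ‖x - z‖]
  exact ⟨x, hx, y, hy, hmax, hbase.symm.trans_le (hmax z (z + e))⟩

theorem exists_shifted_isDoublingMax_of_isMaxOn {A D : Set (Eu N)} {W V : Eu N → ℝ} {M η : ℝ}
    (hcone : HasInwardCone Ω z) (hA : IsCompact A) (hAΩ : A ⊆ closure Ω) (hD : IsCompact D)
    (hW : UpperSemicontinuous W) (hWM : ∀ x, W x ≤ M) (hWA : ∀ x ∉ A, W x ≤ 0)
    (hV : LowerSemicontinuous V) (hV0 : ∀ y, 0 ≤ V y) (hVD : ContinuousOn V D)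
    (hMV : ∀ y ∉ D, M ≤ V y) (hη : 0 < η) (hAD : ∀ x ∈ A, ∀ y ∈ closure Ω, ‖x - y‖ < η → y ∈ D)
    (hz : z ∈ A) (hzmax : ∀ x ∈ A, W x - V x ≤ W z - V z) (hpos : 0 < W z - V z)
    (hs0 : 0 ≤ s) (hs : s ^ 2 = 2 * M) :
    ∃ (n : Eu N) (ε : ℝ), 0 < ε ∧ ε * (s + 1) < η ∧ ∃ x ∈ A, ∃ y ∈ Ω,
      IsDoublingMax (fun x => W x - ‖x - z‖ ^ 2) V (1 / ε ^ 2) (ε • n) x y ∧ V y < W x ∧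
      ‖x - y + ε • n‖ ≤ ε * s ∧ ‖x - y‖ ≤ ε * (s + 1) := by
  have hAsubD : A ⊆ D := fun x hx => hAD x hx x (hAΩ hx) (by simpa using hη)
  obtain ⟨n, hn, ρ, hρ, hinward⟩ := hcone.exists_radius
  obtain ⟨κ, hκ0, hκ⟩ := exists_between (lt_min hpos (show 0 < ρ ^ 2 / 4 by positivity))
  rw [lt_min_iff] at hκ
  obtain ⟨τ, hτ, hmod⟩ := Metric.uniformContinuousOn_iff.1
    (hD.uniformContinuousOn_of_continuous hVD) κ hκ0
  obtain ⟨ε, hε, hεmin⟩ := exists_between (show 0 < min ρ (min τ η / (s + 1)) by positivity)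
  rw [lt_min_iff, lt_div_iff₀ (by positivity), lt_min_iff] at hεmin
  obtain ⟨hερ, hετ, hεη⟩ := hεmin
  have hbΩ : z + ε • n ∈ Ω :=
    hinward z (hAΩ hz) (by simpa using hρ) n (by simpa using hρ) ε hε hερ
  have hzb : ‖z - (z + ε • n)‖ ≤ ε * (s + 1) := by
    rw [sub_add_cancel_left, norm_neg, norm_smul, Real.norm_of_nonneg hε.le]
    gcongr
    linarith
  have hbD : z + ε • n ∈ D := hAD z hz _ (subset_closure hbΩ) (hzb.trans_lt hεη)
  have hosc : ∀ x ∈ D, ∀ y ∈ D, ‖x - y‖ ≤ ε * (s + 1) → |V x - V y| < κ :=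
    fun x hx y hy hxy => hmod x hx y hy (by rw [dist_eq_norm]; exact hxy.trans_lt hετ)
  have hVb := (abs_lt.1 (hosc z (hAsubD hz) _ hbD hzb)).1
  obtain ⟨x, hx, y, hy, hmax, hvalue⟩ := exists_isDoublingMax_of_shift (σ := 1 / ε ^ 2) hA hD hW
    hWM hWA hV hV0 hMV (by positivity) hz hbD (by linarith)
  have hpen : 0 ≤ 1 / ε ^ 2 / 2 * ‖x - y + ε • n‖ ^ 2 := by positivity
  have hpen_z := sq_nonneg ‖x - z‖
  obtain ⟨hshift, hdist⟩ := norm_le_of_shifted_penalty_le (x := x) (y := y) hε hs0 hs hn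
    (by linarith [hWM x, hV0 y])
  have hVx := (abs_lt.1 (hosc x (hAsubD hx) y hy hdist)).2
  have hyΩ : y ∈ Ω := mem_of_shifted_penalty_lt hε hρ
    (fun hxz v hv => hinward x (hAΩ hx) hxz v hv ε hε hερ) (by linarith [hzmax x hx])
  exact ⟨n, ε, hε, hεη, x, hx, y, hyΩ, hmax, by linarith, hshift, hdist⟩

theorem exists_shifted_isDoublingMax {A D : Set (Eu N)} {W V : Eu N → ℝ} {M η : ℝ} {ξ : Eu N}
    (hcone : ∀ z ∈ closure Ω, HasInwardCone Ω z) (hA : IsCompact A) (hAΩ : A ⊆ closure Ω)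
    (hD : IsCompact D) (hW : UpperSemicontinuous W) (hWM : ∀ x, W x ≤ M) (hWA : ∀ x ∉ A, W x ≤ 0)
    (hV : LowerSemicontinuous V) (hV0 : ∀ y, 0 ≤ V y) (hVD : ContinuousOn V D)
    (hMV : ∀ y ∉ D, M ≤ V y) (hη : 0 < η)
    (hAD : ∀ x ∈ A, ∀ y ∈ closure Ω, ‖x - y‖ < η → y ∈ D) (hξ : ξ ∈ A) (hVW : V ξ < W ξ)
    (hs0 : 0 ≤ s) (hs : s ^ 2 = 2 * M) :
    ∃ z ∈ A, ∃ (n : Eu N) (ε : ℝ), 0 < ε ∧ ε * (s + 1) < η ∧ ∃ x ∈ A, ∃ y ∈ Ω,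
      IsDoublingMax (fun x => W x - ‖x - z‖ ^ 2) V (1 / ε ^ 2) (ε • n) x y ∧ V y < W x ∧
      ‖x - y + ε • n‖ ≤ ε * s ∧ ‖x - y‖ ≤ ε * (s + 1) := by
  have hAsubD : A ⊆ D := fun x hx => hAD x hx x (hAΩ hx) (by simpa using hη)
  obtain ⟨z, hz, hzmax⟩ := ((hW.upperSemicontinuousOn A).add
    (hVD.mono hAsubD).neg.upperSemicontinuousOn).exists_isMaxOn ⟨ξ, hξ⟩ hA
  simp only [isMaxOn_iff, Pi.neg_apply, ← sub_eq_add_neg] at hzmax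
  exact ⟨z, hz, exists_shifted_isDoublingMax_of_isMaxOn (hcone z (hAΩ hz)) hA hAΩ hD hW hWM hWA hV
    hV0 hVD hMV hη hAD hz hzmax ((sub_pos.2 hVW).trans_le (hzmax ξ hξ)) hs0 hs⟩

theorem shifted_structure_le (hε : 0 < ε) (hshift : ‖x - y + ε • n‖ ≤ ε * s)
    (hdist : ‖x - y‖ ≤ ε * (s + 1)) :
    1 + ‖x - y‖ * ‖(1 / ε ^ 2) • (x - y + ε • n)‖ + 3 * (1 / ε ^ 2) * ‖x - y‖ ^ 2
      ≤ 1 + (s + 1) * s + 3 * (s + 1) ^ 2 := by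
  have hs1 : 0 ≤ ε * (s + 1) := (norm_nonneg _).trans hdist
  rw [norm_smul, Real.norm_of_nonneg (by positivity)]
  calc 1 + ‖x - y‖ * (1 / ε ^ 2 * ‖x - y + ε • n‖) + 3 * (1 / ε ^ 2) * ‖x - y‖ ^ 2
      ≤ 1 + ε * (s + 1) * (1 / ε ^ 2 * (ε * s)) + 3 * (1 / ε ^ 2) * (ε * (s + 1)) ^ 2 := by
        gcongr
    _ = 1 + (s + 1) * s + 3 * (s + 1) ^ 2 := by field_simp

end ShiftedDoubling

section BoundaryComparison

theorem SuperJet.add_sq {u : Eu N → ℝ} {a : ℝ} {ξ x p : Eu N} {X : Mat N}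
    (h : SuperJet (fun z => u z - a * ‖z - ξ‖ ^ 2) x p X) :
    SuperJet u x (p + (2 * a) • (x - ξ)) (X + (2 * a) • 1) := by
  refine ⟨h.1.add (Matrix.isSymm_one.smul _), fun ε hε => ?_⟩
  filter_upwards [h.2 ε hε] with k hk
  rw [add_sub_right_comm, norm_add_sq_real] at hk
  rw [inner_add_left, inner_smul_left, conj_trivial, qf_add, qf_smul, qf_one]
  linarith

theorem ClosedSuperJet.add_sq {u : Eu N → ℝ} {a : ℝ} {ξ x p : Eu N} {X : Mat N}
    (h : ClosedSuperJet (fun z => u z - a * ‖z - ξ‖ ^ 2) x p X) :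
    ClosedSuperJet u x (p + (2 * a) • (x - ξ)) (X + (2 * a) • 1) := by
  obtain ⟨xs, ps, Xs, hj, hx, hu, hp, hX⟩ := h
  refine ⟨xs, fun n => ps n + (2 * a) • (xs n - ξ), fun n => Xs n + (2 * a) • 1,
    fun n => (hj n).add_sq, hx, ?_, hp.add ((hx.sub_const ξ).const_smul _), hX.add_const _⟩
  have hcont : Continuous fun z : Eu N => a * ‖z - ξ‖ ^ 2 := by fun_prop
  simpa using hu.add ((hcont.tendsto x).comp hx)

/-- `B` bounds the oscillation of `F x` on `[0, R] × ℝ^N × S_N`, uniformly in `x ∈ A`, when the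
variables move by at most `d`. -/
def OscillationBound (F : Operator N) (A : Set (Eu N)) (R d B : ℝ) : Prop :=
  ∀ x ∈ A, ∀ r ∈ Set.Icc (0 : ℝ) R, ∀ s ∈ Set.Icc (0 : ℝ) R, ∀ (p q : Eu N) (X Y : Mat N),
    X.IsSymm → Y.IsSymm → |r - s| ≤ d → ‖p - q‖ ≤ d → (∀ i j, |X i j - Y i j| ≤ d) →
      |F x r p X - F x s q Y| ≤ B

theorem OscillationBound.mono {F : Operator N} {A : Set (Eu N)} {R d d' B : ℝ}
    (h : OscillationBound F A R d B) (hd : d' ≤ d) : OscillationBound F A R d' B :=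
  fun x hx r hr s hs p q X Y hX hY hrs hpq hXY => h x hx r hr s hs p q X Y hX hY (hrs.trans hd)
    (hpq.trans hd) fun i j => (hXY i j).trans hd

theorem OscillationBound.two_mul {F : Operator N} {A : Set (Eu N)} {R d B : ℝ}
    (h : OscillationBound F A R d B) : OscillationBound F A R (2 * d) (2 * B) := by
  intro x hx r hr s hs p q X Y hX hY hrs hpq hXY
  have hmid : (r + s) / 2 ∈ Set.Icc 0 R := ⟨by linarith [hr.1, hs.1], by linarith [hr.2, hs.2]⟩
  have hmidX : ((1 / 2 : ℝ) • (X + Y)).IsSymm := (hX.add hY).smul _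
  have hhalf : ‖(1 / 2 : ℝ) • (p - q)‖ ≤ d := by
    rw [norm_smul, Real.norm_of_nonneg (by norm_num)]
    linarith
  have habs : ∀ t : ℝ, |t| ≤ 2 * d → |1 / 2 * t| ≤ d := fun t ht => by
    rw [abs_mul, abs_of_pos one_half_pos]
    linarith
  refine (abs_sub_le _ (F x ((r + s) / 2) ((1 / 2 : ℝ) • (p + q)) ((1 / 2 : ℝ) • (X + Y))) _).trans
    ((add_le_add (h x hx r hr _ hmid p _ X _ hX hmidX ?_ ?_ fun i j => ?_)
      (h x hx _ hmid s hs _ q _ Y hmidX hY ?_ ?_ fun i j => ?_)).trans_eq (_root_.two_mul B).symm)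
  · convert habs _ hrs using 2; ring
  · convert hhalf using 2; module
  · convert habs _ (hXY i j) using 2
    simp only [Matrix.smul_apply, Matrix.add_apply, smul_eq_mul]
    ring
  · convert habs _ hrs using 2; ring
  · convert hhalf using 2; module
  · convert habs _ (hXY i j) using 2
    simp only [Matrix.smul_apply, Matrix.add_apply, smul_eq_mul]
    ring

theorem IsUniformlyContinuousNear.exists_oscillationBound {F : Operator N} {A : Set (Eu N)}
    (h : IsUniformlyContinuousNear F A) {R : ℝ} (hR : 0 < R) (d : ℝ) :
    ∃ B ≥ 0, OscillationBound F A R d B := by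
  obtain ⟨δ, hδ, hmod⟩ := h R hR 1 one_pos
  have hbase : OscillationBound F A R (δ / 2) 1 :=
    fun x hx r hr s hs p q X Y hX hY hrs hpq hXY =>
      (hmod x hx r hr s hs p q X Y hX hY (by linarith) (by linarith) fun i j => by
        linarith [hXY i j]).le
  have hpow : ∀ k : ℕ, OscillationBound F A R (2 ^ k * (δ / 2)) (2 ^ k) := fun k => by
    induction k with
    | zero => simpa using hbase
    | succ k ih => simpa only [pow_succ', mul_assoc] using ih.two_mul
  obtain ⟨k, hk⟩ := pow_unbounded_of_one_lt (d / (δ / 2)) one_lt_two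
  exact ⟨2 ^ k, by positivity, (hpow k).mono ((div_le_iff₀ (by positivity)).1 hk.le)⟩

variable {F : Operator N} {O Ω A : Set (Eu N)} {α β : ℝ} {u : Eu N → ℝ} {ξ : Eu N}

/-- The boundary point `ξ` admits a barrier `w` with `F[w] ≥ β`; for `β = 1` this is
`AdmitsBarrier`. Other values of `β` appear when the operator is perturbed. -/
def HasBarrier (F : Operator N) (Ω : Set (Eu N)) (ξ : Eu N) (β : ℝ) : Prop :=
  ∃ ρ > 0, ∃ w : Eu N → ℝ, ContinuousOn w (closure (Ω ∩ Metric.ball ξ ρ)) ∧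
    (∀ x ∈ closure (Ω ∩ Metric.ball ξ ρ), 0 ≤ w x) ∧ w ξ = 0 ∧
    IsViscositySupersolution (fun x r p X => F x r p X - β) (Ω ∩ Metric.ball ξ ρ) w

theorem IsDirichletSubsolution.le_of_closedSuperJet_penalized (hΩ : Bornology.IsBounded Ω)
    (hΩO : closure Ω ⊆ O) (hF : IsContinuousOperator F O)
    (hu : UpperSemicontinuousOn u (closure Ω)) (hsub : IsDirichletSubsolution F Ω u)
    {M B C d : ℝ} (hB : OscillationBound F A M d B) {x z p : Eu N} {X : Mat N} (hxA : x ∈ A)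
    (hX : X.IsSymm) (hx : 0 < posExt Ω u x) (hxM : posExt Ω u x ≤ M) (hC : 0 ≤ C)
    (hd : 2 * ‖x - z‖ + 2 * C * ‖x - ξ‖ ≤ d) (hdC : 2 + 2 * C ≤ d)
    (hj : ClosedSuperJet (fun x => posExt Ω u x - C * ‖x - ξ‖ ^ 2 - ‖x - z‖ ^ 2) x p X) :
    F x (posExt Ω u x) p X ≤ B := by
  replace hj : ClosedSuperJet (fun x => posExt Ω u x - C * ‖x - ξ‖ ^ 2 - 1 * ‖x - z‖ ^ 2) x p X :=
    by simpa only [one_mul] using hj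
  have hle := hsub.le_of_closedSuperJet hF hΩO hΩ hu hx hj.add_sq.add_sq
  have hI : posExt Ω u x ∈ Set.Icc 0 M := ⟨hx.le, hxM⟩
  have hosc := hB x hxA _ hI _ hI p (p + (2 * 1 : ℝ) • (x - z) + (2 * C) • (x - ξ)) X
    (X + (2 * 1 : ℝ) • 1 + (2 * C) • 1) hX
    ((hX.add (Matrix.isSymm_one.smul _)).add (Matrix.isSymm_one.smul _))
    (by rw [sub_self, abs_zero]; linarith) ?_ fun i j => ?_
  · linarith [(abs_le.1 hosc).2]
  · rw [norm_sub_rev, add_assoc, add_sub_cancel_left]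
    refine (norm_add_le _ _).trans ?_
    rw [norm_smul, norm_smul, Real.norm_of_nonneg (by norm_num),
      Real.norm_of_nonneg (by positivity)]
    linarith
  · have hone : |(1 : Mat N) i j| ≤ 1 := by
      rw [Matrix.one_apply]
      split_ifs <;> simp
    rw [abs_sub_comm, add_assoc, ← add_smul, Matrix.add_apply, add_sub_cancel_left,
      Matrix.smul_apply, smul_eq_mul, abs_mul, abs_of_nonneg (by positivity)]
    nlinarith

theorem closure_inter_closedBall_subset {E : Type*} [PseudoMetricSpace E] {Ω : Set E} {ξ : E}
    {r ρ : ℝ} (h : r < ρ) :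
    closure Ω ∩ Metric.closedBall ξ r ⊆ closure (Ω ∩ Metric.ball ξ ρ) := by
  rw [Set.inter_comm, Set.inter_comm Ω]
  exact (Set.inter_subset_inter_left _ (Metric.closedBall_subset_ball h)).trans
    Metric.isOpen_ball.inter_closure

theorem exists_barrier_isDoublingMax (hΩ : Bornology.IsBounded Ω)
    (hcone : ∀ z ∈ closure Ω, HasInwardCone Ω z) {U w : Eu N → ℝ} {M C r s k : ℝ}
    (hU : UpperSemicontinuous U) (hUM : ∀ x, U x ≤ M) (hU0 : ∀ x ∉ closure Ω, U x = 0)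
    (hw : ContinuousOn w (closure Ω ∩ Metric.closedBall ξ (3 * r)))
    (hw0 : ∀ x ∈ closure Ω ∩ Metric.closedBall ξ (3 * r), 0 ≤ w x) (hwξ : w ξ = 0)
    (hM : 0 < M) (hr : 0 < r) (hk : 0 < k) (hC : C * (2 * r) ^ 2 = M) (hs0 : 0 ≤ s)
    (hs : s ^ 2 = 2 * M) (hξ : ξ ∈ closure Ω) (hUξ : 0 < U ξ) :
    ∃ (z n : Eu N) (ε : ℝ), 0 < ε ∧ ‖z - ξ‖ ≤ 2 * r ∧ ∃ x ∈ closure Ω, ‖x - ξ‖ ≤ 2 * r ∧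
      ∃ y ∈ Ω, ‖y - ξ‖ < 3 * r ∧
      IsDoublingMax (fun x => U x - C * ‖x - ξ‖ ^ 2 - ‖x - z‖ ^ 2)
        (trunc (closure Ω ∩ Metric.closedBall ξ (3 * r)) (fun y => k * w y) (M + 1))
        (1 / ε ^ 2) (ε • n) x y ∧
      trunc (closure Ω ∩ Metric.closedBall ξ (3 * r)) (fun y => k * w y) (M + 1) y < U x ∧
      ‖x - y + ε • n‖ ≤ ε * s ∧ ‖x - y‖ ≤ ε * (s + 1) := by
  set D := closure Ω ∩ Metric.closedBall ξ (3 * r)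
  have hCpos : 0 < C := pos_of_mul_pos_left (hC ▸ hM) (by positivity)
  have hcompact : ∀ R, IsCompact (closure Ω ∩ Metric.closedBall ξ R) := fun R =>
    hΩ.isCompact_closure.inter_right Metric.isClosed_closedBall
  have hξD : ξ ∈ D := ⟨hξ, Metric.mem_closedBall_self (by positivity)⟩
  have hkw : ContinuousOn (fun y => k * w y) D := continuousOn_const.mul hw
  have hWU : ∀ x, U x - C * ‖x - ξ‖ ^ 2 ≤ U x := fun x => sub_le_self _ (by positivity)
  have hWA : ∀ x ∉ closure Ω ∩ Metric.closedBall ξ (2 * r), U x - C * ‖x - ξ‖ ^ 2 ≤ 0 := by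
    intro x hx
    by_cases hxΩ : x ∈ closure Ω
    · have hfar : 2 * r < ‖x - ξ‖ := not_le.1 fun h => hx ⟨hxΩ, mem_closedBall_iff_norm.2 h⟩
      have hpen : C * (2 * r) ^ 2 ≤ C * ‖x - ξ‖ ^ 2 := by gcongr
      linarith [hUM x]
    · exact (hWU x).trans (hU0 x hxΩ).le
  have hnear : ∀ x ∈ Metric.closedBall ξ (2 * r), ∀ y, ‖x - y‖ < r → ‖y - ξ‖ < 3 * r := by
    intro x hx y hxy
    have htri := norm_sub_le_norm_sub_add_norm_sub y x ξ
    rw [norm_sub_rev y x] at htri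
    linarith [mem_closedBall_iff_norm.1 hx]
  obtain ⟨z, hz, n, ε, hε, hεr, x, hx, y, hy, hmax, hVW, hshift, hdist⟩ :=
    exists_shifted_isDoublingMax (A := closure Ω ∩ Metric.closedBall ξ (2 * r))
      (W := fun x => U x - C * ‖x - ξ‖ ^ 2) (V := trunc D (fun y => k * w y) (M + 1))
      hcone (hcompact _) Set.inter_subset_left (hcompact _)
      (upperSemicontinuous_sub_continuous hU (by fun_prop))
      (fun x => (hWU x).trans (hUM x)) hWA
      (lowerSemicontinuous_trunc (hcompact _).isClosed hkw.lowerSemicontinuousOn)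
      (fun y => le_trunc (by linarith) fun hy => mul_nonneg hk.le (hw0 y hy))
      ((hkw.inf continuousOn_const).congr fun y hy => trunc_of_mem hy)
      (fun y hy => (lt_add_one M).le.trans_eq (trunc_of_notMem hy).symm) hr
      (fun x hx y hy hxy => ⟨hy, mem_closedBall_iff_norm.2 (hnear x hx.2 y hxy).le⟩)
      ⟨hξ, Metric.mem_closedBall_self (by positivity)⟩
      (by rw [trunc_of_mem hξD, hwξ, mul_zero, min_eq_left (by positivity)]; simpa using hUξ)
      hs0 hs
  exact ⟨z, n, ε, hε, mem_closedBall_iff_norm.1 hz.2, x, hx.1, mem_closedBall_iff_norm.1 hx.2, y,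
    hy, hnear x hx.2 y (hdist.trans_lt hεr), hmax, hVW.trans_le (hWU x), hshift, hdist⟩

theorem rpow_mul_le_of_barrier_isDoublingMax (hΩ : Bornology.IsBounded Ω) (hΩO : closure Ω ⊆ O)
    (hF : IsContinuousOperator F O) (h_hom : IsHomogeneous F O α)
    (hu : UpperSemicontinuousOn u (closure Ω)) (hsub : IsDirichletSubsolution F Ω u)
    {B C K M d k ε s : ℝ} {w : Eu N → ℝ} {D G : Set (Eu N)} {n x y z : Eu N}
    (hB : OscillationBound F A M d B) (hMd : M ≤ d) (hdC : 2 + 2 * C ≤ d)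
    (hd : 2 * ‖x - z‖ + 2 * C * ‖x - ξ‖ ≤ d) (hK : 0 ≤ K)
    (hstruct : ∀ X Y : Mat N, X.IsSymm → Y.IsSymm → ∀ σ > 0, BlockIneq σ X Y → ∀ x ∈ A, ∀ y ∈ A,
      ∀ r : ℝ, |r| ≤ M → ∀ p : Eu N,
        F y r p Y - F x r p X ≤ K * (1 + ‖x - y‖ * ‖p‖ + σ * ‖x - y‖ ^ 2))
    (hM : 0 < M) (hUM : ∀ x, posExt Ω u x ≤ M) (hC : 0 ≤ C) (hk : 0 < k) (hε : 0 < ε)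
    (hDc : IsClosed D) (hw : ContinuousOn w D) (hw0 : ∀ x ∈ D, 0 ≤ w x) (hG : IsOpen G)
    (hGO : G ⊆ O) (hsuper : IsViscositySupersolution (fun x r p X => F x r p X - β) G w)
    (hxA : x ∈ A) (hyA : y ∈ A) (hyG : y ∈ G) (hDy : D ∈ 𝓝 y)
    (hmax : IsDoublingMax (fun x => posExt Ω u x - C * ‖x - ξ‖ ^ 2 - ‖x - z‖ ^ 2)
      (trunc D (fun y => k * w y) (M + 1)) (1 / ε ^ 2) (ε • n) x y)
    (hVU : trunc D (fun y => k * w y) (M + 1) y < posExt Ω u x)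
    (hshift : ‖x - y + ε • n‖ ≤ ε * s) (hdist : ‖x - y‖ ≤ ε * (s + 1)) :
    k ^ α * β ≤ 2 * B + K * (1 + (s + 1) * s + 3 * (s + 1) ^ 2) := by
  set V := trunc D (fun y => k * w y) (M + 1)
  have hV0 : ∀ y, 0 ≤ V y := fun y => le_trunc (by linarith) fun hy => mul_nonneg hk.le (hw0 y hy)
  have hUx : 0 < posExt Ω u x := (hV0 y).trans_lt hVU
  obtain ⟨X, Y, hX, hY, hblock, hjX, hjY⟩ := theorem_on_sums (M := M)
    (upperSemicontinuous_sub_continuous (upperSemicontinuous_sub_continuous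
      (upperSemicontinuous_posExt hu) (by fun_prop)) (by fun_prop))
    (lowerSemicontinuous_trunc (f := fun y => k * w y) hDc
      (continuousOn_const.mul hw).lowerSemicontinuousOn)
    (show 0 < 1 / ε ^ 2 by positivity)
    (fun x => by
      have hpen : 0 ≤ C * ‖x - ξ‖ ^ 2 := by positivity
      linarith [hUM x, sq_nonneg ‖x - z‖])
    (fun y => by linarith [hV0 y]) hmax
  set p := (1 / ε ^ 2) • (x - y + ε • n)
  have hFx : F x (posExt Ω u x) p X ≤ B :=
    hsub.le_of_closedSuperJet_penalized hΩ hΩO hF hu hB hxA hX hUx (hUM x) hC hd hdC hjX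
  have hFy : k ^ α * β ≤ F y (V y) p Y :=
    hsuper.le_of_closedSubJet hF h_hom hG hGO hk hyG hDy (by linarith [hUM x]) hjY
  have hosc : F y (V y) p Y - F y (posExt Ω u x) p Y ≤ B := (le_abs_self _).trans
    (hB y hyA (V y) ⟨hV0 y, hVU.le.trans (hUM x)⟩ _ ⟨hUx.le, hUM x⟩ p p Y Y hY hY
      (abs_le.2 ⟨by linarith [hUM x, hV0 y], by linarith⟩)
      (by rw [sub_self, norm_zero]; linarith) fun i j => by rw [sub_self, abs_zero]; linarith)
  have hcompare := hstruct X Y hX hY (3 * (1 / ε ^ 2)) (by positivity) hblock x hxA y hyA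
    (posExt Ω u x) (by rw [abs_of_pos hUx]; exact hUM x) p
  have herror := mul_le_mul_of_nonneg_left (shifted_structure_le hε hshift hdist) hK
  linarith

/-- The scales `k` of the multiples `k w` of a barrier stay bounded because doubling `k w` against
a subsolution that is positive at `ξ` costs only an error independent of `k`. -/
theorem exists_rpow_mul_le_of_barrier (hΩo : IsOpen Ω) (hΩ : Bornology.IsBounded Ω)
    (hcone : ∀ z ∈ frontier Ω, HasInwardCone Ω z) (hΩO : closure Ω ⊆ O) (hA : A ∈ 𝓝 ξ)
    (hF : IsContinuousOperator F O) (h_hom : IsHomogeneous F O α)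
    (h_unif : IsUniformlyContinuousNear F (closure Ω ∩ A))
    (h_bdry : BoundaryStructureCondition F (closure Ω ∩ A))
    (hu : UpperSemicontinuousOn u (closure Ω)) (hsub : IsDirichletSubsolution F Ω u)
    (hξ : ξ ∈ closure Ω) (hpos : 0 < u ξ) (hbarrier : HasBarrier F Ω ξ β) :
    ∃ T, ∀ k > 0, k ^ α * β ≤ T := by
  obtain ⟨ρ₀, hρ₀, w, hw, hw0, hwξ, hsuper⟩ := hbarrier
  obtain ⟨ρ₁, hρ₁, hballA⟩ := Metric.mem_nhds_iff.1 hA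
  obtain ⟨r, hr, hrρ⟩ := exists_between (show 0 < min ρ₀ ρ₁ / 3 by positivity)
  obtain ⟨hr₀, hr₁⟩ := lt_min_iff.1 ((lt_div_iff₀' (by norm_num)).1 hrρ)
  have hmemA : ∀ x, ‖x - ξ‖ < 3 * r → x ∈ A := fun x hx =>
    hballA (mem_ball_iff_norm.2 (hx.trans hr₁))
  have hD := closure_inter_closedBall_subset (Ω := Ω) (ξ := ξ) hr₀
  have hw0D := fun x hx => hw0 x (hD hx)
  obtain ⟨M, hM, hUM⟩ := exists_posExt_le hΩ hu
  set C := M / (2 * r) ^ 2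
  have hC : 0 < C := by positivity
  set d := max M (8 * r + 4 * C * r + 2 + 2 * C)
  have hd : 8 * r + 4 * C * r + 2 + 2 * C ≤ d := le_max_right _ _
  obtain ⟨B, -, hB⟩ := h_unif.exists_oscillationBound hM d
  obtain ⟨K, hK, hstruct⟩ := h_bdry M hM
  set s := Real.sqrt (2 * M)
  refine ⟨2 * B + K * (1 + (s + 1) * s + 3 * (s + 1) ^ 2), fun k hk => ?_⟩
  obtain ⟨z, n, ε, hε, hzξ, x, hx, hxξ, y, hy, hyξ, hmax, hVU, hshift, hdist⟩ :=
    exists_barrier_isDoublingMax hΩ (fun z hz => hasInwardCone_of_mem_closure hΩo hcone hz)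
      (upperSemicontinuous_posExt hu) hUM (fun x hx => Set.indicator_of_notMem hx _)
      (hw.mono hD) hw0D hwξ hM hr hk (div_mul_cancel₀ _ (by positivity)) (Real.sqrt_nonneg _)
      (Real.sq_sqrt (by positivity)) hξ
      (by rw [posExt_of_mem hξ]; exact lt_max_of_lt_left hpos)
  have hxz := norm_sub_le_norm_sub_add_norm_sub x ξ z
  rw [norm_sub_rev ξ z] at hxz
  exact rpow_mul_le_of_barrier_isDoublingMax hΩ hΩO hF h_hom hu hsub hB (le_max_left _ _)
    (by linarith [mul_pos hC hr]) (by nlinarith) hK.le hstruct hM hUM hC.le hk hε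
    (isClosed_closure.inter Metric.isClosed_closedBall) (hw.mono hD) hw0D
    (hΩo.inter Metric.isOpen_ball) (Set.inter_subset_left.trans (subset_closure.trans hΩO)) hsuper
    ⟨hx, hmemA x (by linarith)⟩ ⟨subset_closure hy, hmemA y hyξ⟩
    ⟨hy, mem_ball_iff_norm.2 (hyξ.trans hr₀)⟩
    (inter_mem (mem_of_superset (hΩo.mem_nhds hy) subset_closure)
      (Metric.closedBall_mem_nhds_of_mem (mem_ball_iff_norm.2 hyξ)))
    hmax hVU hshift hdist

theorem IsDirichletSubsolution.nonpos_of_barrier (hα : 0 < α) (hβ : 0 < β) (hΩo : IsOpen Ω)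
    (hΩ : Bornology.IsBounded Ω) (hcone : ∀ z ∈ frontier Ω, HasInwardCone Ω z)
    (hΩO : closure Ω ⊆ O) (hA : A ∈ 𝓝 ξ) (hF : IsContinuousOperator F O)
    (h_hom : IsHomogeneous F O α) (h_unif : IsUniformlyContinuousNear F (closure Ω ∩ A))
    (h_bdry : BoundaryStructureCondition F (closure Ω ∩ A))
    (hu : UpperSemicontinuousOn u (closure Ω)) (hsub : IsDirichletSubsolution F Ω u)
    (hξ : ξ ∈ closure Ω) (hbarrier : HasBarrier F Ω ξ β) : u ξ ≤ 0 := by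
  by_contra! hpos
  obtain ⟨T, hT⟩ := exists_rpow_mul_le_of_barrier hΩo hΩ hcone hΩO hA hF h_hom h_unif h_bdry hu
    hsub hξ hpos hbarrier
  obtain ⟨k, hkT, hk⟩ := ((((tendsto_rpow_atTop hα).atTop_mul_const hβ).eventually_gt_atTop T).and
    (eventually_gt_atTop 0)).exists
  exact hkT.not_ge (hT k hk)

end BoundaryComparison

/-! ### Half-relaxed limits and Perron's method -/

section RelaxedLimits

variable {E : Type*} [TopologicalSpace E]

theorem eventually_sub_lt_of_continuousAt {v : ℕ × E → ℝ} {u Q : E → ℝ} {y : E}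
    (hv : ∀ c, u y < c → ∀ᶠ q in atTop ×ˢ 𝓝 y, v q < c) (hQ : ContinuousAt Q y) {c : ℝ}
    (hc : u y - Q y < c) : ∀ᶠ q in atTop ×ˢ 𝓝 y, v q - Q q.2 < c := by
  have hgap : 0 < (c - (u y - Q y)) / 2 := half_pos (sub_pos.2 hc)
  have hQ' : ∀ᶠ q : ℕ × E in atTop ×ˢ 𝓝 y, Q y - (c - (u y - Q y)) / 2 < Q q.2 :=
    (hQ.tendsto.comp tendsto_snd).eventually_const_lt (sub_lt_self _ hgap)
  filter_upwards [hv _ (lt_add_of_pos_right _ hgap), hQ'] with q hvq hQq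
  linarith

theorem eventually_forall_mem_of_isCompact {A : Set E} (hA : IsCompact A) {P : ℕ → E → Prop}
    (hP : ∀ y ∈ A, ∀ᶠ q : ℕ × E in atTop ×ˢ 𝓝 y, P q.1 q.2) :
    ∀ᶠ m in atTop, ∀ y ∈ A, P m y :=
  Eventually.mono (Eventually.curry (hA.mem_prod_nhdsSet_of_forall hP))
    fun _ h => h.self_of_nhdsSet

theorem tendsto_of_strictMax {K : Set E} (hK : IsCompact K) {w : ℕ → E → ℝ} {g : E → ℝ} {x : E}
    (hlim : ∀ y ∈ K, ∀ c, g y < c → ∀ᶠ q : ℕ × E in atTop ×ˢ 𝓝 y, w q.1 q.2 < c)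
    (hmax : ∀ y ∈ K, y ≠ x → g y < g x) {a : ℕ → ℝ} (ha : Tendsto a atTop (𝓝 (g x)))
    {y : ℕ → E} (hyK : ∀ m, y m ∈ K) (hay : ∀ᶠ m in atTop, a m ≤ w m (y m)) :
    Tendsto y atTop (𝓝 x) := by
  rw [tendsto_nhds]
  intro W hW hxW
  have hlt : ∀ᶠ m in atTop, ∀ z ∈ K \ W, w m z < a m := by
    refine eventually_forall_mem_of_isCompact (hK.diff hW) fun z hz => ?_
    obtain ⟨c, hzc, hcx⟩ := exists_between (hmax z hz.1 fun h => hz.2 (h ▸ hxW))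
    filter_upwards [hlim z hz.1 c hzc, tendsto_fst.eventually (ha.eventually_const_lt hcx)]
      with q hwq haq
    exact hwq.trans haq
  filter_upwards [hlt, hay] with m hm ham
  by_contra hyW
  exact (hm (y m) ⟨hyK m, hyW⟩).not_ge ham

theorem tendsto_value_of_tendsto {w : ℕ → E → ℝ} {g : E → ℝ} {x : E}
    (hlim : ∀ c, g x < c → ∀ᶠ q : ℕ × E in atTop ×ˢ 𝓝 x, w q.1 q.2 < c) {a : ℕ → ℝ}
    (ha : Tendsto a atTop (𝓝 (g x))) {y : ℕ → E} (hy : Tendsto y atTop (𝓝 x))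
    (hay : ∀ᶠ m in atTop, a m ≤ w m (y m)) : Tendsto (fun m => w m (y m)) atTop (𝓝 (g x)) := by
  refine tendsto_order.2 ⟨fun c hc => ?_, fun c hc => ?_⟩
  · filter_upwards [ha.eventually_const_lt hc, hay] with m hcm ham
    exact hcm.trans_le ham
  · exact (tendsto_id.prodMk hy).eventually (hlim c hc)

/-- The upper half-relaxed limit of a sequence of families of functions: the greatest limit value
of `v (z)` as `z → x` and `v ∈ 𝓕 n`, `n → ∞`. It is `0` where the families are not eventually
bounded above. -/
def relaxedLimit (𝓕 : ℕ → Set (E → ℝ)) (x : E) : ℝ :=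
  sInf {c | ∀ᶠ q : ℕ × E in atTop ×ˢ 𝓝 x, ∀ v ∈ 𝓕 q.1, v q.2 ≤ c}

variable {𝓕 : ℕ → Set (E → ℝ)} {x : E} {c : ℝ}

theorem nonneg_of_eventually_forall_le (hzero : ∀ n, 0 ∈ 𝓕 n)
    (hc : ∀ᶠ q : ℕ × E in atTop ×ˢ 𝓝 x, ∀ v ∈ 𝓕 q.1, v q.2 ≤ c) : 0 ≤ c :=
  let ⟨q, hq⟩ := hc.exists
  hq 0 (hzero q.1)

theorem relaxedLimit_nonneg (hzero : ∀ n, 0 ∈ 𝓕 n) (x : E) : 0 ≤ relaxedLimit 𝓕 x :=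
  Real.sInf_nonneg fun _ => nonneg_of_eventually_forall_le hzero

theorem relaxedLimit_le (hzero : ∀ n, 0 ∈ 𝓕 n)
    (hc : ∀ᶠ q : ℕ × E in atTop ×ˢ 𝓝 x, ∀ v ∈ 𝓕 q.1, v q.2 ≤ c) : relaxedLimit 𝓕 x ≤ c :=
  csInf_le ⟨0, fun _ => nonneg_of_eventually_forall_le hzero⟩ hc

theorem eventually_lt_of_relaxedLimit_lt {M : ℝ} (hM : ∀ n, ∀ v ∈ 𝓕 n, ∀ x, v x ≤ M)
    (hc : relaxedLimit 𝓕 x < c) :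
    ∀ᶠ q : ℕ × E in atTop ×ˢ 𝓝 x, ∀ v ∈ 𝓕 q.1, v q.2 < c := by
  have hne : {c | ∀ᶠ q : ℕ × E in atTop ×ˢ 𝓝 x, ∀ v ∈ 𝓕 q.1, v q.2 ≤ c}.Nonempty :=
    ⟨M, Eventually.of_forall (f := atTop ×ˢ 𝓝 x) fun (q : ℕ × E) v hv => hM q.1 v hv q.2⟩
  obtain ⟨c', hc', hlt⟩ := exists_lt_of_csInf_lt hne hc
  exact Eventually.mono hc' fun q hq v hv => (hq v hv).trans_lt hlt

theorem upperSemicontinuous_relaxedLimit (hzero : ∀ n, 0 ∈ 𝓕 n) {M : ℝ}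
    (hM : ∀ n, ∀ v ∈ 𝓕 n, ∀ x, v x ≤ M) : UpperSemicontinuous (relaxedLimit 𝓕) := by
  intro x c hc
  obtain ⟨c', hlt, hc'⟩ := exists_between (show relaxedLimit 𝓕 x < c from hc)
  obtain ⟨s, hs, t, ht, hst⟩ := mem_prod_iff.1 (eventually_lt_of_relaxedLimit_lt hM hlt)
  change ∀ᶠ y in 𝓝 x, relaxedLimit 𝓕 y < c
  filter_upwards [eventually_mem_nhds_iff.2 ht] with y hy
  refine (relaxedLimit_le hzero ?_).trans_lt hc'
  exact mem_of_superset (prod_mem_prod hs hy) fun q hq v hv => (hst hq v hv).le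

theorem exists_tendsto_relaxedLimit {E : Type*} [PseudoMetricSpace E] {𝓕 : ℕ → Set (E → ℝ)}
    (hanti : Antitone 𝓕) (hzero : ∀ n, 0 ∈ 𝓕 n) {M : ℝ} (hM : ∀ n, ∀ v ∈ 𝓕 n, ∀ x, v x ≤ M)
    (x : E) :
    ∃ (v : ℕ → E → ℝ) (z : ℕ → E), (∀ m, v m ∈ 𝓕 m) ∧ Tendsto z atTop (𝓝 x) ∧
      Tendsto (fun m => v m (z m)) atTop (𝓝 (relaxedLimit 𝓕 x)) := by
  set η : ℕ → ℝ := fun m => 1 / ((m : ℝ) + 1)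
  have hηpos : ∀ m, 0 < η m := fun m => by positivity
  have hη : Tendsto η atTop (𝓝 0) := tendsto_one_div_add_atTop_nhds_zero_nat
  have hex : ∀ m, ∃ v ∈ 𝓕 m, ∃ z ∈ Metric.ball x (η m), relaxedLimit 𝓕 x - η m < v z := by
    intro m
    by_contra! hcon
    have hle : relaxedLimit 𝓕 x ≤ relaxedLimit 𝓕 x - η m := relaxedLimit_le hzero <| by
      filter_upwards [prod_mem_prod (Ici_mem_atTop m) (Metric.ball_mem_nhds x (hηpos m))]
        with q hq v hv
      exact hcon v (hanti hq.1 hv) q.2 hq.2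
    linarith [hηpos m]
  choose v hv z hzball hvz using hex
  have hz : Tendsto z atTop (𝓝 x) := tendsto_iff_dist_tendsto_zero.2 <|
    squeeze_zero (fun _ => dist_nonneg) (fun m => (hzball m).le) hη
  have hlow : Tendsto (fun m => relaxedLimit 𝓕 x - η m) atTop (𝓝 (relaxedLimit 𝓕 x)) := by
    simpa only [sub_zero] using hη.const_sub (relaxedLimit 𝓕 x)
  refine ⟨v, z, hv, hz, tendsto_order.2 ⟨fun a ha => ?_, fun a ha => ?_⟩⟩
  · exact (hlow.eventually_const_lt ha).mono fun m hm => hm.trans (hvz m)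
  · exact ((tendsto_id.prodMk hz).eventually (eventually_lt_of_relaxedLimit_lt hM ha)).mono
      fun m hm => hm _ (hv m)

end RelaxedLimits

section LscEnvelope

variable {E : Type*} [TopologicalSpace E]

/-- The lower semicontinuous envelope of a function that is bounded below. -/
def lscEnvelope (u : E → ℝ) (x : E) : ℝ :=
  sSup {c | ∀ᶠ y in 𝓝 x, c ≤ u y}

theorem le_lscEnvelope (u : E → ℝ) {x : E} {c : ℝ} (hc : ∀ᶠ y in 𝓝 x, c ≤ u y) :
    c ≤ lscEnvelope u x :=
  le_csSup ⟨u x, fun _ h => h.self_of_nhds⟩ hc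

theorem lscEnvelope_le {u : E → ℝ} {m : ℝ} (hm : ∀ x, m ≤ u x) (x : E) : lscEnvelope u x ≤ u x :=
  csSup_le ⟨m, Eventually.of_forall hm⟩ fun _ h => h.self_of_nhds

theorem le_lscEnvelope_of_continuousAt {u b : E → ℝ} {x : E} (hb : ContinuousAt b x)
    (hle : ∀ᶠ y in 𝓝 x, b y ≤ u y) : b x ≤ lscEnvelope u x :=
  le_of_forall_lt fun c hc => by
    obtain ⟨c', hcc', hc'⟩ := exists_between hc
    refine hcc'.trans_le (le_lscEnvelope u ?_)
    filter_upwards [hle, hb.eventually_const_lt hc'] with y hby hcy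
    exact hcy.le.trans hby

theorem lowerSemicontinuous_lscEnvelope {u : E → ℝ} {m : ℝ} (hm : ∀ x, m ≤ u x) :
    LowerSemicontinuous (lscEnvelope u) := by
  intro x c hc
  obtain ⟨c', hc', hlt⟩ := exists_lt_of_lt_csSup (s := {c | ∀ᶠ y in 𝓝 x, c ≤ u y})
    ⟨m, Eventually.of_forall hm⟩ hc
  exact (eventually_eventually_nhds.2 hc').mono fun y hy => hlt.trans_le (le_lscEnvelope u hy)

end LscEnvelope

section RaiseOn

variable {E : Type*} {B C : Set E} {b u : E → ℝ} {y : E}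

open scoped Classical in
/-- The function `u` raised to `max u b` on the set `B`. -/
def raiseOn (B : Set E) (b u : E → ℝ) : E → ℝ :=
  fun y => if y ∈ B then max (u y) (b y) else u y

theorem raiseOn_of_mem (hy : y ∈ B) : raiseOn B b u y = max (u y) (b y) :=
  if_pos hy

theorem raiseOn_of_notMem (hy : y ∉ B) : raiseOn B b u y = u y :=
  if_neg hy

theorem raiseOn_of_notMem_of_le (hCB : ∀ z ∈ B \ C, b z ≤ u z) (hy : y ∉ C) :
    raiseOn B b u y = u y := by
  by_cases hyB : y ∈ B
  · rw [raiseOn_of_mem hyB, max_eq_left (hCB y ⟨hyB, hy⟩)]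
  · exact raiseOn_of_notMem hyB

theorem le_raiseOn (B : Set E) (b u : E → ℝ) (y : E) : u y ≤ raiseOn B b u y := by
  by_cases hyB : y ∈ B
  · exact (le_max_left _ _).trans_eq (raiseOn_of_mem hyB).symm
  · exact (raiseOn_of_notMem hyB).ge

theorem raiseOn_le {M : ℝ} (hu : u y ≤ M) (hb : y ∈ B → b y ≤ M) : raiseOn B b u y ≤ M := by
  by_cases hyB : y ∈ B
  · exact (raiseOn_of_mem hyB).trans_le (max_le hu (hb hyB))
  · exact (raiseOn_of_notMem hyB).trans_le hu

theorem upperSemicontinuous_raiseOn [TopologicalSpace E] (hB : IsOpen B) (hC : IsClosed C)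
    (hCB : C ⊆ B) (hle : ∀ z ∈ B \ C, b z ≤ u z) (hu : UpperSemicontinuous u)
    (hb : Continuous b) : UpperSemicontinuous (raiseOn B b u) := by
  intro y c (hc : raiseOn B b u y < c)
  change ∀ᶠ z in 𝓝 y, raiseOn B b u z < c
  by_cases hy : y ∈ C
  · rw [raiseOn_of_mem (hCB hy), max_lt_iff] at hc
    filter_upwards [hu y c hc.1, hb.continuousAt.eventually_lt_const hc.2,
      hB.mem_nhds (hCB hy)] with z huz hbz hzB
    exact (raiseOn_of_mem hzB).trans_lt (max_lt huz hbz)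
  · rw [raiseOn_of_notMem_of_le hle hy] at hc
    filter_upwards [hu y c hc, hC.isOpen_compl.mem_nhds hy] with z huz hzC
    exact (raiseOn_of_notMem_of_le hle hzC).trans_lt huz

theorem le_lscEnvelope_of_raiseOn_le [TopologicalSpace E] (hB : B ∈ 𝓝 y) (hb : ContinuousAt b y)
    (hle : ∀ z, raiseOn B b u z ≤ u z) : b y ≤ lscEnvelope u y := by
  refine le_lscEnvelope_of_continuousAt hb ?_
  filter_upwards [hB] with z hz
  exact ((le_max_right _ _).trans_eq (raiseOn_of_mem hz).symm).trans (hle z)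

end RaiseOn

section Stability

theorem continuous_testFun (x p : Eu N) (X : Mat N) (K : ℝ) : Continuous (testFun x p X K) :=
  (contDiff_testFun x p X K).continuous

theorem continuous_toEuclideanLin (X : Mat N) : Continuous X.toEuclideanLin :=
  LinearMap.continuous_of_finiteDimensional _

theorem hasJet_const_add_testFun (x y p : Eu N) {X : Mat N} (hX : X.IsSymm) (c : ℝ) :
    HasJet (fun z => c + testFun x p X 0 z) y (p + X.toEuclideanLin (y - x)) X := by
  refine ⟨hX, fun ε hε => Eventually.of_forall fun h => ?_⟩
  have hrem : c + testFun x p X 0 (y + h) - (c + testFun x p X 0 y)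
      - ⟪p + X.toEuclideanLin (y - x), h⟫ - qf X h / 2 = 0 := by
    simp only [testFun, add_sub_right_comm y h x, qf_add_right hX, inner_add_left,
      inner_add_right]
    ring
  change |c + testFun x p X 0 (y + h) - (c + testFun x p X 0 y)
      - ⟪p + X.toEuclideanLin (y - x), h⟫ - qf X h / 2| ≤ _
  rw [hrem, abs_zero]
  positivity

theorem SuperJet.exists_sub_testFun_le {u : Eu N → ℝ} {x p : Eu N} {X : Mat N}
    (hj : SuperJet u x p X) {η : ℝ} (hη : 0 < η) :
    ∃ r > 0, ∀ y ∈ Metric.closedBall x r,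
      u y - testFun x p (X + η • 1) 0 y ≤ u x - η / 4 * ‖y - x‖ ^ 2 := by
  obtain ⟨r, hr, hball⟩ := Metric.eventually_nhds_iff_ball.1 (hj.2 (η / 4) (by positivity))
  refine ⟨r / 2, half_pos hr, fun y hy => ?_⟩
  rw [mem_closedBall_iff_norm] at hy
  have hjet := hball (y - x) (by rw [mem_ball_zero_iff]; linarith)
  rw [add_sub_cancel] at hjet
  simp only [testFun, qf_add, qf_smul, qf_one]
  linarith

/-- `F[v] ≤ ε` in the viscosity sense where `v > 0`. -/
def IsPositivePartSubsolution (F : Operator N) (ε : ℝ) (v : Eu N → ℝ) : Prop :=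
  ∀ x, 0 < v x → ∀ p X, SuperJet v x p X → F x (v x) p X ≤ ε

variable {F : Operator N} {O : Set (Eu N)} {v : ℕ → Eu N → ℝ} {ε : ℕ → ℝ} {ε₀ : ℝ}
  {u : Eu N → ℝ} {x p : Eu N} {X : Mat N}

theorem le_of_tendsto_isMaxOn (hO : IsOpen O) (hF : IsContinuousOperator F O)
    (hsub : ∀ m, IsPositivePartSubsolution F (ε m) (v m)) (hε : Tendsto ε atTop (𝓝 ε₀))
    (hxO : x ∈ O) (hX : X.IsSymm) {a r : ℝ} (ha : 0 < a) (hr : 0 < r) {y : ℕ → Eu N}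
    (hmax : ∀ m, IsMaxOn (fun z => v m z - testFun x p X 0 z) (Metric.closedBall x r) (y m))
    (hy : Tendsto y atTop (𝓝 x)) (hvy : Tendsto (fun m => v m (y m)) atTop (𝓝 a)) :
    F x a p X ≤ ε₀ := by
  have hps : Tendsto (fun m => p + X.toEuclideanLin (y m - x)) atTop (𝓝 p) := by
    have hcont : Continuous fun w => p + X.toEuclideanLin (w - x) :=
      continuous_const.add
        ((continuous_toEuclideanLin X).comp (continuous_id.sub continuous_const))
    exact (hcont.tendsto' x p (by simp)).comp hy
  refine le_of_tendsto_of_tendsto (hF.tendsto hy hvy hps tendsto_const_nhds hxO hX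
    (hy.eventually (hO.mem_nhds hxO)) (Eventually.of_forall fun _ => hX)) hε ?_
  filter_upwards [hy.eventually (Metric.ball_mem_nhds x hr), hvy.eventually_const_lt ha]
    with m hyr hpos
  refine hsub m (y m) hpos _ _ (SuperJet.of_touch (hasJet_const_add_testFun x (y m) p hX 0) ?_)
  filter_upwards [Metric.isOpen_ball.mem_nhds hyr] with z hz
  have hzmax : v m z - testFun x p X 0 z ≤ v m (y m) - testFun x p X 0 (y m) :=
    hmax m (Metric.ball_subset_closedBall hz)
  simpa only [zero_add] using hzmax

theorem le_add_smul_one_of_superJet_of_limit (hO : IsOpen O) (hF : IsContinuousOperator F O)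
    (hv : ∀ m, UpperSemicontinuous (v m)) (hsub : ∀ m, IsPositivePartSubsolution F (ε m) (v m))
    (hε : Tendsto ε atTop (𝓝 ε₀))
    (hlim : ∀ y c, u y < c → ∀ᶠ q : ℕ × Eu N in atTop ×ˢ 𝓝 y, v q.1 q.2 < c)
    (hxO : x ∈ O) {z : ℕ → Eu N} (hz : Tendsto z atTop (𝓝 x))
    (hvz : Tendsto (fun m => v m (z m)) atTop (𝓝 (u x))) (hux : 0 < u x)
    (hj : SuperJet u x p X) {η : ℝ} (hη : 0 < η) : F x (u x) p (X + η • 1) ≤ ε₀ := by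
  have hX : (X + η • (1 : Mat N)).IsSymm := hj.1.add (Matrix.isSymm_one.smul _)
  obtain ⟨r, hr, hstrict⟩ := hj.exists_sub_testFun_le hη
  set Q := testFun x p (X + η • 1) 0
  have hQ : Continuous Q := continuous_testFun _ _ _ _
  have hQx : Q x = 0 := testFun_self _ _ _ _
  choose y hyball hymax using fun m =>
    ((upperSemicontinuous_sub_continuous (hv m) hQ).upperSemicontinuousOn _).exists_isMaxOn
      ⟨x, Metric.mem_closedBall_self hr.le⟩ (isCompact_closedBall x r)
  have hbase : Tendsto (fun m => v m (z m) - Q (z m)) atTop (𝓝 (u x - Q x)) :=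
    hvz.sub ((hQ.tendsto x).comp hz)
  have hzy : ∀ᶠ m in atTop, v m (z m) - Q (z m) ≤ v m (y m) - Q (y m) :=
    (hz.eventually (Metric.closedBall_mem_nhds x hr)).mono fun m hm => hymax m hm
  have hlimQ : ∀ y c, u y - Q y < c →
      ∀ᶠ q : ℕ × Eu N in atTop ×ˢ 𝓝 y, v q.1 q.2 - Q q.2 < c := fun y c hc =>
    eventually_sub_lt_of_continuousAt (v := fun q => v q.1 q.2) (hlim y) hQ.continuousAt hc
  have hyx : Tendsto y atTop (𝓝 x) := by
    refine tendsto_of_strictMax (isCompact_closedBall x r) (w := fun m z => v m z - Q z)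
      (g := fun z => u z - Q z) (fun y _ => hlimQ y) (fun y hy hne => ?_) hbase hyball hzy
    have : 0 < ‖y - x‖ := norm_pos_iff.2 (sub_ne_zero.2 hne)
    have : 0 < η / 4 * ‖y - x‖ ^ 2 := by positivity
    linarith [hstrict y hy]
  have hvy : Tendsto (fun m => v m (y m)) atTop (𝓝 (u x)) := by
    have hsum := (tendsto_value_of_tendsto (w := fun m z => v m z - Q z) (g := fun z => u z - Q z)
      (hlimQ x) hbase hyx hzy).add ((hQ.tendsto x).comp hyx)
    simpa only [Function.comp_apply, sub_add_cancel] using hsum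
  exact le_of_tendsto_isMaxOn hO hF hsub hε hxO hX hux hr hymax hyx hvy

theorem le_of_superJet_of_limit (hO : IsOpen O) (hF : IsContinuousOperator F O)
    (hv : ∀ m, UpperSemicontinuous (v m)) (hsub : ∀ m, IsPositivePartSubsolution F (ε m) (v m))
    (hε : Tendsto ε atTop (𝓝 ε₀))
    (hlim : ∀ y c, u y < c → ∀ᶠ q : ℕ × Eu N in atTop ×ˢ 𝓝 y, v q.1 q.2 < c)
    (hxO : x ∈ O) {z : ℕ → Eu N} (hz : Tendsto z atTop (𝓝 x))
    (hvz : Tendsto (fun m => v m (z m)) atTop (𝓝 (u x))) (hux : 0 < u x)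
    (hj : SuperJet u x p X) : F x (u x) p X ≤ ε₀ :=
  le_of_tendsto ((hF.tendsto_add_smul_one hxO _ p hj.1).mono_left nhdsWithin_le_nhds)
    (eventually_nhdsWithin_of_forall fun _ hη =>
      le_add_smul_one_of_superJet_of_limit hO hF hv hsub hε hlim hxO hz hvz hux hj
        (Set.mem_Ioi.1 hη))

end Stability

section Perron

/-- The competitors in Perron's method: upper semicontinuous functions with values in `[0, 1]`
that vanish outside `K` and satisfy `F[v] ≤ ε` where they are positive. -/
structure IsUnitSubsolution (F : Operator N) (K : Set (Eu N)) (ε : ℝ) (v : Eu N → ℝ) : Prop where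
  upperSemicontinuous : UpperSemicontinuous v
  nonneg : ∀ x, 0 ≤ v x
  le_one : ∀ x, v x ≤ 1
  eq_zero : ∀ x ∉ K, v x = 0
  isPositivePartSubsolution : IsPositivePartSubsolution F ε v

variable {F : Operator N} {O K : Set (Eu N)} {ε : ℝ} {u : Eu N → ℝ}

theorem isUnitSubsolution_zero (F : Operator N) (K : Set (Eu N)) (ε : ℝ) :
    IsUnitSubsolution F K ε 0 where
  upperSemicontinuous := upperSemicontinuous_const
  nonneg _ := le_rfl
  le_one _ := zero_le_one
  eq_zero _ _ := rfl
  isPositivePartSubsolution _ hx := absurd hx (lt_irrefl _)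

theorem IsUnitSubsolution.mono {K' : Set (Eu N)} {ε' : ℝ} {v : Eu N → ℝ}
    (hv : IsUnitSubsolution F K ε v) (hK : K ⊆ K') (hε : ε ≤ ε') : IsUnitSubsolution F K' ε' v where
  upperSemicontinuous := hv.upperSemicontinuous
  nonneg := hv.nonneg
  le_one := hv.le_one
  eq_zero x hx := hv.eq_zero x fun h => hx (hK h)
  isPositivePartSubsolution x hx p X hj := (hv.isPositivePartSubsolution x hx p X hj).trans hε

theorem isUnitSubsolution_relaxedLimit (hO : IsOpen O) (hF : IsContinuousOperator F O)
    {K : ℕ → Set (Eu N)} {ε : ℕ → ℝ} {ε₀ : ℝ} (hK : Antitone K) (hε : Antitone ε)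
    (hKcl : ∀ n, IsClosed (K n)) (hKO : K 0 ⊆ O) (hlim : Tendsto ε atTop (𝓝 ε₀)) :
    IsUnitSubsolution F (⋂ n, K n) ε₀
      (relaxedLimit fun n => {v | IsUnitSubsolution F (K n) (ε n) v}) := by
  set 𝓕 := fun n => {v | IsUnitSubsolution F (K n) (ε n) v}
  have hanti : Antitone 𝓕 := fun m n hmn _ hv => hv.mono (hK hmn) (hε hmn)
  have hzero : ∀ n, 0 ∈ 𝓕 n := fun n => isUnitSubsolution_zero _ _ _
  have hone : ∀ n, ∀ v ∈ 𝓕 n, ∀ x, v x ≤ 1 := fun n v hv => hv.le_one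
  have hoff : ∀ x ∉ ⋂ n, K n, relaxedLimit 𝓕 x = 0 := fun x hx => by
    obtain ⟨n, hn⟩ := not_forall.1 (mt Set.mem_iInter.2 hx)
    refine le_antisymm (relaxedLimit_le hzero ?_) (relaxedLimit_nonneg hzero x)
    filter_upwards [prod_mem_prod (Ici_mem_atTop n) ((hKcl n).isOpen_compl.mem_nhds hn)]
      with q hq v hv
    exact (hv.eq_zero q.2 fun h => hq.2 (hK hq.1 h)).le
  refine ⟨upperSemicontinuous_relaxedLimit hzero hone, relaxedLimit_nonneg hzero,
    fun x => relaxedLimit_le hzero (Eventually.of_forall fun q v hv => hone _ v hv _), hoff,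
    fun x hx p X hj => ?_⟩
  have hxO : x ∈ O := by
    by_contra hxO
    exact hx.ne' (hoff x fun h => hxO (hKO (Set.mem_iInter.1 h 0)))
  obtain ⟨v, z, hv, hz, hvz⟩ := exists_tendsto_relaxedLimit hanti hzero hone x
  refine le_of_superJet_of_limit hO hF (fun m => (hv m).upperSemicontinuous)
    (fun m => (hv m).isPositivePartSubsolution) hlim (fun y c hc => ?_) hxO hz hvz hx hj
  exact (eventually_lt_of_relaxedLimit_lt hone hc).mono fun q hq => hq _ (hv q.1)

theorem exists_greatest_isUnitSubsolution (hO : IsOpen O) (hF : IsContinuousOperator F O)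
    (hK : IsClosed K) (hKO : K ⊆ O) (ε : ℝ) :
    ∃ u, IsUnitSubsolution F K ε u ∧ ∀ v, IsUnitSubsolution F K ε v → ∀ x, v x ≤ u x := by
  have hsub := isUnitSubsolution_relaxedLimit hO hF (K := fun _ => K) (ε := fun _ => ε)
    antitone_const antitone_const (fun _ => hK) hKO tendsto_const_nhds
  rw [Set.iInter_const] at hsub
  refine ⟨_, hsub, fun v hv x => le_of_forall_gt fun c hc => ?_⟩
  have hlt := eventually_lt_of_relaxedLimit_lt (fun _ w hw => hw.le_one) hc
  obtain ⟨_, hm⟩ := (hlt.curry.mono fun _ h => h.self_of_nhds).exists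
  exact hm v hv

theorem IsDegenerateElliptic.le_of_qf_le (h : IsDegenerateElliptic F O) {x : Eu N} (hx : x ∈ O)
    (r : ℝ) (p : Eu N) {X Y : Mat N} (hX : X.IsSymm) (hY : Y.IsSymm)
    (hle : ∀ v, qf X v ≤ qf Y v) : F x r p Y ≤ F x r p X := by
  have hdiff := h x hx r p X (Y - X) hX (hY.sub hX)
    (posSemidef_of_qf_nonneg (hY.sub hX) fun v => by rw [qf_sub]; linarith [hle v])
  rwa [add_sub_cancel, sub_nonpos] at hdiff

theorem IsUnitSubsolution.raise (h_ell : IsDegenerateElliptic F O) (hKO : K ⊆ O)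
    (hu : IsUnitSubsolution F K ε u) {B C : Set (Eu N)} {b : Eu N → ℝ} (hB : IsOpen B)
    (hC : IsClosed C) (hCB : C ⊆ B) (hBK : B ⊆ K) (hb : Continuous b)
    (hjet : ∀ y ∈ B, ∃ p Y, HasJet b y p Y ∧ F y (b y) p Y ≤ ε) (hb_one : ∀ y ∈ B, b y ≤ 1)
    (hbu : ∀ y ∈ B \ C, b y ≤ u y) : IsUnitSubsolution F K ε (raiseOn B b u) where
  upperSemicontinuous :=
    upperSemicontinuous_raiseOn hB hC hCB hbu hu.upperSemicontinuous hb
  nonneg y := (hu.nonneg y).trans (le_raiseOn B b u y)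
  le_one y := raiseOn_le (hu.le_one y) (hb_one y)
  eq_zero y hy := (raiseOn_of_notMem fun hyB => hy (hBK hyB)).trans (hu.eq_zero y hy)
  isPositivePartSubsolution y hy q Z hj := by
    by_cases hyu : raiseOn B b u y = u y
    · rw [hyu] at hy ⊢
      exact hu.isPositivePartSubsolution y hy q Z
        (hj.mono (Eventually.of_forall (le_raiseOn B b u)) hyu.symm)
    · have hyB : y ∈ B := by
        by_contra hyB
        exact hyu (raiseOn_of_notMem hyB)
      rw [raiseOn_of_mem hyB] at hyu
      have hyb : raiseOn B b u y = b y :=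
        (raiseOn_of_mem hyB).trans ((max_choice _ _).resolve_left hyu)
      obtain ⟨p, Y, hbjet, hFY⟩ := hjet y hyB
      have hle : ∀ᶠ z in 𝓝 y, b z ≤ raiseOn B b u z := by
        filter_upwards [hB.mem_nhds hyB] with z hz
        exact (le_max_right _ _).trans_eq (raiseOn_of_mem hz).symm
      obtain ⟨rfl, hqf⟩ := hj.eq_and_qf_le hbjet hle hyb.symm
      rw [hyb]
      exact (h_ell.le_of_qf_le (hKO (hBK hyB)) _ _ hbjet.1 hj.1 hqf).trans hFY

theorem HasJet.eventually_add_testFun_le {φ ψ : Eu N → ℝ} {x p : Eu N} {X : Mat N}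
    (hψ : HasJet ψ x p X) (hmin : IsLocalMin (fun y => φ y - ψ y) x) {γ : ℝ} (hγ : 0 < γ) :
    ∀ᶠ y in 𝓝 x, φ x + testFun x p (X + (-γ) • 1) 0 y + γ / 4 * ‖y - x‖ ^ 2 ≤ φ y := by
  have hsub : Tendsto (fun y : Eu N => y - x) (𝓝 x) (𝓝 0) :=
    Continuous.tendsto' (by fun_prop) _ _ (sub_self x)
  filter_upwards [hsub.eventually (hψ.eventually_abs_le (by positivity : 0 < γ / 4)), hmin]
    with y hjet hxy
  rw [add_sub_cancel] at hjet
  simp only [testFun, qf_add, qf_smul, qf_one]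
  linarith [(abs_le.1 hjet).1]

theorem IsContinuousOperator.exists_sub_smul_one_lt (hF : IsContinuousOperator F O) {x : Eu N}
    (hx : x ∈ O) {r : ℝ} {p : Eu N} {X : Mat N} (hX : X.IsSymm) (hlt : F x r p X < ε) :
    ∃ γ : ℝ, 0 < γ ∧ F x r p (X + (-γ) • 1) < ε := by
  have hneg : Tendsto (fun γ : ℝ => -γ) (𝓝[>] 0) (𝓝 0) :=
    (continuous_neg.tendsto' 0 0 neg_zero).mono_left nhdsWithin_le_nhds
  obtain ⟨γ, hγF, hγ⟩ := ((((hF.tendsto_add_smul_one hx r p hX).comp hneg).eventually_lt_const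
    hlt).and self_mem_nhdsWithin).exists
  exact ⟨γ, hγ, hγF⟩

theorem IsContinuousOperator.exists_ball_testFun_lt (hF : IsContinuousOperator F O)
    (hO : IsOpen O) {x : Eu N} (hx : x ∈ O) {a : ℝ} {p : Eu N} {Y : Mat N} (hY : Y.IsSymm)
    (hlt : F x a p Y < ε) :
    ∃ ρ > 0, ∀ y ∈ Metric.ball x ρ, ∀ δ ∈ Metric.ball (0 : ℝ) ρ,
      F y (a + δ + testFun x p Y 0 y) (p + Y.toEuclideanLin (y - x)) Y < ε := by
  have hfst : Tendsto (fun q : Eu N × ℝ => q.1) (𝓝 (x, 0)) (𝓝 x) := continuous_fst.tendsto _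
  have hvalue : Tendsto (fun q : Eu N × ℝ => a + q.2 + testFun x p Y 0 q.1) (𝓝 (x, 0)) (𝓝 a) := by
    have := continuous_testFun x p Y 0
    exact Continuous.tendsto' (by fun_prop) _ _ (by simp [testFun_self])
  have hgrad : Tendsto (fun q : Eu N × ℝ => p + Y.toEuclideanLin (q.1 - x)) (𝓝 (x, 0)) (𝓝 p) := by
    have := continuous_toEuclideanLin Y
    exact Continuous.tendsto' (by fun_prop) _ _ (by simp)
  have hnear := (hF.tendsto hfst hvalue hgrad tendsto_const_nhds hx hY
    (hfst.eventually (hO.mem_nhds hx)) (Eventually.of_forall fun _ => hY)).eventually_lt_const hlt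
  obtain ⟨ρ, hρ, hball⟩ := Metric.eventually_nhds_iff_ball.1 hnear
  rw [← ball_prod_same] at hball
  exact ⟨ρ, hρ, fun y hy δ hδ => hball (y, δ) ⟨hy, hδ⟩⟩

/-- Otherwise `u` could be raised near `x` to a larger competitor. -/
theorem IsUnitSubsolution.le_of_touch_lscEnvelope (hF : IsContinuousOperator F O)
    (h_ell : IsDegenerateElliptic F O) (hO : IsOpen O) (hKO : K ⊆ O)
    (hu : IsUnitSubsolution F K ε u) (hmax : ∀ v, IsUnitSubsolution F K ε v → ∀ x, v x ≤ u x)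
    {x p : Eu N} {Y : Mat N} (hx : x ∈ interior K) (hux : lscEnvelope u x < 1) (hY : Y.IsSymm)
    {κ : ℝ} (hκ : 0 < κ) (htouch : ∀ᶠ y in 𝓝 x,
      lscEnvelope u x + testFun x p Y 0 y + κ * ‖y - x‖ ^ 2 ≤ lscEnvelope u y) :
    ε ≤ F x (lscEnvelope u x) p Y := by
  by_contra! hlt
  set φ := lscEnvelope u
  set Q := testFun x p Y 0
  have hQ : Continuous Q := continuous_testFun _ _ _ _
  have hQx : Q x = 0 := testFun_self _ _ _ _
  obtain ⟨ρ, hρ, hFball⟩ := hF.exists_ball_testFun_lt hO (hKO (interior_subset hx)) hY hlt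
  have hQsmall : ∀ᶠ y in 𝓝 x, Q y < (1 - φ x) / 2 :=
    hQ.continuousAt.eventually_lt_const (by linarith)
  have hKx : ∀ᶠ y in 𝓝 x, y ∈ interior K := isOpen_interior.mem_nhds hx
  have hρx : ∀ᶠ y in 𝓝 x, y ∈ Metric.ball x ρ := Metric.ball_mem_nhds x hρ
  obtain ⟨r, hr, hball⟩ := Metric.eventually_nhds_iff_ball.1
    ((htouch.and hQsmall).and (hKx.and hρx))
  set δ := min (ρ / 2) (min ((1 - φ x) / 2) (κ * (r / 2) ^ 2))
  have hδ : 0 < δ := lt_min (half_pos hρ) (lt_min (by linarith) (by positivity))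
  have hδρ : δ < ρ := (min_le_left _ _).trans_lt (half_lt_self hρ)
  have hδone : δ ≤ (1 - φ x) / 2 := (min_le_right _ _).trans (min_le_left _ _)
  have hδr : δ ≤ κ * (r / 2) ^ 2 := (min_le_right _ _).trans (min_le_right _ _)
  have hraise : IsUnitSubsolution F K ε
      (raiseOn (Metric.ball x r) (fun y => φ x + δ + Q y) u) := by
    refine hu.raise (b := fun y => φ x + δ + Q y) h_ell hKO Metric.isOpen_ball
      (Metric.isClosed_closedBall (x := x) (ε := r / 2))
      (Metric.closedBall_subset_ball (half_lt_self hr))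
      (fun y hy => interior_subset (hball y hy).2.1) (continuous_const.add hQ)
      (fun y hy => ⟨_, Y, hasJet_const_add_testFun x y p hY _,
        (hFball y (hball y hy).2.2 δ (by rwa [mem_ball_zero_iff, Real.norm_of_nonneg hδ.le])).le⟩)
      (fun y hy => by linarith [(hball y hy).1.2]) fun y hy => ?_
    have hfar : r / 2 ≤ ‖y - x‖ := (not_le.1 (mt mem_closedBall_iff_norm.2 hy.2)).le
    have hsq : κ * (r / 2) ^ 2 ≤ κ * ‖y - x‖ ^ 2 := by gcongr
    linarith [(hball y hy.1).1.1, lscEnvelope_le hu.nonneg y]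
  have hle : φ x + δ + Q x ≤ φ x := le_lscEnvelope_of_raiseOn_le (Metric.ball_mem_nhds x hr)
    (continuous_const.add hQ).continuousAt (hmax _ hraise)
  linarith

theorem IsUnitSubsolution.isViscositySupersolution_lscEnvelope (hF : IsContinuousOperator F O)
    (h_ell : IsDegenerateElliptic F O) (hO : IsOpen O) (hKO : K ⊆ O)
    (hu : IsUnitSubsolution F K ε u) (hmax : ∀ v, IsUnitSubsolution F K ε v → ∀ x, v x ≤ u x)
    (hlt : ∀ x, u x < 1) :
    IsViscositySupersolution (fun x r p X => F x r p X - ε) (interior K) (lscEnvelope u) := by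
  intro x hx ψ hψ hmin
  have hjet := hasJet_of_contDiffAt hψ
  by_contra! hneg
  obtain ⟨γ, hγ, hFγ⟩ := hF.exists_sub_smul_one_lt (hKO (interior_subset hx)) hjet.1
    (sub_neg.1 hneg)
  exact hFγ.not_ge <| hu.le_of_touch_lscEnvelope hF h_ell hO hKO hmax hx
    ((lscEnvelope_le hu.nonneg x).trans_lt (hlt x)) (hjet.1.add (Matrix.isSymm_one.smul _))
    (by positivity)
    (hjet.eventually_add_testFun_le (hmin.isLocalMin (isOpen_interior.mem_nhds hx)) hγ)

end Perron

/-! ### The maximum principle and the two eigenvalues -/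

section Existence

variable {F : Operator N} {O Ω U K : Set (Eu N)} {ε : ℝ} {u φ : Eu N → ℝ}

theorem IsHomogeneous.apply_zero {α : ℝ} (h : IsHomogeneous F O α) (hα : 0 < α) {x : Eu N}
    (hx : x ∈ O) : F x 0 0 0 = 0 := by
  simpa only [Real.zero_rpow hα.ne', zero_mul, zero_smul] using
    h x hx 0 0 0 Matrix.isSymm_zero 0 le_rfl

theorem hasJet_const (c : ℝ) (x : Eu N) : HasJet (fun _ => c) x 0 0 := by
  refine ⟨Matrix.isSymm_zero, fun ε hε => Eventually.of_forall fun h => ?_⟩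
  simp only [sub_self, map_zero, LinearMap.zero_apply, inner_zero_left, zero_div, abs_zero]
  positivity

theorem IsUnitSubsolution.isDirichletSubsolution (h_ell : IsDegenerateElliptic F O)
    (h_zero : ∀ x ∈ O, F x 0 0 0 = 0) (hΩo : IsOpen Ω) (hΩO : closure Ω ⊆ O)
    (hu : IsUnitSubsolution F (closure Ω) 0 u) : IsDirichletSubsolution F Ω u := by
  intro ψ hψ ξ hξ hmax
  have hmaxξ : ∀ y ∈ closure Ω, u y - ψ y ≤ u ξ - ψ ξ := fun y hy => hmax hy
  have hjet := hasJet_of_contDiffAt (hψ.contDiffAt (x := ξ))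
  rcases (hu.nonneg ξ).lt_or_eq with hpos | hzero
  · have hF : F ξ (u ξ) (gradient ψ ξ) (hess ψ ξ) ≤ 0 := by
      refine hu.isPositivePartSubsolution ξ hpos _ _ (SuperJet.of_touch hjet ?_)
      filter_upwards [hψ.continuous.continuousAt.eventually_const_lt (sub_lt_self (ψ ξ) hpos)]
        with y hy
      by_cases hyΩ : y ∈ closure Ω
      · exact hmaxξ y hyΩ
      · linarith [hu.eq_zero y hyΩ]
    exact ⟨fun _ => hF, fun _ => (min_le_right _ _).trans hF⟩
  · refine ⟨fun hξΩ => ?_, fun _ => (min_le_left _ _).trans hzero.ge⟩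
    have hzeroJet : SuperJet (fun _ => 0) ξ (gradient ψ ξ) (hess ψ ξ) := by
      refine SuperJet.of_touch hjet ?_
      filter_upwards [hΩo.mem_nhds hξΩ] with y hy
      linarith [hmaxξ y (subset_closure hy), hu.nonneg y]
    obtain ⟨hgrad, hhess⟩ := hzeroJet.eq_and_qf_le (hasJet_const 0 ξ)
      (Eventually.of_forall fun _ => le_rfl) rfl
    rw [← hzero, ← hgrad]
    exact (h_ell.le_of_qf_le (hΩO hξ) 0 0 Matrix.isSymm_zero hjet.1 hhess).trans_eq
      (h_zero ξ (hΩO hξ))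

theorem IsUnitSubsolution.lt_one_of_maximumPrinciple (h_ell : IsDegenerateElliptic F O)
    (h_zero : ∀ x ∈ O, F x 0 0 0 = 0) (hΩo : IsOpen Ω) (hΩO : closure Ω ⊆ O)
    (hMP : MaximumPrinciple F Ω) (hu : IsUnitSubsolution F (closure Ω) 0 u) (x : Eu N) :
    u x < 1 := by
  refine lt_of_le_of_lt ?_ one_pos
  by_cases hx : x ∈ closure Ω
  · exact hMP u (hu.upperSemicontinuous.upperSemicontinuousOn _)
      (hu.isDirichletSubsolution h_ell h_zero hΩo hΩO) x hx
  · exact (hu.eq_zero x hx).le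

theorem exists_forall_isUnitSubsolution_lt_one (hO : IsOpen O) (hF : IsContinuousOperator F O)
    {K : ℕ → Set (Eu N)} {ε : ℕ → ℝ} {ε₀ : ℝ} (hK : Antitone K) (hε : Antitone ε)
    (hKcl : ∀ n, IsClosed (K n)) (hK0 : IsCompact (K 0)) (hKO : K 0 ⊆ O)
    (hlim : Tendsto ε atTop (𝓝 ε₀))
    (hlt : ∀ v, IsUnitSubsolution F (⋂ n, K n) ε₀ v → ∀ x, v x < 1) :
    ∃ m, ∀ v, IsUnitSubsolution F (K m) (ε m) v → ∀ x, v x < 1 := by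
  have hlimit := hlt _ (isUnitSubsolution_relaxedLimit hO hF hK hε hKcl hKO hlim)
  obtain ⟨m, hm⟩ := (eventually_forall_mem_of_isCompact
    (P := fun n y => ∀ v, IsUnitSubsolution F (K n) (ε n) v → v y < 1) hK0 fun y _ =>
      eventually_lt_of_relaxedLimit_lt (fun _ _ hv => hv.le_one) (hlimit y)).exists
  refine ⟨m, fun v hv x => ?_⟩
  by_cases hx : x ∈ K 0
  · exact hm x hx v hv
  · exact (hv.eq_zero x fun hxm => hx (hK (Nat.zero_le m) hxm)).trans_lt one_pos

theorem IsViscositySupersolution.pos (h_zero : ∀ x ∈ U, F x 0 0 0 = 0) (hε : 0 < ε)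
    (hφ : ∀ x, 0 ≤ φ x) (hsuper : IsViscositySupersolution (fun x r p X => F x r p X - ε) U φ)
    {x : Eu N} (hx : x ∈ U) : 0 < φ x := by
  refine (hφ x).lt_of_ne fun hφx => ?_
  have hmin : IsLocalMinOn (fun y => φ y - 0) U x := Eventually.of_forall fun y => by
    simpa only [sub_zero, ← hφx] using hφ y
  have hFx := hsuper x hx (fun _ => 0) contDiffAt_const hmin
  obtain ⟨hgrad, hhess⟩ := (hasJet_const 0 x).gradient_hess_eq contDiffAt_const
  rw [hgrad, hhess, ← hφx] at hFx
  linarith [h_zero x hx]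

theorem exists_supersolution_interior (hO : IsOpen O) (hF : IsContinuousOperator F O)
    (h_ell : IsDegenerateElliptic F O) (h_zero : ∀ x ∈ O, F x 0 0 0 = 0) (hK : IsClosed K)
    (hKO : K ⊆ O) (hε : 0 < ε) (hlt : ∀ v, IsUnitSubsolution F K ε v → ∀ x, v x < 1) :
    ∃ φ : Eu N → ℝ, LowerSemicontinuous φ ∧ (∀ x ∈ interior K, 0 < φ x) ∧ (∀ x, φ x ≤ 1) ∧
      IsViscositySupersolution (fun x r p X => F x r p X - ε) (interior K) φ := by
  obtain ⟨v, hv, hvmax⟩ := exists_greatest_isUnitSubsolution hO hF hK hKO ε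
  have hsuper := hv.isViscositySupersolution_lscEnvelope hF h_ell hO hKO hvmax (hlt v hv)
  have hnonneg : ∀ x, 0 ≤ lscEnvelope v x := fun x =>
    le_lscEnvelope v (Eventually.of_forall hv.nonneg)
  exact ⟨lscEnvelope v, lowerSemicontinuous_lscEnvelope hv.nonneg,
    fun x hx => hsuper.pos (fun y hy => h_zero y (hKO (interior_subset hy))) hε hnonneg hx,
    fun x => (lscEnvelope_le hv.nonneg x).trans (hv.le_one x), hsuper⟩

theorem exists_supersolution_of_maximumPrinciple (hΩo : IsOpen Ω) (hΩ : Bornology.IsBounded Ω)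
    (hO : IsOpen O) (hΩO : closure Ω ⊆ O) (hF : IsContinuousOperator F O)
    (h_ell : IsDegenerateElliptic F O) (h_zero : ∀ x ∈ O, F x 0 0 0 = 0)
    (hMP : MaximumPrinciple F Ω) :
    ∃ ε : ℝ, 0 < ε ∧ ∃ Ω', IsOpen Ω' ∧ closure Ω ⊆ Ω' ∧ Ω' ⊆ O ∧ ∃ φ : Eu N → ℝ,
      LowerSemicontinuous φ ∧ (∀ x ∈ Ω', 0 < φ x) ∧ (∀ x, φ x ≤ 1) ∧
      IsViscositySupersolution (fun x r p X => F x r p X - ε) Ω' φ := by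
  obtain ⟨r, hr, hrO⟩ := hΩ.isCompact_closure.exists_cthickening_subset_open hO hΩO
  obtain ⟨ε, hεanti, hεmem, hεlim⟩ := exists_seq_strictAnti_tendsto' hr
  set K := fun n => Metric.cthickening (ε n) (closure Ω)
  have hK : Antitone K := fun m n hmn => Metric.cthickening_mono (hεanti.antitone hmn) _
  have hKO : ∀ n, K n ⊆ O := fun n => (Metric.cthickening_mono (hεmem n).2.le _).trans hrO
  have hKcl : ∀ n, IsClosed (K n) := fun n => Metric.isClosed_cthickening
  have hKinter : ⋂ n, K n = closure Ω := by
    have hsmall : ∀ δ : ℝ, 0 < δ → (Set.range ε ∩ Set.Ioc 0 δ).Nonempty := fun δ hδ =>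
      have ⟨n, hn⟩ := (hεlim.eventually_lt_const hδ).exists
      ⟨ε n, ⟨n, rfl⟩, (hεmem n).1, hn.le⟩
    rw [← closure_closure (s := Ω), Metric.closure_eq_iInter_cthickening' _ _ hsmall,
      Set.biInter_range]
  obtain ⟨m, hm⟩ := exists_forall_isUnitSubsolution_lt_one hO hF hK hεanti.antitone hKcl
    hΩ.isCompact_closure.cthickening (hKO 0) hεlim fun v hv =>
      (hKinter ▸ hv).lt_one_of_maximumPrinciple h_ell h_zero hΩo hΩO hMP
  have hΩK : closure Ω ⊆ interior (K m) :=
    (Metric.self_subset_thickening (hεmem m).1 _).trans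
      (interior_maximal (Metric.thickening_subset_cthickening _ _) Metric.isOpen_thickening)
  exact ⟨ε m, (hεmem m).1, interior (K m), isOpen_interior, hΩK, interior_subset.trans (hKO m),
    exists_supersolution_interior hO hF h_ell h_zero (hKcl m) (hKO m) (hεmem m).1 hm⟩

end Existence

section AbsShifted

variable {F G G' : Operator N} {O Ω U U' V A : Set (Eu N)} {α l m : ℝ} {φ : Eu N → ℝ} {ξ : Eu N}

theorem IsViscositySupersolution.mono (h : IsViscositySupersolution G U φ) (hU' : IsOpen U')
    (hU : U' ⊆ U) : IsViscositySupersolution G U' φ := fun x hx ψ hψ hmin => by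
  rw [IsLocalMinOn, IsMinFilter, hU'.nhdsWithin_eq hx] at hmin
  exact h x (hU hx) ψ hψ (hmin.filter_mono nhdsWithin_le_nhds)

theorem IsViscositySupersolution.of_le (h : IsViscositySupersolution G U φ)
    (hle : ∀ x ∈ U, ∀ p X, G x (φ x) p X ≤ G' x (φ x) p X) : IsViscositySupersolution G' U φ :=
  fun x hx ψ hψ hmin => (h x hx ψ hψ hmin).trans (hle x hx _ _)

theorem maximumPrinciple_of_supersolution (hα : 0 < α) (hl : 0 < l) (hΩo : IsOpen Ω)
    (hΩ : Bornology.IsBounded Ω) (hcone : ∀ z ∈ frontier Ω, HasInwardCone Ω z)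
    (hΩO : closure Ω ⊆ O) (hV : IsOpen V) (hVΩ : frontier Ω ⊆ V) (hF : IsContinuousOperator F O)
    (h_hom : IsHomogeneous F O α) (h_val : IsUniformlyContinuousInValue F O)
    (h_struct : StructureCondition F O) (h_unif : IsUniformlyContinuousNear F (closure Ω ∩ V))
    (h_bdry : BoundaryStructureCondition F (closure Ω ∩ V)) {β : ℝ} (hβ : 0 < β)
    (h_barrier : ∀ ξ ∈ frontier Ω, HasBarrier F Ω ξ β) (hφ : LowerSemicontinuousOn φ Ω) {c : ℝ}
    (hc : 0 < c) (hcφ : ∀ x ∈ Ω, c ≤ φ x)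
    (hsuper : IsViscositySupersolution (shifted F α l) Ω φ) : MaximumPrinciple F Ω := by
  intro u hu hsub x hx
  have hfr : ∀ ξ ∈ frontier Ω, u ξ ≤ 0 := fun ξ hξ =>
    hsub.nonpos_of_barrier hα hβ hΩo hΩ hcone hΩO (hV.mem_nhds (hVΩ hξ)) hF h_hom h_unif h_bdry hu
      (frontier_subset_closure hξ) (h_barrier ξ hξ)
  have hstrict : IsViscositySupersolution (fun x r p X => F x r p X - l * c ^ α) Ω φ :=
    hsuper.of_le fun y hy p X => by
      rw [shifted]
      gcongr
      exact hcφ y hy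
  have hpos := posExt_nonpos_of_frontier (by positivity) hΩo hΩ hΩO hF h_hom h_val h_struct hφ hc
    hcφ hstrict hu hsub hfr x
  rw [posExt_of_mem hx] at hpos
  exact (le_max_left _ _).trans hpos

/-- The operator `F[u] - l |u| ^ α`. It agrees with `shifted F α l` on positive functions; the
absolute value makes it continuous and homogeneous for functions of any sign. -/
def absShifted (F : Operator N) (α l : ℝ) : Operator N :=
  fun x r p X => F x r p X - l * |r| ^ α

theorem absShifted_of_pos (F : Operator N) (α l : ℝ) {r : ℝ} (hr : 0 < r) (x p : Eu N) (X : Mat N) :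
    absShifted F α l x r p X = shifted F α l x r p X := by
  rw [absShifted, shifted, abs_of_pos hr]

theorem absShifted_zero (F : Operator N) (α : ℝ) : absShifted F α 0 = F := by
  funext x r p X
  rw [absShifted, zero_mul, sub_zero]

theorem continuous_mul_abs_rpow (hα : 0 < α) (l : ℝ) : Continuous fun r : ℝ => l * |r| ^ α :=
  continuous_const.mul (continuous_abs.rpow_const fun _ => Or.inr hα.le)

theorem IsContinuousOperator.absShifted (hα : 0 < α) (h : IsContinuousOperator F O) (l : ℝ) :
    IsContinuousOperator (absShifted F α l) O :=
  ContinuousOn.sub h ((continuous_mul_abs_rpow hα l).comp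
    (continuous_fst.comp continuous_snd)).continuousOn

theorem IsDegenerateElliptic.absShifted (α l : ℝ) (h : IsDegenerateElliptic F O) :
    IsDegenerateElliptic (absShifted F α l) O := fun x hx r p X Y hX hY hYp =>
  (sub_sub_sub_cancel_right _ _ _).trans_le (h x hx r p X Y hX hY hYp)

theorem IsHomogeneous.absShifted (l : ℝ) (h : IsHomogeneous F O α) :
    IsHomogeneous (absShifted F α l) O α := fun x hx r p X hX τ hτ => by
  simp only [DegElliptic.absShifted]
  rw [h x hx r p X hX τ hτ, abs_mul, abs_of_nonneg hτ, Real.mul_rpow hτ (abs_nonneg r)]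
  ring

theorem IsUniformlyContinuousInValue.absShifted (hα : 0 < α) (l : ℝ)
    (h : IsUniformlyContinuousInValue F O) :
    IsUniformlyContinuousInValue (absShifted F α l) O := by
  intro r ε hε
  obtain ⟨δF, hδF, hF⟩ := h r (ε / 2) (half_pos hε)
  obtain ⟨δ, hδ, hpow⟩ := Metric.continuous_iff.1 (continuous_mul_abs_rpow hα l) r (ε / 2)
    (half_pos hε)
  refine ⟨min δF δ, lt_min hδF hδ, fun s hs x hx p X hX => ?_⟩
  calc |F x s p X - l * |s| ^ α - (F x r p X - l * |r| ^ α)|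
      ≤ |F x s p X - F x r p X| + |l * |s| ^ α - l * |r| ^ α| := by
        rw [sub_sub_sub_comm]
        exact abs_sub _ _
    _ < ε / 2 + ε / 2 := add_lt_add (hF s (hs.trans_le (min_le_left _ _)) x hx p X hX)
        (hpow s (hs.trans_le (min_le_right _ _)))
    _ = ε := add_halves ε

theorem StructureCondition.absShifted (α l : ℝ) (h : StructureCondition F O) :
    StructureCondition (absShifted F α l) O := fun R hR =>
  have ⟨mod, hmod, hmod0, hFmod⟩ := h R hR
  ⟨mod, hmod, hmod0, fun X Y hX hY σ hσ hXY x hx y hy r hr =>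
    (sub_sub_sub_cancel_right _ _ _).trans_le (hFmod X Y hX hY σ hσ hXY x hx y hy r hr)⟩

theorem BoundaryStructureCondition.absShifted (α l : ℝ) (h : BoundaryStructureCondition F A) :
    BoundaryStructureCondition (absShifted F α l) A := fun R hR =>
  have ⟨K, hK, hFK⟩ := h R hR
  ⟨K, hK, fun X Y hX hY σ hσ hXY x hx y hy r hr p =>
    (sub_sub_sub_cancel_right _ _ _).trans_le (hFK X Y hX hY σ hσ hXY x hx y hy r hr p)⟩

theorem IsUniformlyContinuousNear.absShifted (hα : 0 < α) (l : ℝ)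
    (h : IsUniformlyContinuousNear F A) : IsUniformlyContinuousNear (absShifted F α l) A := by
  intro R hR ε hε
  obtain ⟨δF, hδF, hF⟩ := h R hR (ε / 2) (half_pos hε)
  obtain ⟨δ, hδ, hpow⟩ := Metric.uniformContinuousOn_iff.1
    ((isCompact_Icc (a := (0 : ℝ)) (b := R)).uniformContinuousOn_of_continuous
      (continuous_mul_abs_rpow hα l).continuousOn) (ε / 2) (half_pos hε)
  refine ⟨min δF δ, lt_min hδF hδ, fun x hx r hr s hs p q X Y hX hY hrs hpq hXY => ?_⟩
  calc |F x r p X - l * |r| ^ α - (F x s q Y - l * |s| ^ α)|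
      ≤ |F x r p X - F x s q Y| + |l * |r| ^ α - l * |s| ^ α| := by
        rw [sub_sub_sub_comm]
        exact abs_sub _ _
    _ < ε / 2 + ε / 2 := add_lt_add
        (hF x hx r hr s hs p q X Y hX hY (hrs.trans_le (min_le_left _ _))
          (hpq.trans_le (min_le_left _ _)) fun i j => (hXY i j).trans_le (min_le_left _ _))
        (hpow r hr s hs (hrs.trans_le (min_le_right _ _)))
    _ = ε := add_halves ε

theorem AdmitsBarrier.absShifted (hα : 0 < α) (l : ℝ) (hΩ : IsOpen Ω) (hξ : ξ ∈ closure Ω)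
    (h : AdmitsBarrier F Ω ξ) : HasBarrier (absShifted F α l) Ω ξ (1 / 2) := by
  obtain ⟨ρ, hρ, w, hw, hw0, hwξ, hsuper⟩ := h
  have hξball : ξ ∈ closure (Ω ∩ Metric.ball ξ ρ) := by
    rw [Set.inter_comm]
    exact Metric.isOpen_ball.inter_closure ⟨Metric.mem_ball_self hρ, hξ⟩
  have hlim : Tendsto ((fun r => l * |r| ^ α) ∘ w) (𝓝[closure (Ω ∩ Metric.ball ξ ρ)] ξ) (𝓝 0) := by
    simpa only [hwξ, abs_zero, Real.zero_rpow hα.ne', mul_zero] using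
      ((continuous_mul_abs_rpow hα l).tendsto (w ξ)).comp (hw ξ hξball)
  obtain ⟨ρ', hρ', hsmall⟩ := Metric.eventually_nhds_iff_ball.1
    (eventually_nhdsWithin_iff.1 (hlim.eventually_lt_const one_half_pos))
  have hball : Ω ∩ Metric.ball ξ (min ρ ρ') ⊆ Ω ∩ Metric.ball ξ ρ :=
    Set.inter_subset_inter_right _ (Metric.ball_subset_ball (min_le_left _ _))
  refine ⟨min ρ ρ', lt_min hρ hρ', w, hw.mono (closure_mono hball),
    fun x hx => hw0 x (closure_mono hball hx), hwξ,
    (hsuper.mono (hΩ.inter Metric.isOpen_ball) hball).of_le fun x hx p X => ?_⟩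
  have hlt : l * |w x| ^ α < 1 / 2 :=
    hsmall x (Metric.ball_subset_ball (min_le_right _ _) hx.2) (subset_closure (hball hx))
  simp only [DegElliptic.absShifted]
  linarith

end AbsShifted

section Eigenvalues

variable {F : Operator N} {O Ω V : Set (Eu N)} {α m : ℝ}

theorem mu_le_lambdaBar (hΩo : IsOpen Ω) (hΩ : Bornology.IsBounded Ω) :
    mu F α O Ω ≤ lambdaBar F α Ω := by
  refine sSup_le_sSup (Set.image_mono ?_)
  rintro l ⟨Ω', -, hΩΩ', -, φ, hφ, hpos, hsuper⟩
  have hsub : Ω ⊆ Ω' := subset_closure.trans hΩΩ'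
  refine ⟨φ, hφ.mono hsub, ?_, hsuper.mono hΩo hsub⟩
  rcases (closure Ω).eq_empty_or_nonempty with hempty | hne
  · rw [closure_empty_iff] at hempty
    exact ⟨1, one_pos, by simp [hempty]⟩
  · obtain ⟨z, hz, hmin⟩ := (hφ.mono hΩΩ').exists_isMinOn hne hΩ.isCompact_closure
    exact ⟨φ z, hpos z (hΩΩ' hz), fun x hx => hmin (subset_closure hx)⟩

theorem maximumPrinciple_absShifted_of_lt_lambdaBar (hα : 0 < α) (hΩo : IsOpen Ω)
    (hΩ : Bornology.IsBounded Ω) (hcone : ∀ z ∈ frontier Ω, HasInwardCone Ω z)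
    (hΩO : closure Ω ⊆ O) (hV : IsOpen V) (hVΩ : frontier Ω ⊆ V) (hF : IsContinuousOperator F O)
    (h_hom : IsHomogeneous F O α) (h_val : IsUniformlyContinuousInValue F O)
    (h_struct : StructureCondition F O) (h_unif : IsUniformlyContinuousNear F (closure Ω ∩ V))
    (h_bdry : BoundaryStructureCondition F (closure Ω ∩ V))
    (h_barrier : ∀ ξ ∈ frontier Ω, AdmitsBarrier F Ω ξ) (hm : (m : EReal) < lambdaBar F α Ω) :
    MaximumPrinciple (absShifted F α m) Ω := by
  obtain ⟨_, ⟨l, ⟨φ, hφ, ⟨c, hc, hcφ⟩, hsuper⟩, rfl⟩, hml⟩ := lt_sSup_iff.1 hm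
  have hshift : IsViscositySupersolution (shifted (absShifted F α m) α (l - m)) Ω φ :=
    hsuper.of_le fun x hx p X => by
      rw [shifted, shifted, absShifted_of_pos F α m (hc.trans_le (hcφ x hx)), shifted]
      linarith
  exact maximumPrinciple_of_supersolution hα (sub_pos.2 (EReal.coe_lt_coe_iff.1 hml)) hΩo hΩ hcone
    hΩO hV hVΩ (hF.absShifted hα m) (h_hom.absShifted m) (h_val.absShifted hα m)
    (h_struct.absShifted α m) (h_unif.absShifted hα m) (h_bdry.absShifted α m) one_half_pos
    (fun ξ hξ => (h_barrier ξ hξ).absShifted hα m hΩo (frontier_subset_closure hξ)) hφ hc hcφ hshift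

theorem lt_mu_of_maximumPrinciple_absShifted (hα : 0 < α) (hΩo : IsOpen Ω)
    (hΩ : Bornology.IsBounded Ω) (hO : IsOpen O) (hΩO : closure Ω ⊆ O)
    (hF : IsContinuousOperator F O) (h_ell : IsDegenerateElliptic F O)
    (h_hom : IsHomogeneous F O α) (hMP : MaximumPrinciple (absShifted F α m) Ω) :
    (m : EReal) < mu F α O Ω := by
  obtain ⟨ε, hε, Ω', hΩ', hΩΩ', hΩ'O, φ, hφ, hpos, hle, hsuper⟩ :=
    exists_supersolution_of_maximumPrinciple hΩo hΩ hO hΩO (hF.absShifted hα m)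
      (h_ell.absShifted α m) (fun _ hx => (h_hom.absShifted m).apply_zero hα hx) hMP
  have hshift : IsViscositySupersolution (shifted F α (m + ε)) Ω' φ :=
    hsuper.of_le fun x hx p X => by
      have hφα : ε * φ x ^ α ≤ ε :=
        mul_le_of_le_one_right hε.le (Real.rpow_le_one (hpos x hx).le (hle x) hα.le)
      rw [absShifted_of_pos F α m (hpos x hx), shifted, shifted]
      linarith
  exact (EReal.coe_lt_coe_iff.2 (lt_add_of_pos_right m hε)).trans_le (le_sSup
    ⟨m + ε, ⟨Ω', hΩ', hΩΩ', hΩ'O, φ, hφ.lowerSemicontinuousOn Ω', hpos, hshift⟩, rfl⟩)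

end Eigenvalues

end DegElliptic

end

theorem theorem4p2_general {N : ℕ} (Ω O V : Set (DegElliptic.Eu N))
    (hΩ_open : IsOpen Ω) (hΩ_bdd : Bornology.IsBounded Ω)
    (hΩ_cone : ∀ z ∈ frontier Ω, DegElliptic.HasInwardCone Ω z)
    (hO : IsOpen O) (hΩO : closure Ω ⊆ O)
    (hV : IsOpen V) (hVΩ : frontier Ω ⊆ V)
    (F : DegElliptic.Operator N) (α : ℝ) (hα : 0 < α)
    (hF : DegElliptic.IsContinuousOperator F O)
    (h_ell : DegElliptic.IsDegenerateElliptic F O)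
    (h_hom : DegElliptic.IsHomogeneous F O α)
    (h_val : DegElliptic.IsUniformlyContinuousInValue F O)
    (h_struct : DegElliptic.StructureCondition F O)
    (h_unif : DegElliptic.IsUniformlyContinuousNear F (closure Ω ∩ V))
    (h_bdry : DegElliptic.BoundaryStructureCondition F (closure Ω ∩ V))
    (h_barrier : ∀ ξ ∈ frontier Ω, DegElliptic.AdmitsBarrier F Ω ξ) :
    DegElliptic.mu F α O Ω = DegElliptic.lambdaBar F α Ω ∧
      (DegElliptic.MaximumPrinciple F Ω ↔ 0 < DegElliptic.lambdaBar F α Ω) := by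
  have maximumPrinciple_of_lt : ∀ m : ℝ, (m : EReal) < DegElliptic.lambdaBar F α Ω →
      DegElliptic.MaximumPrinciple (DegElliptic.absShifted F α m) Ω := fun m =>
    DegElliptic.maximumPrinciple_absShifted_of_lt_lambdaBar hα hΩ_open hΩ_bdd hΩ_cone hΩO hV hVΩ hF
      h_hom h_val h_struct h_unif h_bdry h_barrier
  have lt_of_maximumPrinciple : ∀ m : ℝ,
      DegElliptic.MaximumPrinciple (DegElliptic.absShifted F α m) Ω →
      (m : EReal) < DegElliptic.mu F α O Ω := fun m =>
    DegElliptic.lt_mu_of_maximumPrinciple_absShifted hα hΩ_open hΩ_bdd hO hΩO hF h_ell h_hom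
  have hle := DegElliptic.mu_le_lambdaBar (F := F) (α := α) (O := O) hΩ_open hΩ_bdd
  have shift_zero := DegElliptic.absShifted_zero F α
  exact ⟨hle.antisymm (EReal.ge_of_forall_gt_iff_ge.1 fun m hm =>
      (lt_of_maximumPrinciple m (maximumPrinciple_of_lt m hm)).le),
    fun hMP => (lt_of_maximumPrinciple 0 (shift_zero.symm ▸ hMP)).trans_le hle,
    fun hpos => shift_zero ▸ maximumPrinciple_of_lt 0 hpos⟩

theorem theorem4p2 {N : ℕ} (Ω O V : Set (DegElliptic.Eu N))
    (hΩ_open : IsOpen Ω) (hΩ_conn : IsConnected Ω) (hΩ_bdd : Bornology.IsBounded Ω)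
    (hΩ_smooth : DegElliptic.HasSmoothBoundary Ω)
    (hO : IsOpen O) (hΩO : closure Ω ⊆ O)
    (hV : IsOpen V) (hVΩ : frontier Ω ⊆ V)
    (F : DegElliptic.Operator N) (α : ℝ) (hα : 0 < α)
    (hF : DegElliptic.IsContinuousOperator F O)
    (h_ell : DegElliptic.IsDegenerateElliptic F O)
    (h_hom : DegElliptic.IsHomogeneous F O α)
    (h_val : DegElliptic.IsUniformlyContinuousInValue F O)
    (h_struct : DegElliptic.StructureCondition F O)
    (h_unif : DegElliptic.IsUniformlyContinuousNear F (closure Ω ∩ V))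
    (h_bdry : DegElliptic.BoundaryStructureCondition F (closure Ω ∩ V))
    (h_barrier : ∀ ξ ∈ frontier Ω, DegElliptic.AdmitsBarrier F Ω ξ) :
    DegElliptic.mu F α O Ω = DegElliptic.lambdaBar F α Ω ∧
      (DegElliptic.MaximumPrinciple F Ω ↔ 0 < DegElliptic.lambdaBar F α Ω) := by
  exact theorem4p2_general Ω O V hΩ_open hΩ_bdd (fun _ hz => hΩ_smooth.hasInwardCone hz) hO hΩO hV
    hVΩ F α hα hF h_ell h_hom h_val h_struct h_unif h_bdry h_barrier
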